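/- Let $[n]=\{1,\dots,n\}$. Order the $k$-element subsets of $[n]$ lexicographically: $A$ precedes $B$ if $A\ne B$ and $\min(A\triangle B)\in A$. Let $\mathcal L_{n,k}(m)$ be the family of the first $m$ sets in this order. A family of sets is intersecting if no two of its members are disjoint. For a family $\mathcal F$ and $p\in[0,1]$, let $\mathcal F_p$ be the random subfamily of $\mathcal F$ in which each member of $\mathcal F$ is retained independently with probability $p$. **Corollary.** Let $k\ge 1$ and $\ell\ge 0$ be integers. There is $n_0=n_0(k,\ell)$ such that for all $n\ge n_0$ and all integers $m$ with $$\binom nk-\binom{n-\ell}k\;\le\; m\;\le\;\binom nk-\binom{n-\ell}k+n-\ell-k+1,$$ the family $\mathcal L_{n,k}(m)$ is a most probably intersecting $k$-uniform family of $m$ subsets of $[n]$, for every $p$: it consists of $m$ sets, and for every $p\in[0,1]$ and every family $\mathcal F$ of $m$ distinct $k$-element subsets of $[n]$, $$\mathbb P\big(\mathcal F_p\text{ is intersecting}\big)\;\le\;\mathbb P\big(\mathcal L_{n,k}(m)_p\text{ is intersecting}\big).$$ -/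

import Mathlib

/-- The strict lexicographic order on finite subsets of the ground set `Fin n`:
`A` precedes `B` when `A ≠ B` and the least element of the symmetric difference lies in `A`. -/
def LexBefore {n : ℕ} (A B : Finset (Fin n)) : Prop :=
  ∃ h : (symmDiff A B).Nonempty, (symmDiff A B).min' h ∈ A

open scoped Classical in
/-- The initial segment of length `m` of the lexicographic order on the `k`-element subsets of
`Fin n`: the `k`-sets that have fewer than `m` predecessors among the `k`-sets. -/
noncomputable def lexInitialSegment (n k m : ℕ) : Finset (Finset (Fin n)) :=
  {A ∈ Finset.powersetCard k Finset.univ |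
    ({B ∈ Finset.powersetCard k Finset.univ | LexBefore B A} : Finset (Finset (Fin n))).card < m}

/-- The probability that the random subfamily of `F`, in which every member of `F` is retained
independently with probability `p`, is intersecting. -/
noncomputable def probIntersecting {n : ℕ} (F : Finset (Finset (Fin n))) (p : unitInterval) : ℝ :=
  (ProbabilityTheory.setBernoulli (F : Set (Finset (Fin n))) p).real
    {G : Set (Finset (Fin n)) | G.Intersecting}

/-- `F` is a `k`-uniform family of `m` subsets of `Fin n` and, among all such families, it
maximises the probability that the random `p`-subfamily is intersecting. -/
def IsMostProbablyIntersecting {n : ℕ} (k m : ℕ) (p : unitInterval)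
    (F : Finset (Finset (Fin n))) : Prop :=
  F ∈ Finset.powersetCard m (Finset.powersetCard k Finset.univ) ∧
    ∀ F' ∈ Finset.powersetCard m (Finset.powersetCard k (Finset.univ : Finset (Fin n))),
      probIntersecting F' p ≤ probIntersecting F p

/-! With `x = p / (1 - p)`, the probability that the random subfamily of `F` is intersecting is `(1
- p) ^ #F` times `intWeight x F`, the sum of `x ^ #G` over the intersecting `G ⊆ F`. So for families
of `m` sets it suffices to compare these polynomials for every `x ≥ 0`. In the stated range the
lexicographic segment is `hitFam k Y ∪ sunflower K T`: all `k`-sets meeting an `ℓ`-set `Y`, plus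
sets through a common `(k-1)`-set `K`. If `k = 1` or `ℓ = 0` the comparison is immediate. Otherwise
it has three stages, with `N` the number of `k`-sets through one point.

Stability (`intWeight_le_of_few_full_stars`). Most intersecting families with at least two members
are stars, so up to a small error `intWeight x F` is `1 + #F * x` plus the sum of `excess x d` over
the large degrees `d`. Since `excess` is convex and the degree sum is almost fixed, having fewer
than `ℓ` nearly full stars costs more than all errors together.

Completion (`exists_full_of_nearly_full`, `intWeight_le_of_nearly_full_two`). With `ℓ` nearly full
stars, a member missing their centres meets fewer members than a star contains, so exchanging it for
a missing set of a star does not decrease the weight. For `k = 2` the remainder can be as large as a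
star; exchanging then stops either with full stars or with a graph covered by `ℓ + 1` points, which
is handled by induction on the number of missing edges.

Remainder (`intWeight_hitFam_union_le`). Conditioning on the trace `S` on the remainder leaves the
sets of `hitFam k Y` that meet every member of `S`. If `S` is not a sunflower with kernel of size `k
- 1`, these sets meet a core `C` of size at most `k - 2` or have two points in a bounded set `B`. By
`intWeight_hitOrPair_le` all pairs in `B` are worth less than one new core point, so a sunflower
with the larger kernel does at least as well.

The estimates hold for all `x` simultaneously because powers of `x` are never bounded by constants:
Bernoulli's inequality `n * x ≤ (1 + x) ^ n - 1` turns them into exponents, and the argument becomes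
a count of exponents. -/

open Finset

/-! ### Generating functions of collections of finite sets, and certificate bounds -/

section Weights

variable {β γ ι : Type*}

/-- The generating function of a collection of finite sets, weighted by cardinality. -/
def famWeight (x : ℝ) (𝒢 : Finset (Finset β)) : ℝ := ∑ G ∈ 𝒢, x ^ #G

theorem famWeight_nonneg {x : ℝ} (hx : 0 ≤ x) (𝒢 : Finset (Finset β)) : 0 ≤ famWeight x 𝒢 :=
  sum_nonneg fun _ _ => pow_nonneg hx _

theorem famWeight_powerset (x : ℝ) (D : Finset β) : famWeight x D.powerset = (1 + x) ^ #D := by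
  have := Finset.sum_pow_mul_eq_add_pow x 1 D
  simp only [one_pow, mul_one] at this
  rw [famWeight, this, add_comm]

theorem famWeight_mono {x : ℝ} (hx : 0 ≤ x) {𝒢 ℋ : Finset (Finset β)} (h : 𝒢 ⊆ ℋ) :
    famWeight x 𝒢 ≤ famWeight x ℋ :=
  sum_le_sum_of_subset_of_nonneg h fun _ _ _ => pow_nonneg hx _

theorem famWeight_le_of_injOn {x : ℝ} (hx : 0 ≤ x) {𝒢 : Finset (Finset β)}
    {ℋ : Finset (Finset γ)} (Φ : Finset β → Finset γ) (hmaps : ∀ G ∈ 𝒢, Φ G ∈ ℋ)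
    (hinj : Set.InjOn Φ 𝒢) (hcard : ∀ G ∈ 𝒢, #(Φ G) = #G) :
    famWeight x 𝒢 ≤ famWeight x ℋ := by
  classical
  calc famWeight x 𝒢 = ∑ G ∈ 𝒢, x ^ #(Φ G) := sum_congr rfl fun G hG => by rw [hcard G hG]
    _ = ∑ G ∈ 𝒢.image Φ, x ^ #G := (sum_image (f := fun G => x ^ #G) hinj).symm
    _ ≤ famWeight x ℋ := famWeight_mono hx (by
        intro G hG
        obtain ⟨G', hG', rfl⟩ := mem_image.1 hG
        exact hmaps _ hG')

/-- There are at most `#X ^ j` subsets of size `j`. -/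
theorem sum_pow_card_le {x : ℝ} (hx : 0 ≤ x) (X : Finset β) (s : ℕ) :
    ∑ S ∈ X.powerset with #S ≤ s, x ^ #S ≤ ∑ j ∈ range (s + 1), (#X * x) ^ j := by
  rw [← sum_fiberwise_of_maps_to (g := card) (t := range (s + 1))
    (fun S hS => by simpa [Nat.lt_succ_iff] using (mem_filter.1 hS).2)]
  refine sum_le_sum fun j _ => ?_
  calc _ = ∑ S ∈ ({S ∈ ({S ∈ X.powerset | #S ≤ s} : Finset (Finset β)) | #S = j}), x ^ j :=
        sum_congr rfl fun S hS => by rw [(mem_filter.1 hS).2]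
    _ ≤ ∑ S ∈ X.powersetCard j, x ^ j := by
        refine sum_le_sum_of_subset_of_nonneg (fun S hS => ?_) fun _ _ _ => pow_nonneg hx _
        simp only [mem_filter, mem_powerset] at hS
        exact mem_powersetCard.2 ⟨hS.1.1, hS.2⟩
    _ ≤ _ := by
        rw [sum_const, card_powersetCard, nsmul_eq_mul, mul_pow]
        gcongr
        exact_mod_cast Nat.choose_le_pow _ _

variable [DecidableEq β]

theorem famWeight_union_le {x : ℝ} (hx : 0 ≤ x) (𝒢 ℋ : Finset (Finset β)) :
    famWeight x (𝒢 ∪ ℋ) ≤ famWeight x 𝒢 + famWeight x ℋ := by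
  rw [famWeight, famWeight, famWeight, ← sum_union_inter]
  exact le_add_of_nonneg_right (sum_nonneg fun _ _ => pow_nonneg hx _)

theorem famWeight_biUnion_le {x : ℝ} (hx : 0 ≤ x) (s : Finset ι) (f : ι → Finset (Finset β)) :
    famWeight x (s.biUnion f) ≤ ∑ i ∈ s, famWeight x (f i) := by
  classical
  induction s using Finset.induction_on with
  | empty => simp [famWeight]
  | insert a s ha ih =>
    rw [biUnion_insert, sum_insert ha]
    exact (famWeight_union_le hx _ _).trans (by gcongr)

/-- The part of the powerset lying between `A` and `A ∪ B` has weight at most `x^|A| (1+x)^|B|`. -/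
theorem famWeight_interval_le {x : ℝ} (hx : 0 ≤ x) {A B : Finset β} {𝒢 : Finset (Finset β)}
    (h : ∀ G ∈ 𝒢, A ⊆ G ∧ G ⊆ A ∪ B) : famWeight x 𝒢 ≤ x ^ #A * (1 + x) ^ #B := by
  calc famWeight x 𝒢 = ∑ G ∈ 𝒢, x ^ #A * x ^ #(G \ A) := by
        refine sum_congr rfl fun G hG => ?_
        rw [← pow_add, add_comm, card_sdiff_add_card_eq_card (h G hG).1]
    _ = x ^ #A * ∑ G ∈ 𝒢, x ^ #(G \ A) := by rw [mul_sum]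
    _ ≤ x ^ #A * (1 + x) ^ #B := by
        gcongr
        rw [← famWeight_powerset]
        have hinj : Set.InjOn (fun G => G \ A) (𝒢 : Set (Finset β)) := by
          intro G hG G' hG' he
          have h1 := (h G hG).1
          have h2 := (h G' hG').1
          rw [← sdiff_union_of_subset h1, ← sdiff_union_of_subset h2]
          simpa using congrArg (· ∪ A) he
        rw [← sum_image (f := fun G => x ^ #G) hinj]
        refine famWeight_mono hx fun G hG => ?_
        obtain ⟨G', hG', rfl⟩ := mem_image.1 hG
        rw [mem_powerset]
        intro a ha
        rw [mem_sdiff] at ha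
        exact (mem_union.1 ((h G' hG').2 ha.1)).resolve_left ha.2

/-- A collection each of whose members is squeezed between `A i` and `A i ∪ B i` for some index. -/
theorem famWeight_le_of_cert {x : ℝ} (hx : 0 ≤ x) {𝒢 : Finset (Finset β)} (I : Finset ι)
    (A B : ι → Finset β) (h : ∀ G ∈ 𝒢, ∃ i ∈ I, A i ⊆ G ∧ G ⊆ A i ∪ B i) :
    famWeight x 𝒢 ≤ ∑ i ∈ I, x ^ #(A i) * (1 + x) ^ #(B i) := by
  classical
  calc famWeight x 𝒢
      ≤ famWeight x (I.biUnion fun i => {G ∈ 𝒢 | A i ⊆ G ∧ G ⊆ A i ∪ B i}) := by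
        refine famWeight_mono hx fun G hG => ?_
        obtain ⟨i, hi, h1, h2⟩ := h G hG
        exact mem_biUnion.2 ⟨i, hi, mem_filter.2 ⟨hG, h1, h2⟩⟩
    _ ≤ _ := famWeight_biUnion_le hx _ _
    _ ≤ _ := sum_le_sum fun i _ => famWeight_interval_le hx fun G hG => (mem_filter.1 hG).2

end Weights

/-! ### Intersecting subfamilies and their generating function -/

section Intersecting

variable {α : Type*} [DecidableEq α]

open scoped Classical in
/-- The intersecting subfamilies of a family. -/
noncomputable def intFamilies (F : Finset (Finset α)) : Finset (Finset (Finset α)) :=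
  {G ∈ F.powerset | (G : Set (Finset α)).Intersecting}

/-- The generating function of the intersecting subfamilies of a family. -/
noncomputable def intWeight (x : ℝ) (F : Finset (Finset α)) : ℝ := famWeight x (intFamilies F)

theorem mem_intFamilies {F G : Finset (Finset α)} :
    G ∈ intFamilies F ↔ G ⊆ F ∧ (G : Set (Finset α)).Intersecting := by
  simp [intFamilies]

theorem intFamilies_mono {F F' : Finset (Finset α)} (h : F ⊆ F') :
    intFamilies F ⊆ intFamilies F' := fun _ hG =>
  mem_intFamilies.2 ⟨(mem_intFamilies.1 hG).1.trans h, (mem_intFamilies.1 hG).2⟩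

theorem intWeight_mono {x : ℝ} (hx : 0 ≤ x) {F F' : Finset (Finset α)} (h : F ⊆ F') :
    intWeight x F ≤ intWeight x F' := famWeight_mono hx (intFamilies_mono h)

theorem intWeight_le_pow {x : ℝ} (hx : 0 ≤ x) (F : Finset (Finset α)) :
    intWeight x F ≤ (1 + x) ^ #F := by
  rw [← famWeight_powerset]
  exact famWeight_mono hx fun G hG => mem_powerset.2 (mem_intFamilies.1 hG).1

theorem intWeight_of_intersecting (x : ℝ) {F : Finset (Finset α)}
    (h : (F : Set (Finset α)).Intersecting) : intWeight x F = (1 + x) ^ #F := by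
  rw [← famWeight_powerset, intWeight]
  congr 1
  ext G
  rw [mem_intFamilies, mem_powerset]
  exact ⟨fun h => h.1, fun hG => ⟨hG, h.mono (by exact_mod_cast hG)⟩⟩

/-- An injection between families that keeps intersecting pairs intersecting. -/
theorem intWeight_le_of_injOn {γ : Type*} [DecidableEq γ] {x : ℝ} (hx : 0 ≤ x)
    {F : Finset (Finset α)} {F' : Finset (Finset γ)} (φ : Finset α → Finset γ) (hmaps : ∀ A ∈ F, φ A ∈ F')
    (hinj : Set.InjOn φ F)
    (hint : ∀ A ∈ F, ∀ B ∈ F, ¬Disjoint A B → ¬Disjoint (φ A) (φ B)) :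
    intWeight x F ≤ intWeight x F' := by
  classical
  refine famWeight_le_of_injOn hx (fun G => G.image φ) ?_ ?_ ?_
  · intro G hG
    obtain ⟨h1, h2⟩ := mem_intFamilies.1 hG
    refine mem_intFamilies.2 ⟨fun A hA => ?_, ?_⟩
    · obtain ⟨B, hB, rfl⟩ := mem_image.1 hA
      exact hmaps _ (h1 hB)
    · intro A hA B hB
      obtain ⟨A', hA', rfl⟩ := mem_image.1 (mem_coe.1 hA)
      obtain ⟨B', hB', rfl⟩ := mem_image.1 (mem_coe.1 hB)
      exact hint _ (h1 hA') _ (h1 hB') (h2 (mem_coe.2 hA') (mem_coe.2 hB'))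
  · intro G hG G' hG' he
    have h1 := (mem_intFamilies.1 hG).1
    have h2 := (mem_intFamilies.1 hG').1
    exact image_injOn_powerset_of_injOn hinj (mem_coe.2 (mem_powerset.2 h1))
      (mem_coe.2 (mem_powerset.2 h2)) he
  · intro G hG
    exact card_image_of_injOn (hinj.mono (by exact_mod_cast (mem_intFamilies.1 hG).1))

end Intersecting

/-! ### From probabilities to generating functions -/

section Probability

variable {n : ℕ}

theorem probIntersecting_eq_sum (F : Finset (Finset (Fin n))) (p : unitInterval) :
    probIntersecting F p = ∑ G ∈ intFamilies F, (p : ℝ) ^ #G * (1 - p : ℝ) ^ (#F - #G) := by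
  classical
  have hset : {s ∈ {G : Set (Finset (Fin n)) | G.Intersecting} | s ⊆ (F : Set (Finset (Fin n)))}
      = (Finset.image (fun G : Finset (Finset (Fin n)) => (↑G : Set (Finset (Fin n))))
        (intFamilies F) : Set (Set (Finset (Fin n)))) := by
    ext s
    simp only [Set.mem_ofPred_eq, coe_image, Set.mem_image, mem_coe, mem_intFamilies]
    constructor
    · rintro ⟨h1, h2⟩
      lift s to Finset (Finset (Fin n)) using (F.finite_toSet.subset h2)
      exact ⟨s, ⟨by exact_mod_cast h2, h1⟩, rfl⟩
    · rintro ⟨G, ⟨h1, h2⟩, rfl⟩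
      exact ⟨h2, by exact_mod_cast h1⟩
  rw [probIntersecting, MeasureTheory.measureReal_def,
    ProbabilityTheory.setBernoulli_apply_eq_apply_subsets, ← MeasureTheory.measureReal_def, hset,
    ← MeasureTheory.sum_measureReal_singleton, sum_image (by simp)]
  refine sum_congr rfl fun G hG => ?_
  have hsub := (mem_intFamilies.1 hG).1
  rw [ProbabilityTheory.setBernoulli_real_singleton p (by exact_mod_cast hsub) F.finite_toSet,
    Set.ncard_coe_finset, ← coe_sdiff, Set.ncard_coe_finset, card_sdiff_of_subset hsub]

theorem probIntersecting_eq_intWeight (F : Finset (Finset (Fin n))) (p : unitInterval)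
    (hp : (p : ℝ) < 1) :
    probIntersecting F p = (1 - p : ℝ) ^ #F * intWeight ((p : ℝ) / (1 - p)) F := by
  have h1 : (0 : ℝ) < 1 - p := by linarith
  rw [probIntersecting_eq_sum, intWeight, famWeight, mul_sum]
  refine sum_congr rfl fun G hG => ?_
  have hle := card_le_card (mem_intFamilies.1 hG).1
  have h2 : (1 - p : ℝ) ^ #F = (1 - p : ℝ) ^ (#F - #G) * (1 - p : ℝ) ^ #G := by
    rw [← pow_add, Nat.sub_add_cancel hle]
  rw [h2, div_pow]
  field_simp

theorem continuous_probIntersecting (F : Finset (Finset (Fin n))) :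
    Continuous (probIntersecting F) := by
  have : probIntersecting F =
      fun p : unitInterval => ∑ G ∈ intFamilies F, (p : ℝ) ^ #G * (1 - p : ℝ) ^ (#F - #G) :=
    funext fun p => probIntersecting_eq_sum F p
  rw [this]
  fun_prop

/-- To compare intersection probabilities it suffices to compare generating functions. -/
theorem probIntersecting_le_of_intWeight_le {F F' : Finset (Finset (Fin n))} (hcard : #F = #F')
    (h : ∀ x : ℝ, 0 ≤ x → intWeight x F ≤ intWeight x F') (p : unitInterval) :
    probIntersecting F p ≤ probIntersecting F' p := by
  have hlt : ∀ q : unitInterval, (q : ℝ) < 1 → probIntersecting F q ≤ probIntersecting F' q := by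
    intro q hq
    rw [probIntersecting_eq_intWeight F q hq, probIntersecting_eq_intWeight F' q hq, hcard]
    have h1 : (0 : ℝ) ≤ 1 - q := by linarith
    exact mul_le_mul_of_nonneg_left (h _ (div_nonneg q.2.1 h1)) (pow_nonneg h1 _)
  -- The substitution `x = p / (1 - p)` breaks down only at `p = 1`, which continuity in `p`
  -- recovers.
  have hdense : Dense {q : unitInterval | (q : ℝ) < 1} := by
    have : {q : unitInterval | (q : ℝ) < 1} = {1}ᶜ := by
      ext q
      simp only [Set.mem_ofPred_eq, Set.mem_compl_iff, Set.mem_singleton_iff]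
      rw [← Subtype.coe_inj]
      exact ⟨fun h => h.ne, fun h => lt_of_le_of_ne q.2.2 h⟩
    rw [this]
    exact dense_compl_singleton 1
  have hclosed : IsClosed {q : unitInterval | probIntersecting F q ≤ probIntersecting F' q} :=
    isClosed_le (continuous_probIntersecting F) (continuous_probIntersecting F')
  have := hclosed.closure_subset_iff.2 (fun q hq => hlt q hq : {q : unitInterval | (q : ℝ) < 1} ⊆ _)
  exact this (hdense p)

end Probability

/-! ### The building blocks of the extremal family -/

section HitFamilies

variable {α : Type*} [Fintype α] [DecidableEq α]

/-- The `k`-sets meeting `Y`. -/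
def hitFam (k : ℕ) (Y : Finset α) : Finset (Finset α) :=
  {E ∈ powersetCard k univ | ¬Disjoint E Y}

theorem mem_hitFam {k : ℕ} {Y E : Finset α} : E ∈ hitFam k Y ↔ #E = k ∧ ¬Disjoint E Y := by
  simp [hitFam, mem_powersetCard]

theorem card_hitFam_add (k : ℕ) (Y : Finset α) :
    #(hitFam k Y) + (Fintype.card α - #Y).choose k = (Fintype.card α).choose k := by
  have h := card_filter_add_card_filter_not (s := powersetCard k (univ : Finset α))
    (fun E => ¬Disjoint E Y)
  rw [card_powersetCard, card_univ] at h
  rw [hitFam, ← h]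
  congr 1
  rw [← card_compl, ← card_powersetCard]
  congr 1
  ext E
  simp only [mem_powersetCard, mem_filter, not_not, subset_univ, true_and]
  rw [subset_compl_iff_disjoint_right, and_comm]

/-- The `k`-sets containing the `(k-1)`-set `K` and one further point from `T`. -/
def sunflower (K T : Finset α) : Finset (Finset α) := T.image fun t => insert t K

omit [Fintype α] in
theorem card_sunflower {K T : Finset α} (h : Disjoint K T) : #(sunflower K T) = #T := by
  refine card_image_of_injOn fun a ha b _ hab => ?_
  have ha' : a ∉ K := fun h' => disjoint_left.1 h h' (mem_coe.1 ha)
  have : a ∈ insert b K := by rw [← show insert a K = insert b K from hab]; simp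
  exact (mem_insert.1 this).resolve_right ha'

end HitFamilies

/-! ### Initial segments of the lexicographic order -/

section Lex

variable {n : ℕ}

theorem lexBefore_iff {A B : Finset (Fin n)} :
    LexBefore A B ↔ ∃ i, (∀ j < i, (j ∈ A ↔ j ∈ B)) ∧ i ∈ A ∧ i ∉ B := by
  constructor
  · rintro ⟨h, hA⟩
    refine ⟨_, fun j hj => ?_, hA, ?_⟩
    · have : j ∉ symmDiff A B := fun hmem => absurd (min'_le _ _ hmem) (not_le.2 hj)
      rw [mem_symmDiff] at this
      tauto
    · have := min'_mem _ h
      rw [mem_symmDiff] at this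
      tauto
  · rintro ⟨i, hlt, hA, hB⟩
    have hi : i ∈ symmDiff A B := mem_symmDiff.2 (Or.inl ⟨hA, hB⟩)
    have hmin : (symmDiff A B).min' ⟨i, hi⟩ = i := by
      refine le_antisymm (min'_le _ _ hi) (le_min' _ _ _ fun j hj => ?_)
      by_contra hji
      have := hlt j (not_le.1 hji)
      rw [mem_symmDiff] at hj
      tauto
    exact ⟨⟨i, hi⟩, by rw [hmin]; exact hA⟩

theorem LexBefore.irrefl (A : Finset (Fin n)) : ¬LexBefore A A := by
  rw [lexBefore_iff]
  rintro ⟨i, -, h, h'⟩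
  exact h' h

theorem LexBefore.trans {A B C : Finset (Fin n)} (h₁ : LexBefore A B) (h₂ : LexBefore B C) :
    LexBefore A C := by
  rw [lexBefore_iff] at *
  obtain ⟨i, hi, hiA, hiB⟩ := h₁
  obtain ⟨j, hj, hjB, hjC⟩ := h₂
  rcases lt_trichotomy i j with h | h | h
  · exact ⟨i, fun a ha => (hi a ha).trans (hj a (ha.trans h)), hiA, fun h' => hiB ((hj i h).2 h')⟩
  · subst h
    exact absurd hjB hiB
  · exact ⟨j, fun a ha => (hi a (ha.trans h)).trans (hj a ha), (hi j h).2 hjB, hjC⟩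

theorem lexBefore_total {A B : Finset (Fin n)} (h : A ≠ B) : LexBefore A B ∨ LexBefore B A := by
  have hne : (symmDiff A B).Nonempty := by
    rw [nonempty_iff_ne_empty]
    exact fun h' => h (symmDiff_eq_bot.1 h')
  have hne' : (symmDiff B A).Nonempty := by rwa [symmDiff_comm]
  have hmem := min'_mem _ hne
  rw [mem_symmDiff] at hmem
  rcases hmem with h1 | h1
  · exact Or.inl ⟨hne, h1.1⟩
  · refine Or.inr ⟨hne', ?_⟩
    have : (symmDiff B A).min' hne' = (symmDiff A B).min' hne := by simp only [symmDiff_comm]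
    rw [this]
    exact h1.1

open scoped Classical in
/-- In a finite strict linear order, exactly `m` elements have fewer than `m` predecessors. -/
theorem card_filter_card_lt {β : Type*} (s : Finset β) (r : β → β → Prop)
    (hirr : ∀ a, ¬r a a) (htrans : ∀ a b c, r a b → r b c → r a c)
    (htot : ∀ a b, a ≠ b → r a b ∨ r b a) {m : ℕ} (hm : m ≤ #s) :
    #{a ∈ s | #{b ∈ s | r b a} < m} = m := by
  set rk : β → ℕ := fun a => #{b ∈ s | r b a} with hrk
  have hlt : ∀ a ∈ s, ∀ b ∈ s, r b a → rk b < rk a := by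
    intro a ha b hb hab
    refine card_lt_card ⟨fun c hc => ?_, fun hsub => ?_⟩
    · rw [mem_filter] at hc ⊢
      exact ⟨hc.1, htrans _ _ _ hc.2 hab⟩
    · have := hsub (mem_filter.2 ⟨hb, hab⟩)
      exact hirr _ (mem_filter.1 this).2
  have hinj : Set.InjOn rk s := by
    intro a ha b hb hab
    by_contra hne
    rcases htot a b hne with h | h
    · exact absurd hab (hlt b hb a ha h).ne
    · exact absurd hab (hlt a ha b hb h).ne'
  have himg : s.image rk = range #s := by
    refine eq_of_subset_of_card_le (fun i hi => ?_) (by rw [card_range, card_image_of_injOn hinj])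
    obtain ⟨a, ha, rfl⟩ := mem_image.1 hi
    refine mem_range.2 (card_lt_card ⟨filter_subset _ _, fun hsub => ?_⟩)
    exact hirr _ (mem_filter.1 (hsub ha)).2
  have himg2 : ({a ∈ s | rk a < m} : Finset β).image rk = range m := by
    ext i
    simp only [mem_image, mem_filter, mem_range]
    constructor
    · rintro ⟨a, ⟨_, h⟩, rfl⟩
      exact h
    · intro hi
      have : i ∈ s.image rk := by rw [himg]; exact mem_range.2 (hi.trans_le hm)
      obtain ⟨a, ha, rfl⟩ := mem_image.1 this
      exact ⟨a, ⟨ha, hi⟩, rfl⟩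
  rw [← card_image_of_injOn (hinj.mono (by exact_mod_cast filter_subset _ s)), himg2, card_range]

open scoped Classical in
theorem mem_lexInitialSegment {k m : ℕ} {A : Finset (Fin n)} :
    A ∈ lexInitialSegment n k m ↔
      A ∈ powersetCard k univ ∧ #{B ∈ powersetCard k univ | LexBefore B A} < m := by
  rw [lexInitialSegment, mem_filter]

theorem card_lexInitialSegment {k m : ℕ} (hm : m ≤ n.choose k) :
    #(lexInitialSegment n k m) = m :=
  card_filter_card_lt (powersetCard k (univ : Finset (Fin n))) LexBefore LexBefore.irrefl
    (fun _ _ _ => LexBefore.trans) (fun _ _ => lexBefore_total) (m := m) (by simpa using hm)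

theorem subset_lexInitialSegment {k m : ℕ} {D : Finset (Finset (Fin n))}
    (hD : D ⊆ powersetCard k univ)
    (hinit : ∀ A ∈ D, ∀ B ∈ powersetCard k univ, B ∉ D → LexBefore A B) (hm : #D ≤ m) :
    D ⊆ lexInitialSegment n k m := by
  classical
  intro A hA
  refine mem_lexInitialSegment.2 ⟨hD hA, lt_of_lt_of_le (card_lt_card ⟨fun B hB => ?_, ?_⟩) hm⟩
  · rw [mem_filter] at hB
    by_contra hBD
    exact LexBefore.irrefl _ ((hinit A hA B hB.1 hBD).trans hB.2)
  · intro hsub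
    exact LexBefore.irrefl _ (mem_filter.1 (hsub hA)).2

theorem lexInitialSegment_subset {k m : ℕ} {D : Finset (Finset (Fin n))}
    (hD : D ⊆ powersetCard k univ)
    (hinit : ∀ A ∈ D, ∀ B ∈ powersetCard k univ, B ∉ D → LexBefore A B) (hm : m ≤ #D) :
    lexInitialSegment n k m ⊆ D := by
  classical
  intro A hA
  rw [mem_lexInitialSegment] at hA
  by_contra hAD
  refine absurd hA.2 (not_lt.2 (hm.trans (card_le_card fun B hB => ?_)))
  exact mem_filter.2 ⟨hD hB, hinit B hB A hA.1 hAD⟩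

/-- Just above the size of `ℓ` full stars, an initial segment of the lexicographic order consists
of `ℓ` full stars and a sunflower with a core of size `k - 1`. -/
theorem lexInitialSegment_eq_union {k ℓ m : ℕ} (hk : 1 ≤ k) (hn : ℓ + k ≤ n)
    (hm₁ : n.choose k ≤ m + (n - ℓ).choose k)
    (hm₂ : m + (n - ℓ).choose k + ℓ + k ≤ n.choose k + n + 1) :
    m ≤ n.choose k ∧ ∃ Y K T : Finset (Fin n), #Y = ℓ ∧ #K + 1 = k ∧ Disjoint Y K ∧ Disjoint Y T ∧
      Disjoint K T ∧ lexInitialSegment n k m = hitFam k Y ∪ sunflower K T := by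
  classical
  -- The first `ℓ` points, the next `k - 1`, and the remaining `n - ℓ - k + 1`. Both `hitFam k Y`
  -- and `hitFam k Y ∪ sunflower K V` are closed under predecessors, and `m` lies between their
  -- sizes, so the segment is squeezed between them.
  set Y : Finset (Fin n) := {i | (i : ℕ) < ℓ} with hY
  set K : Finset (Fin n) := {i | ℓ ≤ (i : ℕ) ∧ (i : ℕ) + 1 < ℓ + k} with hK
  set V : Finset (Fin n) := {i | ℓ + k ≤ (i : ℕ) + 1} with hV
  have hcard : ∀ a b : ℕ, b ≤ n → #({i : Fin n | a ≤ (i : ℕ) ∧ (i : ℕ) < b} : Finset (Fin n))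
      = b - a := by
    intro a b hb
    rw [← Nat.card_Ico, ← card_map Fin.valEmbedding]
    congr 1
    ext i
    simp only [mem_map, mem_filter, mem_univ, true_and, Fin.valEmbedding_apply, mem_Ico]
    constructor
    · rintro ⟨j, hj, rfl⟩
      exact hj
    · intro hi
      exact ⟨⟨i, by omega⟩, hi, rfl⟩
  have hYc : #Y = ℓ := by
    have := hcard 0 ℓ (by omega)
    simpa using this
  have hKc : #K + 1 = k := by
    have := hcard ℓ (ℓ + k - 1) (by omega)
    have h2 : K = ({i : Fin n | ℓ ≤ (i : ℕ) ∧ (i : ℕ) < ℓ + k - 1} : Finset (Fin n)) := by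
      ext i
      simp only [hK, mem_filter, mem_univ, true_and]
      omega
    rw [h2, this]
    omega
  have hVc : #V = n + 1 - ℓ - k := by
    have := hcard (ℓ + k - 1) n le_rfl
    have h2 : V = ({i : Fin n | ℓ + k - 1 ≤ (i : ℕ) ∧ (i : ℕ) < n} : Finset (Fin n)) := by
      ext i
      simp only [hV, mem_filter, mem_univ, true_and]
      omega
    rw [h2, this]
    omega
  have hYK : Disjoint Y K := by
    rw [disjoint_left]
    intro i hi hi'
    simp only [hY, hK, mem_filter, mem_univ, true_and] at hi hi'
    omega
  have hYV : Disjoint Y V := by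
    rw [disjoint_left]
    intro i hi hi'
    simp only [hY, hV, mem_filter, mem_univ, true_and] at hi hi'
    omega
  have hKV : Disjoint K V := by
    rw [disjoint_left]
    intro i hi hi'
    simp only [hK, hV, mem_filter, mem_univ, true_and] at hi hi'
    omega
  have hUc := card_hitFam_add k Y
  rw [Fintype.card_fin, hYc] at hUc
  have hUsub : hitFam k Y ⊆ powersetCard k univ := filter_subset _ _
  have hSsub : sunflower K V ⊆ powersetCard k univ := by
    intro E hE
    obtain ⟨t, ht, rfl⟩ := mem_image.1 hE
    rw [mem_powersetCard_univ, card_insert_of_notMem (fun h => disjoint_left.1 hKV h ht), hKc]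
  have hinitU : ∀ A ∈ hitFam k Y, ∀ B ∈ powersetCard k univ, B ∉ hitFam k Y → LexBefore A B := by
    intro A hA B hB hBU
    obtain ⟨-, hA2⟩ := mem_hitFam.1 hA
    have hB2 : Disjoint B Y := by
      by_contra h
      exact hBU (mem_hitFam.2 ⟨mem_powersetCard_univ.1 hB, h⟩)
    obtain ⟨y, hyA, hyY⟩ := not_disjoint_iff.1 hA2
    have hne : A.Nonempty := ⟨y, hyA⟩
    have hsm : ∀ j ≤ y, j ∈ Y := by
      intro j hj
      simp only [hY, mem_filter, mem_univ, true_and] at hyY ⊢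
      exact lt_of_le_of_lt (Fin.le_def.1 hj) hyY
    refine lexBefore_iff.2 ⟨A.min' hne, fun j hj => ?_, min'_mem _ _, fun h => ?_⟩
    · have h1 : j ∉ A := fun h => absurd (min'_le _ _ h) (not_le.2 hj)
      have h2 : j ∉ B := fun h => disjoint_left.1 hB2 h (hsm j (hj.le.trans (min'_le _ _ hyA)))
      tauto
    · exact disjoint_left.1 hB2 h (hsm _ (min'_le _ _ hyA))
  have hinitS : ∀ A ∈ hitFam k Y ∪ sunflower K V, ∀ B ∈ powersetCard k univ,
      B ∉ hitFam k Y ∪ sunflower K V → LexBefore A B := by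
    intro A hA B hB hBU
    rw [mem_union, not_or] at hBU
    rcases mem_union.1 hA with hA | hA
    · exact hinitU A hA B hB hBU.1
    obtain ⟨t, ht, rfl⟩ := mem_image.1 hA
    have hBc := mem_powersetCard_univ.1 hB
    have hB2 : Disjoint B Y := by
      by_contra h
      exact hBU.1 (mem_hitFam.2 ⟨hBc, h⟩)
    -- If `B` contained `K` and missed `Y`, its remaining point would lie in `V` and `B` would be a
    -- petal. So `B` omits a point of `K`, and the least such point is the first place where `B`
    -- differs from `insert t K`, because `t` comes after all of `K`.
    have hne : (K \ B).Nonempty := by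
      rw [sdiff_nonempty]
      intro hKB
      obtain ⟨b, hb, hbe⟩ : ∃ b, b ∉ K ∧ insert b K = B := by
        obtain ⟨b, hb⟩ := card_eq_one.1 (show #(B \ K) = 1 by
          rw [card_sdiff_of_subset hKB]; omega)
        have hb' : b ∈ B \ K := by rw [hb]; exact mem_singleton_self b
        exact ⟨b, (mem_sdiff.1 hb').2, by
          rw [insert_eq, ← hb, sdiff_union_of_subset hKB]⟩
      refine hBU.2 (mem_image.2 ⟨b, ?_, hbe⟩)
      have hbY : b ∉ Y := fun h => disjoint_left.1 hB2 (by rw [← hbe]; simp) h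
      simp only [hY, hK, hV, mem_filter, mem_univ, true_and] at hb hbY ⊢
      omega
    have hz := min'_mem _ hne
    set z := (K \ B).min' hne with hzdef
    rw [mem_sdiff] at hz
    have hzK := hz.1
    simp only [hK, mem_filter, mem_univ, true_and] at hzK
    simp only [hV, mem_filter, mem_univ, true_and] at ht
    refine lexBefore_iff.2 ⟨z, fun j hj => ?_, mem_insert_of_mem hz.1, hz.2⟩
    have hj' : (j : ℕ) < z := hj
    by_cases hjY : (j : ℕ) < ℓ
    · have h1 : j ∉ B := fun h => disjoint_left.1 hB2 h (by simpa [hY] using hjY)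
      have h2 : j ∉ insert t K := by
        simp only [mem_insert, hK, mem_filter, mem_univ, true_and, not_or]
        refine ⟨fun h => ?_, by omega⟩
        subst h
        omega
      tauto
    · have hjK : j ∈ K := by
        simp only [hK, mem_filter, mem_univ, true_and]
        omega
      have hjB : j ∈ B := by
        by_contra h
        exact absurd (min'_le _ _ (mem_sdiff.2 ⟨hjK, h⟩)) (not_le.2 hj)
      simp [hjK, hjB]
  have hdisj : Disjoint (hitFam k Y) (sunflower K V) := by
    rw [disjoint_left]
    intro E hE hE'
    obtain ⟨t, ht, rfl⟩ := mem_image.1 hE'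
    exact (mem_hitFam.1 hE).2 (disjoint_insert_left.2
      ⟨fun h => disjoint_left.1 hYV h ht, hYK.symm⟩)
  have hUS : #(hitFam k Y ∪ sunflower K V) = #(hitFam k Y) + (n + 1 - ℓ - k) := by
    rw [card_union_of_disjoint hdisj, card_sunflower hKV, hVc]
  have hUSle : #(hitFam k Y ∪ sunflower K V) ≤ n.choose k := by
    have := card_le_card (union_subset hUsub hSsub)
    simpa using this
  have hlow := subset_lexInitialSegment (m := m) hUsub hinitU (by omega)
  have hup := lexInitialSegment_subset (m := m) (union_subset hUsub hSsub) hinitS (by omega)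
  refine ⟨by omega, Y, K, {t ∈ V | insert t K ∈ lexInitialSegment n k m}, hYc, hKc, hYK,
    hYV.mono_right (filter_subset _ _), hKV.mono_right (filter_subset _ _), ?_⟩
  ext E
  rw [mem_union]
  constructor
  · intro hE
    rcases mem_union.1 (hup hE) with h | h
    · exact Or.inl h
    · obtain ⟨t, ht, rfl⟩ := mem_image.1 h
      exact Or.inr (mem_image.2 ⟨t, mem_filter.2 ⟨ht, hE⟩, rfl⟩)
  · rintro (h | h)
    · exact hlow h
    · obtain ⟨t, ht, rfl⟩ := mem_image.1 h
      exact (mem_filter.1 ht).2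

end Lex

/-! ### Counting `k`-sets with prescribed points -/

/-- The number of `k`-subsets of an `n`-set containing a given `j`-set. -/
def supCard (n k j : ℕ) : ℕ := if j ≤ k then (n - j).choose (k - j) else 0

/-- The absorption identity for binomial coefficients: each further prescribed point costs a factor
`(k - j) / (n - j)`. The value `0` for `j > k` keeps it true at and beyond `j = k`, where truncated
subtraction inside `choose` would give `1`. -/
theorem supCard_succ_mul {n k j : ℕ} (hj : j < n) :
    (n - j) * supCard n k (j + 1) = (k - j) * supCard n k j := by
  unfold supCard
  split_ifs with h1 h2 h2
  · obtain ⟨a, rfl⟩ : ∃ a, n = a + 1 + j := ⟨n - j - 1, by omega⟩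
    obtain ⟨b, rfl⟩ : ∃ b, k = b + 1 + j := ⟨k - j - 1, by omega⟩
    have e1 : a + 1 + j - (j + 1) = a := by omega
    have e2 : b + 1 + j - (j + 1) = b := by omega
    have e3 : a + 1 + j - j = a + 1 := by omega
    have e4 : b + 1 + j - j = b + 1 := by omega
    rw [e1, e2, e3, e4, Nat.add_one_mul_choose_eq, mul_comm]
  · omega
  · have : k - j = 0 := by omega
    simp [this]
  · simp

theorem supCard_antitone_succ {n k j : ℕ} (hj : j < n) (hkn : k ≤ n) :
    supCard n k (j + 1) ≤ supCard n k j := by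
  have h := supCard_succ_mul (k := k) hj
  have h2 : (k - j) * supCard n k j ≤ (n - j) * supCard n k j := by gcongr
  exact Nat.le_of_mul_le_mul_left (h.le.trans h2) (by omega)

section Counting

variable {α : Type*} [Fintype α] [DecidableEq α]

theorem card_filter_superset (k : ℕ) (J : Finset α) :
    #{E ∈ powersetCard k univ | J ⊆ E} = supCard (Fintype.card α) k #J := by
  unfold supCard
  split_ifs with h
  · rw [← card_compl, ← card_powersetCard]
    refine card_bij' (fun E _ => E \ J) (fun E _ => E ∪ J) ?_ ?_ ?_ ?_
    · intro E hE
      rw [mem_filter, mem_powersetCard_univ] at hE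
      rw [mem_powersetCard, card_sdiff_of_subset hE.2, hE.1]
      refine ⟨fun a ha => ?_, rfl⟩
      rw [mem_sdiff] at ha
      exact mem_compl.2 ha.2
    · intro E hE
      rw [mem_powersetCard] at hE
      have hd : Disjoint E J := subset_compl_iff_disjoint_right.1 hE.1
      rw [mem_filter, mem_powersetCard_univ, card_union_of_disjoint hd, hE.2]
      exact ⟨by omega, subset_union_right⟩
    · intro E hE
      exact sdiff_union_of_subset (mem_filter.1 hE).2
    · intro E hE
      rw [mem_powersetCard] at hE
      exact union_sdiff_cancel_right (subset_compl_iff_disjoint_right.1 hE.1)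
  · rw [card_eq_zero, filter_eq_empty_iff]
    intro E hE hJ
    have := card_le_card hJ
    rw [mem_powersetCard_univ.1 hE] at this
    exact h this

/-- Union bound over the `j`-subsets of `B`, of which there are at most `#B ^ j`. -/
theorem card_filter_superset_le_card_inter_le (k j : ℕ) {I B : Finset α} (h : Disjoint I B) :
    #{E ∈ powersetCard k univ | I ⊆ E ∧ j ≤ #(E ∩ B)} ≤
      #B ^ j * supCard (Fintype.card α) k (#I + j) := by
  calc #{E ∈ powersetCard k univ | I ⊆ E ∧ j ≤ #(E ∩ B)}
      ≤ #((powersetCard j B).biUnion fun J => {E ∈ powersetCard k univ | I ∪ J ⊆ E}) := by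
        refine card_le_card fun E hE => ?_
        rw [mem_filter] at hE
        obtain ⟨J, hJ, hJc⟩ := exists_subset_card_eq hE.2.2
        exact mem_biUnion.2 ⟨J, mem_powersetCard.2 ⟨hJ.trans inter_subset_right, hJc⟩,
          mem_filter.2 ⟨hE.1, union_subset hE.2.1 (hJ.trans inter_subset_left)⟩⟩
    _ ≤ ∑ J ∈ powersetCard j B, #{E ∈ powersetCard k univ | I ∪ J ⊆ E} := card_biUnion_le
    _ = ∑ J ∈ powersetCard j B, supCard (Fintype.card α) k (#I + j) :=
        sum_congr rfl fun J hJ => by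
          rw [mem_powersetCard] at hJ
          rw [card_filter_superset, card_union_of_disjoint (h.mono_right hJ.1), hJ.2]
    _ ≤ _ := by
        rw [sum_const, card_powersetCard, smul_eq_mul]
        gcongr
        exact Nat.choose_le_pow _ _

theorem card_filter_le_card_inter (k j : ℕ) (B : Finset α) :
    #{E ∈ powersetCard k univ | j ≤ #(E ∩ B)} ≤ #B ^ j * supCard (Fintype.card α) k j := by
  simpa using card_filter_superset_le_card_inter_le k j (disjoint_empty_left B)

theorem card_filter_superset_not_disjoint_le (k : ℕ) {J M : Finset α} (h : Disjoint J M) :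
    #{E ∈ powersetCard k univ | J ⊆ E ∧ ¬Disjoint E M} ≤
      #M * supCard (Fintype.card α) k (#J + 1) := by
  calc #{E ∈ powersetCard k univ | J ⊆ E ∧ ¬Disjoint E M}
      ≤ #(M.biUnion fun a => {E ∈ powersetCard k univ | insert a J ⊆ E}) := by
        refine card_le_card fun E hE => ?_
        obtain ⟨h1, h2, h3⟩ := mem_filter.1 hE
        obtain ⟨a, ha, haM⟩ := not_disjoint_iff.1 h3
        exact mem_biUnion.2 ⟨a, haM, mem_filter.2 ⟨h1, insert_subset ha h2⟩⟩
    _ ≤ ∑ a ∈ M, #{E ∈ powersetCard k univ | insert a J ⊆ E} := card_biUnion_le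
    _ = ∑ a ∈ M, supCard (Fintype.card α) k (#J + 1) := sum_congr rfl fun a ha => by
        rw [card_filter_superset, card_insert_of_notMem fun h' => disjoint_left.1 h h' ha]
    _ = _ := by rw [sum_const, smul_eq_mul]

theorem supCard_le_card_filter_superset_disjoint (k : ℕ) {J M : Finset α} (h : Disjoint J M) :
    supCard (Fintype.card α) k #J ≤ #{E ∈ powersetCard k univ | J ⊆ E ∧ Disjoint E M} +
      #M * supCard (Fintype.card α) k (#J + 1) := by
  have h1 := card_filter_superset_not_disjoint_le k h
  have h2 := card_filter_add_card_filter_not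
    (s := ({E ∈ powersetCard k univ | J ⊆ E} : Finset (Finset α))) (fun E => Disjoint E M)
  rw [filter_filter, filter_filter, card_filter_superset] at h2
  omega

theorem card_hitFam_le (k : ℕ) (Y : Finset α) :
    #(hitFam k Y) ≤ #Y * supCard (Fintype.card α) k 1 := by
  have := card_filter_superset_not_disjoint_le k (disjoint_empty_left Y)
  simpa [hitFam] using this

end Counting

/-! ### Structure of intersecting families around `Y` and a core -/

section Structure

variable {α : Type*} [DecidableEq α]

/-- Structure of an intersecting family `G` all of whose members meet `Y` and, moreover, meet `C`
or have two points in `B`, and which has a member missing `C`. Apart from few members, it consists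
of sets through one point of `Y`, or of sets through one point of `C` that meet a proper subset of
`Y`, unless every member contains a fixed point or all of `Y`. -/
theorem exists_core_of_intersecting {Y C B : Finset α} {G : Finset (Finset α)}
    (hYne : Y.Nonempty) (hYC : Disjoint Y C) (hYB : Disjoint Y B)
    (hG : (G : Set (Finset α)).Intersecting)
    (hGY : ∀ E ∈ G, ¬Disjoint E Y) (hGC : ∀ E ∈ G, ¬Disjoint E C ∨ 2 ≤ #(E ∩ B))
    (A : Finset α) :
    (∃ c, ∀ E ∈ G, (c ∈ E ∧ ¬Disjoint E C) ∨ Y ⊆ E) ∨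
    ∃ S ⊆ G, A ∉ S ∧ #S ≤ #Y * #C ∧
      ((∃ y ∈ Y, ∀ E ∈ G, 3 ≤ #(E ∩ (A ∪ S.sup id ∪ Y ∪ C ∪ B)) ∨ (y ∈ E ∧ ¬Disjoint E C)) ∨
       (∃ c ∈ C, ∃ y₀ ∈ Y, ∀ E ∈ G, 3 ≤ #(E ∩ (A ∪ S.sup id ∪ Y ∪ C ∪ B)) ∨
          (c ∈ E ∧ ¬Disjoint E (Y.erase y₀)))) := by
  classical
  -- `P` holds the pairs `(y, c)` that fail to cover `G`, and `f` picks a member avoiding both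
  -- points. These witnesses form `S`; `A` is erased because it is recorded separately as the marked
  -- member of the certificate.
  set P : Finset (α × α) := {p ∈ Y ×ˢ C | ∃ E ∈ G, p.1 ∉ E ∧ p.2 ∉ E} with hP
  have hex : ∀ p : α × α, ∃ E, p ∈ P → E ∈ G ∧ p.1 ∉ E ∧ p.2 ∉ E := by
    intro p
    by_cases hp : p ∈ P
    · obtain ⟨E, hE⟩ := (mem_filter.1 hp).2
      exact ⟨E, fun _ => hE⟩
    · exact ⟨∅, fun h => absurd h hp⟩
  choose f hf using hex
  set S := (P.image f).erase A with hS
  set big := A ∪ S.sup id ∪ Y ∪ C ∪ B with hbig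
  have hAbig : A ⊆ big := fun a ha => by simp [hbig, ha]
  have hYbig : Y ⊆ big := fun a ha => by simp [hbig, ha]
  have hCbig : C ⊆ big := fun a ha => by simp [hbig, ha]
  have hBbig : B ⊆ big := fun a ha => by simp [hbig, ha]
  have hfbig : ∀ p ∈ P, f p ⊆ big := by
    intro p hp
    by_cases h : f p = A
    · rw [h]; exact hAbig
    · have : f p ≤ S.sup id := le_sup (f := id) (mem_erase.2 ⟨h, mem_image_of_mem f hp⟩)
      intro a ha
      have := this ha
      simp only [hbig, mem_union]
      tauto
  -- A member with at most two points in `big` contains some `y ∈ Y` and `c ∈ C`. If `{y, c}` did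
  -- not cover `G`, the member would meet the witness `f (y, c)` in a third point of `big`.
  have hcore : ∀ E ∈ G, ¬3 ≤ #(E ∩ big) → ∃ y ∈ Y, ∃ c ∈ C, y ∈ E ∧ c ∈ E ∧
      ∀ E' ∈ G, y ∈ E' ∨ c ∈ E' := by
    intro E hE h3
    obtain ⟨y, hyE, hyY⟩ := not_disjoint_iff.1 (hGY E hE)
    rcases hGC E hE with hEC | hEB
    · obtain ⟨c, hcE, hcC⟩ := not_disjoint_iff.1 hEC
      refine ⟨y, hyY, c, hcC, hyE, hcE, fun E' hE' => ?_⟩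
      by_contra hcon
      rw [not_or] at hcon
      have hp : (y, c) ∈ P := mem_filter.2 ⟨mem_product.2 ⟨hyY, hcC⟩, E', hE', hcon⟩
      obtain ⟨h1, h2, h3'⟩ := hf _ hp
      obtain ⟨z, hzE, hzf⟩ := not_disjoint_iff.1 (hG (mem_coe.2 hE) (mem_coe.2 h1))
      apply h3
      have hzy : z ≠ y := fun h => h2 (h ▸ hzf)
      have hzc : z ≠ c := fun h => h3' (h ▸ hzf)
      have hyc : y ≠ c := fun h => disjoint_left.1 hYC hyY (h ▸ hcC)
      calc 3 = #({z, y, c} : Finset α) := by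
            rw [card_insert_of_notMem (by simp [hzy, hzc]), card_pair hyc]
        _ ≤ _ := card_le_card (by
            intro a ha
            simp only [mem_insert, mem_singleton] at ha
            rcases ha with rfl | rfl | rfl
            · exact mem_inter.2 ⟨hzE, hfbig _ hp hzf⟩
            · exact mem_inter.2 ⟨hyE, hYbig hyY⟩
            · exact mem_inter.2 ⟨hcE, hCbig hcC⟩)
    · exfalso
      apply h3
      have hy' : y ∉ E ∩ B := fun h => disjoint_left.1 hYB hyY (mem_inter.1 h).2
      calc 3 ≤ #(insert y (E ∩ B)) := by rw [card_insert_of_notMem hy']; omega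
        _ ≤ _ := card_le_card (insert_subset (mem_inter.2 ⟨hyE, hYbig hyY⟩)
            (inter_subset_inter_left hBbig))
  have hSG : S ⊆ G := by
    intro E hE
    obtain ⟨p, hp, rfl⟩ := mem_image.1 (mem_of_mem_erase hE)
    exact (hf p hp).1
  have hScard : #S ≤ #Y * #C :=
    (card_erase_le.trans card_image_le).trans ((card_filter_le _ _).trans (card_product _ _).le)
  by_cases hstarY : ∃ y ∈ Y, ∀ E ∈ G, 3 ≤ #(E ∩ big) ∨ (y ∈ E ∧ ¬Disjoint E C)
  · exact Or.inr ⟨S, hSG, notMem_erase _ _, hScard, Or.inl hstarY⟩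
  -- No point of `Y` is a centre. The choice of `y₁` only provides one member with few points in
  -- `big`, hence a covering pair `{y₂, c}`; the failure of `y₂` as a centre gives a second covering
  -- pair with `y₃ ≠ y₂`.
  push Not at hstarY
  obtain ⟨y₁, hy₁⟩ := hYne
  obtain ⟨E₁, hE₁, h₁, -⟩ := hstarY y₁ hy₁
  obtain ⟨y₂, hy₂, c, hc, hy₂E, hcE, hhit⟩ := hcore E₁ hE₁ (not_le.2 h₁)
  obtain ⟨E₃, hE₃, h₃, h₃'⟩ := hstarY y₂ hy₂
  obtain ⟨y₃, hy₃, c₃, hc₃, hy₃E, hc₃E, hhit₃⟩ := hcore E₃ hE₃ (not_le.2 h₃)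
  have hy₂E₃ : y₂ ∉ E₃ := fun h => not_disjoint_iff.2 ⟨c₃, hc₃E, hc₃⟩ (h₃' h)
  -- A covering pair disjoint from `{y, c} ⊆ E` would give `E` a third point in `big`.
  have hcommon : ∀ E ∈ G, ¬3 ≤ #(E ∩ big) → ∀ y c, y ∈ Y → c ∈ C → y ∈ E → c ∈ E →
      ∀ y' ∈ Y, ∀ c' ∈ C, (∀ E' ∈ G, y' ∈ E' ∨ c' ∈ E') → y' = y ∨ c' = c := by
    intro E hE h3 y c hy hc hyE hcE y' hy' c' hc' hh
    by_contra hcon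
    rw [not_or] at hcon
    apply h3
    have hyc : y ≠ c := fun h => disjoint_left.1 hYC hy (h ▸ hc)
    have hyc' : y ≠ c' := fun h => disjoint_left.1 hYC hy (h ▸ hc')
    have hy'c : y' ≠ c := fun h => disjoint_left.1 hYC hy' (h ▸ hc)
    obtain ⟨z, hzE, hzbig, hzy, hzc⟩ : ∃ z, z ∈ E ∧ z ∈ big ∧ z ≠ y ∧ z ≠ c := by
      rcases hh E hE with h | h
      · exact ⟨y', h, hYbig hy', hcon.1, hy'c⟩
      · exact ⟨c', h, hCbig hc', hyc'.symm, hcon.2⟩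
    calc 3 = #({z, y, c} : Finset α) := by
          rw [card_insert_of_notMem (by simp [hzy, hzc]), card_pair hyc]
      _ ≤ _ := card_le_card (by
          intro a ha
          simp only [mem_insert, mem_singleton] at ha
          rcases ha with rfl | rfl | rfl
          · exact mem_inter.2 ⟨hzE, hzbig⟩
          · exact mem_inter.2 ⟨hyE, hYbig hy⟩
          · exact mem_inter.2 ⟨hcE, hCbig hc⟩)
  have hne : y₂ ≠ y₃ := fun h => hy₂E₃ (h ▸ hy₃E)
  have hcc : c = c₃ := (hcommon E₃ hE₃ (not_le.2 h₃) y₃ c₃ hy₃ hc₃ hy₃E hc₃E y₂ hy₂ c hc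
    hhit).resolve_left hne
  subst hcc
  -- If every `{y, c}` covers `G`, a member missing `c` contains all of `Y`. Otherwise some `{y₀,
  -- c}` is not a cover, and the covering pair inside a member with few points in `big` must be `{y,
  -- c}` with `y ≠ y₀`.
  by_cases hall : ∀ y ∈ Y, ∀ E ∈ G, y ∈ E ∨ c ∈ E
  · left
    refine ⟨c, fun E hE => ?_⟩
    by_cases hcE' : c ∈ E
    · exact Or.inl ⟨hcE', not_disjoint_iff.2 ⟨c, hcE', hc⟩⟩
    · exact Or.inr fun y hy => (hall y hy E hE).resolve_right hcE'
  · push Not at hall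
    obtain ⟨y₀, hy₀, E₀, hE₀, hyE₀, hcE₀⟩ := hall
    refine Or.inr ⟨S, hSG, notMem_erase _ _, hScard, Or.inr ⟨c, hc, y₀, hy₀, fun E hE => ?_⟩⟩
    by_contra hcon
    rw [not_or] at hcon
    obtain ⟨h3, hcon⟩ := hcon
    obtain ⟨y, hy, c', hc', hyE, hc'E, hh⟩ := hcore E hE h3
    have hcc' : c = c' := by
      by_contra hne'
      have e1 := (hcommon E hE h3 y c' hy hc' hyE hc'E y₂ hy₂ c hc hhit).resolve_right hne'
      have e2 := (hcommon E hE h3 y c' hy hc' hyE hc'E y₃ hy₃ c hc hhit₃).resolve_right hne'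
      exact hne (e1.trans e2.symm)
    subst hcc'
    refine hcon ⟨hc'E, not_disjoint_iff.2 ⟨y, hyE, mem_erase.2 ⟨fun h => ?_, hy⟩⟩⟩
    subst h
    exact (hh E₀ hE₀).elim hyE₀ hcE₀

end Structure

/-! ### Estimates uniform in `x` -/

section Numeric

/-- Bernoulli's inequality. -/
theorem mul_le_pow_sub_one {x : ℝ} (hx : 0 ≤ x) (n : ℕ) : n * x ≤ (1 + x) ^ n - 1 := by
  have := one_add_mul_le_pow (by linarith : (-2 : ℝ) ≤ x) n
  linarith

/-- The device behind uniformity in `x`: as `q * x ≤ (1 + x) ^ q`, each factor `X * x` from the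
choice of a certificate member costs a constant `c` and `q` in the exponent. With `q` a small
fraction of the gain, up to `s` choices are affordable. -/
theorem sum_pow_le_pow {x : ℝ} (hx : 0 ≤ x) {X c q : ℕ} (hX : X ≤ c * q) (hc : 1 ≤ c) (s : ℕ) :
    ∑ j ∈ range (s + 1), (X * x) ^ j ≤ (s + 1) * c ^ s * (1 + x) ^ (q * s) := by
  have hc' : (1 : ℝ) ≤ c := by exact_mod_cast hc
  calc ∑ j ∈ range (s + 1), (X * x) ^ j
      ≤ ∑ j ∈ range (s + 1), (c : ℝ) ^ s * (1 + x) ^ (q * s) := by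
        refine sum_le_sum fun j hj => ?_
        have hjs : j ≤ s := Nat.lt_succ_iff.1 (mem_range.1 hj)
        have h1 : (X : ℝ) * x ≤ c * (1 + x) ^ q := by
          have h2 : (X : ℝ) ≤ c * q := by exact_mod_cast hX
          have h3 := mul_le_pow_sub_one hx q
          calc (X : ℝ) * x ≤ c * q * x := by gcongr
            _ = c * (q * x) := by ring
            _ ≤ _ := by gcongr; linarith
        calc ((X : ℝ) * x) ^ j ≤ (c * (1 + x) ^ q) ^ j := by gcongr
          _ = c ^ j * (1 + x) ^ (q * j) := by rw [mul_pow, pow_mul]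
          _ ≤ _ := by
            have : (1 : ℝ) ≤ 1 + x := by linarith
            gcongr
    _ = _ := by
        rw [sum_const, card_range, nsmul_eq_mul]
        push_cast
        ring

/-- The right side is what `t` additional sets contribute to a star of `B` sets. Of these `t`, `q *
s` pay for the choice of `S`, `d` for the enlarged pool, and `h` for the choice of the marked member
together with all constants, through `h * x ≤ (1 + x) ^ h - 1`. -/
theorem marked_weight_le_gain {x : ℝ} (hx : 0 ≤ x) {y X q s c h d t K B : ℕ} (hX : X ≤ c * q)
    (hc : 1 ≤ c) (hy : y * ((s + 1) * c ^ s * K) ≤ h) (ht : q * s + d + h ≤ t) :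
    K * (y * x * (∑ j ∈ range (s + 1), (X * x) ^ j) * (1 + x) ^ (B + d)) ≤
      (1 + x) ^ B * ((1 + x) ^ t - 1) := by
  have h1 : (1 : ℝ) ≤ 1 + x := by linarith
  calc K * (y * x * (∑ j ∈ range (s + 1), (X * x) ^ j) * (1 + x) ^ (B + d))
      ≤ K * (y * x * ((s + 1) * c ^ s * (1 + x) ^ (q * s)) * (1 + x) ^ (B + d)) := by
        gcongr
        exact sum_pow_le_pow hx hX hc s
    _ = ((y * ((s + 1) * c ^ s * K) : ℕ) : ℝ) * x * (1 + x) ^ B * (1 + x) ^ (q * s + d) := by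
        push_cast
        ring
    _ ≤ h * x * (1 + x) ^ B * (1 + x) ^ (q * s + d) := by
        gcongr
    _ = (1 + x) ^ B * ((1 + x) ^ (q * s + d) * (h * x)) := by ring
    _ ≤ (1 + x) ^ B * ((1 + x) ^ (q * s + d) * ((1 + x) ^ h - 1)) := by
        gcongr
        exact mul_le_pow_sub_one hx h
    _ ≤ (1 + x) ^ B * ((1 + x) ^ t - 1) := by
        gcongr
        rw [mul_sub, ← pow_add, mul_one]
        have h2 : (1 + x) ^ (q * s + d + h) ≤ (1 + x) ^ t := pow_le_pow_right₀ h1 ht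
        have h3 : (1 : ℝ) ≤ (1 + x) ^ (q * s + d) := one_le_pow₀ h1
        linarith

/-- A certificate bound with one marked member taken from a small set. -/
theorem famWeight_le_of_marked_cert {β : Type*} [DecidableEq β] {x : ℝ} (hx : 0 ≤ x)
    {𝒢 : Finset (Finset β)} (Y X : Finset β) (s p : ℕ) (pool : β → Finset β → Finset β)
    (hpool : ∀ A ∈ Y, ∀ S ⊆ X, #S ≤ s → #(pool A S) ≤ p)
    (h : ∀ G ∈ 𝒢, ∃ A ∈ Y, ∃ S ⊆ X, A ∉ S ∧ #S ≤ s ∧ insert A S ⊆ G ∧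
      G ⊆ insert A S ∪ pool A S) :
    famWeight x 𝒢 ≤ #Y * x * (∑ j ∈ range (s + 1), (#X * x) ^ j) * (1 + x) ^ p := by
  have h1 : (1 : ℝ) ≤ 1 + x := by linarith
  set T : Finset (Finset β) := {S ∈ X.powerset | #S ≤ s} with hT
  have hsum : 0 ≤ ∑ S ∈ T, x ^ #S := sum_nonneg fun _ _ => pow_nonneg hx _
  have hcert := famWeight_le_of_cert hx (𝒢 := 𝒢)
    ({i ∈ Y ×ˢ T | i.1 ∉ i.2} : Finset (β × Finset β))
    (fun i => insert i.1 i.2) (fun i => pool i.1 i.2) (by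
      intro G hG
      obtain ⟨A, hA, S, hS, hAS, hs, h2, h3⟩ := h G hG
      exact ⟨(A, S), mem_filter.2 ⟨mem_product.2 ⟨hA, mem_filter.2 ⟨mem_powerset.2 hS, hs⟩⟩,
        hAS⟩, h2, h3⟩)
  refine hcert.trans ?_
  calc _ ≤ ∑ i ∈ ({i ∈ Y ×ˢ T | i.1 ∉ i.2} : Finset (β × Finset β)),
          x * x ^ #i.2 * (1 + x) ^ p := by
        refine sum_le_sum fun i hi => ?_
        obtain ⟨hi, hi'⟩ := mem_filter.1 hi
        obtain ⟨hA, hS⟩ := mem_product.1 hi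
        obtain ⟨hS, hs⟩ := mem_filter.1 hS
        have := pow_le_pow_right₀ h1 (hpool _ hA _ (mem_powerset.1 hS) hs)
        rw [card_insert_of_notMem hi', pow_succ']
        gcongr
    _ ≤ ∑ i ∈ Y ×ˢ T, x * x ^ #i.2 * (1 + x) ^ p :=
        sum_le_sum_of_subset_of_nonneg (filter_subset _ _) fun _ _ _ => by positivity
    _ = #Y * x * (∑ S ∈ T, x ^ #S) * (1 + x) ^ p := by
        have : ∀ A ∈ Y, ∑ S ∈ T, x * x ^ #S * (1 + x) ^ p =
            x * (∑ S ∈ T, x ^ #S) * (1 + x) ^ p := fun A _ => by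
          rw [mul_sum, sum_mul]
        rw [sum_product, sum_congr rfl this, sum_const, nsmul_eq_mul]
        ring
    _ ≤ _ := by
        refine mul_le_mul_of_nonneg_right (mul_le_mul_of_nonneg_left ?_ (by positivity))
          (by positivity)
        exact sum_pow_card_le hx X s

end Numeric

theorem famWeight_sdiff_powerset {β : Type*} [DecidableEq β] (x : ℝ) {D D' : Finset β}
    (h : D' ⊆ D) :
    famWeight x (D.powerset \ D'.powerset) = (1 + x) ^ #D - (1 + x) ^ #D' := by
  rw [← famWeight_powerset, ← famWeight_powerset, eq_sub_iff_add_eq]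
  exact sum_sdiff (powerset_mono.2 h)

/-! ### Exchanging pairs in `B` for one new point -/

section Switch

variable {α : Type*} [Fintype α] [DecidableEq α]

/-- The `k`-sets meeting both `Y` and `C`. -/
def hitBoth (k : ℕ) (Y C : Finset α) : Finset (Finset α) := {E ∈ hitFam k Y | ¬Disjoint E C}

/-- The `k`-sets meeting `Y` which also meet `C` or have two points in `B`. -/
def hitOrPair (k : ℕ) (Y C B : Finset α) : Finset (Finset α) :=
  {E ∈ hitFam k Y | ¬Disjoint E C ∨ 2 ≤ #(E ∩ B)}

theorem mem_hitBoth {k : ℕ} {Y C E : Finset α} :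
    E ∈ hitBoth k Y C ↔ #E = k ∧ ¬Disjoint E Y ∧ ¬Disjoint E C := by
  rw [hitBoth, mem_filter, mem_hitFam, and_assoc]

theorem mem_hitOrPair {k : ℕ} {Y C B E : Finset α} :
    E ∈ hitOrPair k Y C B ↔ #E = k ∧ ¬Disjoint E Y ∧ (¬Disjoint E C ∨ 2 ≤ #(E ∩ B)) := by
  rw [hitOrPair, mem_filter, mem_hitFam, and_assoc]

theorem hitBoth_mono (k : ℕ) (Y : Finset α) {C C' : Finset α} (h : C ⊆ C') :
    hitBoth k Y C ⊆ hitBoth k Y C' := fun E hE => by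
  rw [mem_hitBoth] at hE ⊢
  exact ⟨hE.1, hE.2.1, fun h' => hE.2.2 (h'.mono_right h)⟩

open scoped Classical in
/-- Families whose members contain a fixed point or all of `Y` do not lose weight when pairs in `B`
are exchanged for the point `a`. -/
theorem famWeight_switch_le {x : ℝ} (hx : 0 ≤ x) {k : ℕ} {Y C B : Finset α} {a : α}
    (hY : Y.Nonempty)
    (hcard : #{E ∈ powersetCard k (univ : Finset α) | Y ⊆ E ∧ Disjoint E C ∧ 2 ≤ #(E ∩ B)} ≤
      #{E ∈ powersetCard k (univ : Finset α) | insert a Y ⊆ E ∧ Disjoint E C}) :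
    famWeight x {G ∈ intFamilies (hitOrPair k Y C B) | ¬G ⊆ hitBoth k Y C ∧
        ∃ c, ∀ E ∈ G, (c ∈ E ∧ ¬Disjoint E C) ∨ Y ⊆ E} ≤
      famWeight x {G ∈ intFamilies (hitBoth k Y (insert a C)) | ¬G ⊆ hitBoth k Y C ∧
        ∀ E ∈ G, E ∉ hitBoth k Y C → Y ⊆ E} := by
  set P : Finset (Finset α) :=
    {E ∈ powersetCard k (univ : Finset α) | Y ⊆ E ∧ Disjoint E C ∧ 2 ≤ #(E ∩ B)} with hP
  set Q : Finset (Finset α) :=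
    {E ∈ powersetCard k (univ : Finset α) | insert a Y ⊆ E ∧ Disjoint E C} with hQ
  set H := hitBoth k Y C with hH
  -- `ψ` fixes `H` and sends the sets of `P`, whose only merit is a pair in `B`, injectively to sets
  -- of `Q` through `a`.
  obtain ⟨e⟩ : Nonempty (P ↪ Q) :=
    Function.Embedding.nonempty_of_card_le (by simpa using hcard)
  set ψ : Finset α → Finset α := fun E => if h : E ∈ P then (e ⟨E, h⟩ : Finset α) else E with hψ
  have hψP : ∀ E ∈ P, ψ E ∈ Q := fun E hE => by
    simp only [hψ, hE, dif_pos]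
    exact (e ⟨E, hE⟩).2
  have hHP : ∀ E ∈ H, E ∉ P := fun E hE hE' =>
    (mem_hitBoth.1 hE).2.2 (mem_filter.1 hE').2.2.1
  have hψH : ∀ E ∈ H, ψ E = E := fun E hE => by simp [hψ, hHP E hE]
  have hQH : ∀ E ∈ Q, E ∉ H := fun E hE hE' => (mem_hitBoth.1 hE').2.2 (mem_filter.1 hE).2.2
  have hinj : Set.InjOn ψ (H ∪ P : Finset (Finset α)) := by
    intro E hE E' hE' heq
    rcases mem_union.1 (mem_coe.1 hE) with h | h <;>
      rcases mem_union.1 (mem_coe.1 hE') with h' | h'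
    · rwa [hψH E h, hψH E' h'] at heq
    · rw [hψH E h] at heq
      exact absurd (heq ▸ h) (hQH _ (hψP E' h'))
    · rw [hψH E' h'] at heq
      exact absurd (heq ▸ h') (hQH _ (hψP E h))
    · simp only [hψ, h, h', dif_pos] at heq
      have := e.injective (Subtype.ext heq)
      simpa using this
  have hmem : ∀ G ⊆ hitOrPair k Y C B, (∃ c, ∀ E ∈ G, (c ∈ E ∧ ¬Disjoint E C) ∨ Y ⊆ E) →
      G ⊆ H ∪ P := by
    rintro G hG ⟨c, hc⟩ E hE
    rw [mem_union]
    have hE' := mem_hitOrPair.1 (hG hE)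
    by_cases hEC : Disjoint E C
    · right
      refine mem_filter.2 ⟨mem_powersetCard_univ.2 hE'.1, ?_, hEC, ?_⟩
      · exact (hc E hE).resolve_left fun h => h.2 hEC
      · exact hE'.2.2.resolve_left fun h => h hEC
    · exact Or.inl (mem_hitBoth.2 ⟨hE'.1, hE'.2.1, hEC⟩)
  refine famWeight_le_of_injOn hx (fun G => G.image ψ) ?_ ?_ ?_
  · intro G hG
    obtain ⟨hGi, hGH, c, hc⟩ := mem_filter.1 hG
    obtain ⟨hG3, hGint⟩ := mem_intFamilies.1 hGi
    have hGHP := hmem G hG3 ⟨c, hc⟩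
    -- `ψ` need not respect individual intersections, but this dichotomy survives it and forces any
    -- two images to meet: both contain `c`, or one contains `Y` and the other meets `Y`.
    have hkey : ∀ E ∈ G, (c ∈ ψ E ∧ ¬Disjoint (ψ E) Y) ∨ Y ⊆ ψ E := by
      intro E hE
      rcases mem_union.1 (hGHP hE) with h | h
      · rw [hψH E h]
        exact (hc E hE).imp (fun h' => ⟨h'.1, (mem_hitBoth.1 h).2.1⟩) id
      · exact Or.inr ((subset_insert _ _).trans (mem_filter.1 (hψP E h)).2.1)
    refine mem_filter.2 ⟨mem_intFamilies.2 ⟨?_, ?_⟩, ?_, ?_⟩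
    · intro E' hE'
      obtain ⟨E, hE, rfl⟩ := mem_image.1 hE'
      rcases mem_union.1 (hGHP hE) with h | h
      · rw [hψH E h]
        exact hitBoth_mono k Y (subset_insert _ _) h
      · obtain ⟨h1, h2, h3⟩ := mem_filter.1 (hψP E h)
        refine mem_hitBoth.2 ⟨mem_powersetCard_univ.1 h1, ?_, ?_⟩
        · obtain ⟨y, hy⟩ := hY
          exact not_disjoint_iff.2 ⟨y, h2 (mem_insert_of_mem hy), hy⟩
        · exact not_disjoint_iff.2 ⟨a, h2 (mem_insert_self _ _), mem_insert_self _ _⟩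
    · intro E₁ hE₁ E₂ hE₂
      obtain ⟨A₁, hA₁, rfl⟩ := mem_image.1 (mem_coe.1 hE₁)
      obtain ⟨A₂, hA₂, rfl⟩ := mem_image.1 (mem_coe.1 hE₂)
      obtain ⟨y, hy⟩ := hY
      rcases hkey A₁ hA₁ with h | h <;> rcases hkey A₂ hA₂ with h' | h'
      · exact not_disjoint_iff.2 ⟨c, h.1, h'.1⟩
      · exact fun hd => h.2 (hd.mono_right h')
      · exact fun hd => h'.2 (hd.symm.mono_right h)
      · exact not_disjoint_iff.2 ⟨y, h hy, h' hy⟩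
    · intro hsub
      apply hGH
      intro E hE
      rcases mem_union.1 (hGHP hE) with h | h
      · exact h
      · exact absurd (hsub (mem_image_of_mem ψ hE)) (hQH _ (hψP E h))
    · intro E' hE' hE'H
      obtain ⟨E, hE, rfl⟩ := mem_image.1 hE'
      rcases mem_union.1 (hGHP hE) with h | h
      · exact absurd (by rw [hψH E h]; exact h) hE'H
      · exact (subset_insert _ _).trans (mem_filter.1 (hψP E h)).2.1
  · intro G hG G' hG' heq
    obtain ⟨hGi, -, hc⟩ := mem_filter.1 (mem_coe.1 hG)
    obtain ⟨hGi', -, hc'⟩ := mem_filter.1 (mem_coe.1 hG')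
    exact image_injOn_powerset_of_injOn hinj
      (mem_coe.2 (mem_powerset.2 (hmem G (mem_intFamilies.1 hGi).1 hc)))
      (mem_coe.2 (mem_powerset.2 (hmem G' (mem_intFamilies.1 hGi').1 hc'))) heq
  · intro G hG
    obtain ⟨hGi, -, hc⟩ := mem_filter.1 hG
    exact card_image_of_injOn
      (hinj.mono (by exact_mod_cast hmem G (mem_intFamilies.1 hGi).1 hc))

/-- The hypothesis of `famWeight_switch_le` holds on large ground sets. -/
theorem card_superset_pair_le {k b : ℕ} {Y C B : Finset α} {a : α} (hYC : Disjoint Y C)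
    (hYB : Disjoint Y B) (haY : a ∉ Y) (haC : a ∉ C) (hB : #B ≤ b) (hC : #C ≤ k)
    (hn : #Y + 1 + (b ^ 2 + k) * k < Fintype.card α) :
    #{E ∈ powersetCard k (univ : Finset α) | Y ⊆ E ∧ Disjoint E C ∧ 2 ≤ #(E ∩ B)} ≤
      #{E ∈ powersetCard k (univ : Finset α) | insert a Y ⊆ E ∧ Disjoint E C} := by
  set n := Fintype.card α with hnn
  have h1 : #{E ∈ powersetCard k (univ : Finset α) | Y ⊆ E ∧ Disjoint E C ∧ 2 ≤ #(E ∩ B)} ≤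
      b ^ 2 * supCard n k (#Y + 2) := by
    refine (card_le_card fun E hE => ?_).trans
      ((card_filter_superset_le_card_inter_le k 2 hYB).trans (by gcongr))
    obtain ⟨h1, h2, h3, h4⟩ := mem_filter.1 hE
    exact mem_filter.2 ⟨h1, h2, h4⟩
  have h2 := supCard_le_card_filter_superset_disjoint (M := C) (J := insert a Y) k
    (disjoint_insert_left.2 ⟨haC, hYC⟩)
  rw [card_insert_of_notMem haY, ← hnn] at h2
  have h3 := supCard_succ_mul (k := k) (j := #Y + 1) (n := n) (by omega)
  -- One more prescribed point costs a factor of at least `(n - #Y - 1) / k`, which exceeds `b ^ 2 +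
  -- #C`.
  have h4 : (b ^ 2 + #C) * supCard n k (#Y + 2) ≤ supCard n k (#Y + 1) := by
    have hpos : 0 < n - (#Y + 1) := by omega
    refine Nat.le_of_mul_le_mul_left ?_ hpos
    calc (n - (#Y + 1)) * ((b ^ 2 + #C) * supCard n k (#Y + 2))
        = (b ^ 2 + #C) * ((k - (#Y + 1)) * supCard n k (#Y + 1)) := by
          rw [← h3]
          ring
      _ ≤ (b ^ 2 + k) * (k * supCard n k (#Y + 1)) := by
          gcongr
          omega
      _ = (b ^ 2 + k) * k * supCard n k (#Y + 1) := by ring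
      _ ≤ _ := by
          gcongr
          omega
  have h5 : (b ^ 2 + #C) * supCard n k (#Y + 2) = b ^ 2 * supCard n k (#Y + 2) +
    #C * supCard n k (#Y + 1 + 1) := by ring
  rw [h5] at h4
  omega

end Switch

/-! ### One additional core point outweighs all pairs in a bounded set -/

section Core

variable {α : Type*} [Fintype α] [DecidableEq α]

/-- The `k`-sets through `y` and `a` with no further point of `Y` and no point of `C`. -/
def petal (k : ℕ) (Y C : Finset α) (a y : α) : Finset (Finset α) :=
  {E ∈ powersetCard k (univ : Finset α) | {y, a} ⊆ E ∧ Disjoint E (Y.erase y ∪ C)}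

theorem mem_petal {k : ℕ} {Y C : Finset α} {a y : α} {E : Finset α} :
    E ∈ petal k Y C a y ↔
      #E = k ∧ (y ∈ E ∧ a ∈ E) ∧ Disjoint E (Y.erase y) ∧ Disjoint E C := by
  simp [petal, insert_subset_iff, disjoint_union_right]

theorem supCard_le_card_petal (k : ℕ) {Y C : Finset α} {a y : α} (hYC : Disjoint Y C)
    (haY : a ∉ Y) (haC : a ∉ C) (hy : y ∈ Y) :
    supCard (Fintype.card α) k 2 ≤
      #(petal k Y C a y) + (#Y + #C) * supCard (Fintype.card α) k 3 := by
  have hya : y ≠ a := fun h => haY (h ▸ hy)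
  have hd : Disjoint ({y, a} : Finset α) (Y.erase y ∪ C) := by
    simp only [disjoint_insert_left, disjoint_singleton_left, mem_union, mem_erase, not_or]
    exact ⟨⟨by simp, fun h => disjoint_left.1 hYC hy h⟩, fun h => haY h.2, haC⟩
  have h := supCard_le_card_filter_superset_disjoint k hd
  rw [card_pair hya] at h
  refine h.trans (Nat.add_le_add le_rfl (Nat.mul_le_mul_right _ ?_))
  exact (card_union_le _ _).trans (Nat.add_le_add card_erase_le le_rfl)

theorem petal_subset_hitBoth {k : ℕ} {Y C : Finset α} {a y : α} (hy : y ∈ Y) :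
    petal k Y C a y ⊆ hitBoth k Y (insert a C) := fun E hE => by
  rw [mem_petal] at hE
  exact mem_hitBoth.2 ⟨hE.1, not_disjoint_iff.2 ⟨y, hE.2.1.1, hy⟩,
    not_disjoint_iff.2 ⟨a, hE.2.1.2, mem_insert_self _ _⟩⟩

theorem notMem_hitBoth_of_mem_petal {k : ℕ} {Y C : Finset α} {a y : α} {E : Finset α}
    (hE : E ∈ petal k Y C a y) : E ∉ hitBoth k Y C := fun h =>
  (mem_hitBoth.1 h).2.2 (mem_petal.1 hE).2.2.2

theorem not_subset_of_mem_petal {k : ℕ} {Y C : Finset α} {a y : α} {E : Finset α}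
    (hY : 2 ≤ #Y) (hE : E ∈ petal k Y C a y) : ¬Y ⊆ E := fun h => by
  have h1 : 1 ≤ #(Y.erase y) := by
    have := pred_card_le_card_erase (s := Y) (a := y)
    omega
  obtain ⟨z, hz⟩ := card_pos.1 h1
  exact disjoint_left.1 (mem_petal.1 hE).2.2.1 (h (mem_of_mem_erase hz)) hz

open scoped Classical in
/-- Intersecting families consisting of sets through `y` which are forced out of `hitBoth k Y C`
by a petal. -/
theorem petal_gain_le {x : ℝ} (hx : 0 ≤ x) {k : ℕ} {Y C : Finset α} {a : α} (hY : 2 ≤ #Y)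
    (D D' : Finset (Finset α)) (hD' : D' ⊆ D) (hDX : D ⊆ hitBoth k Y (insert a C))
    (hDint : (D : Set (Finset α)).Intersecting)
    (hpet : ∀ E ∈ D, E ∉ D' → ∃ y, E ∈ petal k Y C a y) :
    (1 + x) ^ #D - (1 + x) ^ #D' ≤
      famWeight x {G ∈ intFamilies (hitBoth k Y (insert a C)) |
        ∃ E ∈ G, E ∉ hitBoth k Y C ∧ ¬Y ⊆ E} := by
  rw [← famWeight_sdiff_powerset x hD']
  refine famWeight_mono hx fun G hG => ?_
  rw [mem_sdiff, mem_powerset, mem_powerset, not_subset] at hG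
  obtain ⟨hGD, E, hE, hED'⟩ := hG
  obtain ⟨y, hy⟩ := hpet E (hGD hE) hED'
  exact mem_filter.2 ⟨mem_intFamilies.2 ⟨hGD.trans hDX, hDint.mono (by exact_mod_cast hGD)⟩,
    E, hE, notMem_hitBoth_of_mem_petal hy, not_subset_of_mem_petal hY hy⟩

end Core

/-- Bound on the number of points in a bounded configuration of sets. -/
def configSize (k ℓ b : ℕ) : ℕ := k + ℓ * k * k + ℓ + k + b

/-- The constant by which petals must outnumber exceptional sets. -/
def petalFactor (k ℓ b : ℕ) : ℕ :=
  (ℓ * k + 1) * ((ℓ + k + b) ^ 2 * (8 * (ℓ * k + 1))) ^ (ℓ * k) * (ℓ + k * ℓ)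

section Core

variable {α : Type*} [Fintype α] [DecidableEq α]

set_option maxHeartbeats 1000000 in
/-- Pairs in a bounded set `B` are worth less than a single additional point `a`. -/
theorem intWeight_hitOrPair_le {x : ℝ} (hx : 0 ≤ x) {k b : ℕ} {Y C B : Finset α} {a : α}
    (hY : Y.Nonempty) (hYC : Disjoint Y C) (hYB : Disjoint Y B) (haY : a ∉ Y) (haC : a ∉ C)
    (hB : #B ≤ b) (hC : #C ≤ k) (hkn : k ≤ Fintype.card α)
    (hn : #Y + 1 + (b ^ 2 + k) * k < Fintype.card α)
    (hN2 : 4 * (#Y * k + 1) ≤ supCard (Fintype.card α) k 2)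
    (hN3 : 2 * (configSize k #Y b ^ 3 + configSize k #Y b ^ 3 * petalFactor k #Y b +
      #Y * (#Y + k)) * supCard (Fintype.card α) k 3 ≤ supCard (Fintype.card α) k 2) :
    intWeight x (hitOrPair k Y C B) ≤ intWeight x (hitBoth k Y (insert a C)) := by
  classical
  have hμ : (1 : ℝ) ≤ 1 + x := by linarith
  set n := Fintype.card α with hnn
  set N2 := supCard n k 2 with hN2d
  set N3 := supCard n k 3 with hN3d
  set ℓ := #Y with hℓ
  have hℓ1 : 1 ≤ ℓ := card_pos.2 hY
  set D := configSize k ℓ b ^ 3 with hD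
  set F := petalFactor k ℓ b with hF
  set X := hitOrPair k Y C B with hX
  set X' := hitBoth k Y (insert a C) with hX'
  set H := hitBoth k Y C with hH
  set M := X \ H with hM
  -- Families inside `H` count on both sides. The other families of `X` are `R`, with a common point
  -- or containing `Y`, and the rest `NR`; on the side of `X'` there are `R'`, whose members outside
  -- `H` contain `Y`, and `W`. Switching embeds `R` in `R'`, so `W` has to pay for `NR`.
  set R : Finset (Finset (Finset α)) := {G ∈ intFamilies X | ¬G ⊆ H ∧
        ∃ c, ∀ E ∈ G, (c ∈ E ∧ ¬Disjoint E C) ∨ Y ⊆ E} with hR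
  set R' : Finset (Finset (Finset α)) := {G ∈ intFamilies X' | ¬G ⊆ H ∧
        ∀ E ∈ G, E ∉ H → Y ⊆ E} with hR'
  set NR : Finset (Finset (Finset α)) := {G ∈ intFamilies X | ¬G ⊆ H ∧
        ¬∃ c, ∀ E ∈ G, (c ∈ E ∧ ¬Disjoint E C) ∨ Y ⊆ E} with hNR
  set W : Finset (Finset (Finset α)) := {G ∈ intFamilies X' |
        ∃ E ∈ G, E ∉ H ∧ ¬Y ⊆ E} with hW
  have hHX' : H ⊆ X' := hitBoth_mono k Y (subset_insert _ _)
  have hRR' : famWeight x R ≤ famWeight x R' :=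
    famWeight_switch_le hx hY (card_superset_pair_le hYC hYB haY haC hB hC hn)
  have hupper : intWeight x X ≤ intWeight x H + famWeight x R + famWeight x NR := by
    calc intWeight x X ≤ famWeight x (intFamilies H ∪ R ∪ NR) := by
          refine famWeight_mono hx fun G hG => ?_
          by_cases hGH : G ⊆ H
          · exact mem_union_left _ (mem_union_left _
              (mem_intFamilies.2 ⟨hGH, (mem_intFamilies.1 hG).2⟩))
          · by_cases hc : ∃ c, ∀ E ∈ G, (c ∈ E ∧ ¬Disjoint E C) ∨ Y ⊆ E
            · exact mem_union_left _ (mem_union_right _ (mem_filter.2 ⟨hG, hGH, hc⟩))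
            · exact mem_union_right _ (mem_filter.2 ⟨hG, hGH, hc⟩)
      _ ≤ _ := (famWeight_union_le hx _ _).trans
          (add_le_add (famWeight_union_le hx _ _) le_rfl)
  have hlower : intWeight x H + famWeight x R' + famWeight x W ≤ intWeight x X' := by
    have hd1 : Disjoint (intFamilies H) R' := disjoint_left.2 fun G h1 h2 =>
      (mem_filter.1 h2).2.1 (mem_intFamilies.1 h1).1
    have hd2 : Disjoint (intFamilies H ∪ R') W := disjoint_left.2 fun G h1 h2 => by
      obtain ⟨-, E, hE, hEH, hEY⟩ := mem_filter.1 h2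
      rcases mem_union.1 h1 with h | h
      · exact hEH ((mem_intFamilies.1 h).1 hE)
      · exact hEY ((mem_filter.1 h).2.2 E hE hEH)
    calc _ = famWeight x (intFamilies H ∪ R' ∪ W) := by
          simp only [intWeight, famWeight]
          rw [sum_union hd2, sum_union hd1]
      _ ≤ _ := famWeight_mono hx (union_subset (union_subset (intFamilies_mono hHX')
          (filter_subset _ _)) (filter_subset _ _))
  suffices hmain : famWeight x NR ≤ famWeight x W by linarith
  -- If `Y` is a single point, every member contains `Y` and `NR` is empty.
  by_cases hℓ2 : ℓ = 1
  · have : NR = ∅ := by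
      refine filter_eq_empty_iff.2 fun G hG hcon => hcon.2 ?_
      obtain ⟨y, hy⟩ := card_eq_one.1 hℓ2
      refine ⟨y, fun E hE => Or.inr ?_⟩
      have := (mem_hitOrPair.1 ((mem_intFamilies.1 hG).1 hE)).2.1
      rw [hy, disjoint_singleton_right, not_not] at this
      rwa [hy, singleton_subset_iff]
    rw [this]
    simpa [famWeight] using famWeight_nonneg hx W
  have hℓ2' : 2 ≤ #Y := by omega
  set s := ℓ * k with hs
  set deg : Finset α → Finset (Finset α) → Finset (Finset α) := fun A S =>
    {E ∈ powersetCard k (univ : Finset α) | 3 ≤ #(E ∩ (A ∪ S.sup id ∪ Y ∪ C ∪ B))} with hdeg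
  -- The possible stars in the structure theorem: a centre `y ∈ Y`, or a centre `c ∈ C` with one
  -- point `y₀` left out of `Y`.
  set bases : Finset (Finset (Finset α)) :=
    Y.image (fun y => {E ∈ H | y ∈ E}) ∪ (C ×ˢ Y).image (fun p =>
      {E ∈ powersetCard k (univ : Finset α) | p.1 ∈ E ∧ ¬Disjoint E (Y.erase p.2)}) with hbases
  have hbasescard : #bases ≤ ℓ + k * ℓ := by
    refine (card_union_le _ _).trans (Nat.add_le_add card_image_le
      (card_image_le.trans ?_))
    rw [card_product]
    gcongr
  set L : Finset (Finset α) → Finset (Finset (Finset α)) := fun base =>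
    {G ∈ intFamilies X | ∃ A ∈ M, ∃ S ⊆ X, A ∉ S ∧ #S ≤ s ∧ insert A S ⊆ G ∧
      G ⊆ insert A S ∪ (base ∪ deg A S)} with hL
  have hNRsub : NR ⊆ bases.biUnion L := by
    intro G hG
    obtain ⟨hGi, hGH, hGR⟩ := mem_filter.1 hG
    obtain ⟨hGX, hGint⟩ := mem_intFamilies.1 hGi
    obtain ⟨A, hAG, hAH⟩ := not_subset.1 hGH
    have hAM : A ∈ M := mem_sdiff.2 ⟨hGX hAG, hAH⟩
    rcases exists_core_of_intersecting hY hYC hYB hGint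
      (fun E hE => (mem_hitOrPair.1 (hGX hE)).2.1)
      (fun E hE => (mem_hitOrPair.1 (hGX hE)).2.2) A with h | ⟨S, hSG, hAS, hSc, h⟩
    · exact absurd h hGR
    have hSs : #S ≤ s := hSc.trans (by rw [hs]; gcongr)
    have hins : insert A S ⊆ G := insert_subset hAG hSG
    rcases h with ⟨y, hy, h⟩ | ⟨c, hc, y₀, hy₀, h⟩
    · refine mem_biUnion.2 ⟨{E ∈ H | y ∈ E}, mem_union_left _ (mem_image_of_mem _ hy),
        mem_filter.2 ⟨hGi, A, hAM, S, hSG.trans hGX, hAS, hSs, hins, fun E hE => ?_⟩⟩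
      have hE' := mem_hitOrPair.1 (hGX hE)
      refine mem_union_right _ (mem_union.2 ?_)
      rcases h E hE with h3 | h3
      · exact Or.inr (mem_filter.2 ⟨mem_powersetCard_univ.2 hE'.1, h3⟩)
      · exact Or.inl (mem_filter.2 ⟨mem_hitBoth.2 ⟨hE'.1, hE'.2.1, h3.2⟩, h3.1⟩)
    · refine mem_biUnion.2 ⟨_, mem_union_right _ (mem_image_of_mem _
        (mem_product.2 ⟨hc, hy₀⟩ : (c, y₀) ∈ C ×ˢ Y)),
        mem_filter.2 ⟨hGi, A, hAM, S, hSG.trans hGX, hAS, hSs, hins, fun E hE => ?_⟩⟩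
      have hE' := mem_hitOrPair.1 (hGX hE)
      refine mem_union_right _ (mem_union.2 ?_)
      rcases h E hE with h3 | h3
      · exact Or.inr (mem_filter.2 ⟨mem_powersetCard_univ.2 hE'.1, h3⟩)
      · exact Or.inl (mem_filter.2 ⟨mem_powersetCard_univ.2 hE'.1, h3⟩)
  have hdegcard : ∀ A ∈ M, ∀ S ⊆ X, #S ≤ s → #(deg A S) ≤ D * N3 := by
    intro A hA S hS hSs
    refine (card_filter_le_card_inter k 3 _).trans ?_
    rw [hD]
    gcongr
    have hAk : #A = k := (mem_hitOrPair.1 (mem_sdiff.1 hA).1).1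
    have hSk : #(S.sup id) ≤ s * k := by
      rw [sup_eq_biUnion]
      refine card_biUnion_le.trans ((sum_le_card_nsmul _ _ k fun E hE => ?_).trans ?_)
      · exact (mem_hitOrPair.1 (hS hE)).1.le
      · rw [smul_eq_mul]
        gcongr
    have h1 := card_union_le (A ∪ S.sup id ∪ Y ∪ C) B
    have h2 := card_union_le (A ∪ S.sup id ∪ Y) C
    have h3 := card_union_le (A ∪ S.sup id) Y
    have h4 := card_union_le A (S.sup id)
    rw [hs] at hSk
    rw [configSize]
    omega
  have hN32 : N3 ≤ N2 := supCard_antitone_succ (by omega) hkn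
  -- A set of `X` outside `H` has a point in `Y` and two in `B`. These three bounded choices make
  -- the marked sets rare compared with `N2`.
  have hMcard : #M ≤ D * N3 := by
    calc #M ≤ #{E ∈ powersetCard k (univ : Finset α) | 3 ≤ #(E ∩ (Y ∪ B))} := by
          refine card_le_card fun E hE => ?_
          obtain ⟨hEX, hEH⟩ := mem_sdiff.1 hE
          obtain ⟨h1, h2, h3⟩ := mem_hitOrPair.1 hEX
          have h4 := h3.resolve_left fun h => hEH (mem_hitBoth.2 ⟨h1, h2, h⟩)
          obtain ⟨y, hyE, hyY⟩ := not_disjoint_iff.1 h2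
          refine mem_filter.2 ⟨mem_powersetCard_univ.2 h1, ?_⟩
          have hy' : y ∉ E ∩ B := fun h => disjoint_left.1 hYB hyY (mem_inter.1 h).2
          calc 3 ≤ #(insert y (E ∩ B)) := by rw [card_insert_of_notMem hy']; omega
            _ ≤ _ := card_le_card (insert_subset
                (mem_inter.2 ⟨hyE, mem_union_left _ hyY⟩)
                (inter_subset_inter_left subset_union_right))
      _ ≤ #(Y ∪ B) ^ 3 * N3 := card_filter_le_card_inter k 3 _
      _ ≤ _ := by
          rw [hD]
          gcongr
          have := card_union_le Y B
          rw [configSize]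
          omega
  -- Small enough that `q * s` uses at most a quarter of `N2`, and large enough that `#X` is at most
  -- a constant times `q`; `hN2` makes `q` positive.
  set q := N2 / (4 * (s + 1)) with hq
  have hqs : 4 * (q * s) ≤ N2 := by
    have := Nat.div_mul_le_self N2 (4 * (s + 1))
    rw [← hq] at this
    nlinarith
  have hq1 : N2 ≤ 8 * (s + 1) * q := by
    have h1 : 1 ≤ q := (Nat.one_le_div_iff (by omega)).2 hN2
    have h2 := Nat.div_add_mod N2 (4 * (s + 1))
    have h3 := Nat.mod_lt N2 (show 0 < 4 * (s + 1) by omega)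
    rw [← hq] at h2
    nlinarith
  set c := (ℓ + k + b) ^ 2 * (8 * (s + 1)) with hcdef
  have hc1 : 1 ≤ c := Nat.one_le_iff_ne_zero.2 (by rw [hcdef]; positivity)
  have hXcard : #X ≤ c * q := by
    calc #X ≤ #{E ∈ powersetCard k (univ : Finset α) | 2 ≤ #(E ∩ (Y ∪ C ∪ B))} := by
          refine card_le_card fun E hE => ?_
          obtain ⟨h1, h2, h3⟩ := mem_hitOrPair.1 hE
          refine mem_filter.2 ⟨mem_powersetCard_univ.2 h1, ?_⟩
          rcases h3 with h3 | h3
          · obtain ⟨y, hyE, hyY⟩ := not_disjoint_iff.1 h2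
            obtain ⟨c', hcE, hcC⟩ := not_disjoint_iff.1 h3
            have hne : y ≠ c' := fun h => disjoint_left.1 hYC hyY (h ▸ hcC)
            rw [← card_pair hne]
            refine card_le_card (insert_subset (mem_inter.2 ⟨hyE, by simp [hyY]⟩)
              (singleton_subset_iff.2 (mem_inter.2 ⟨hcE, by simp [hcC]⟩)))
          · exact h3.trans (card_le_card (inter_subset_inter_left subset_union_right))
      _ ≤ #(Y ∪ C ∪ B) ^ 2 * N2 := card_filter_le_card_inter k 2 _
      _ ≤ (ℓ + k + b) ^ 2 * (8 * (s + 1) * q) := by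
          gcongr
          have h1 := card_union_le (Y ∪ C) B
          have h2 := card_union_le Y C
          omega
      _ = c * q := by rw [hcdef]; ring
  have hpetal : ∀ y ∈ Y, N2 ≤ #(petal k Y C a y) + (ℓ + k) * N3 := fun y hy =>
    (supCard_le_card_petal k hYC haY haC hy).trans (by gcongr)
  -- The first three terms pay for the choice of `S`, the pool, and the marked set; the last bounds
  -- how far the petals over all of `Y` fall short of `ℓ * N2`.
  have hbudget : q * s + D * N3 + D * N3 * F + ℓ * ((ℓ + k) * N3) ≤ N2 := by
    have : 2 * (D + D * F + ℓ * (ℓ + k)) * N3 =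
      2 * (D * N3 + D * N3 * F + ℓ * ((ℓ + k) * N3)) := by ring
    omega
  have hpart : ∀ base ∈ bases, ((ℓ + k * ℓ : ℕ) : ℝ) * famWeight x (L base) ≤ famWeight x W := by
    intro base hbase
    have hcert := famWeight_le_of_marked_cert hx (𝒢 := L base) M X s (#base + D * N3)
      (fun A S => base ∪ deg A S)
      (fun A hA S hS hSs => (card_union_le _ _).trans
        (Nat.add_le_add le_rfl (hdegcard A hA S hS hSs)))
      (fun G hG => (mem_filter.1 hG).2)
    refine (mul_le_mul_of_nonneg_left hcert (by positivity)).trans ?_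
    have hMF : #M * ((s + 1) * c ^ s * (ℓ + k * ℓ)) ≤ D * N3 * F := by
      rw [hF, petalFactor]
      exact Nat.mul_le_mul_right _ hMcard
    rcases mem_union.1 hbase with hb | hb
    -- A star at `y` is enlarged by the petal at `y`, all of whose sets contain `y`.
    · obtain ⟨y, hy, rfl⟩ := mem_image.1 hb
      have hp := hpetal y hy
      have h1 : (ℓ + k) * N3 ≤ ℓ * ((ℓ + k) * N3) := Nat.le_mul_of_pos_left _ hℓ1
      have ht : q * s + D * N3 + D * N3 * F ≤ #(petal k Y C a y) := by omega
      refine (marked_weight_le_gain hx hXcard hc1 hMF ht).trans ?_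
      rw [mul_sub, ← pow_add, mul_one]
      have hdisj : Disjoint ({E ∈ H | y ∈ E} : Finset (Finset α)) (petal k Y C a y) :=
        disjoint_left.2 fun E h1 h2 =>
          notMem_hitBoth_of_mem_petal h2 (mem_filter.1 h1).1
      rw [← card_union_of_disjoint hdisj]
      refine petal_gain_le hx hℓ2' _ _ subset_union_left
        (union_subset ((filter_subset _ _).trans hHX') (petal_subset_hitBoth hy)) ?_ ?_
      · have hyall : ∀ E ∈ ({E ∈ H | y ∈ E} : Finset (Finset α)) ∪ petal k Y C a y, y ∈ E := by
          intro E hE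
          rcases mem_union.1 hE with h | h
          · exact (mem_filter.1 h).2
          · exact (mem_petal.1 h).2.1.1
        exact fun E hE E' hE' => not_disjoint_iff.2 ⟨y, hyall E hE, hyall E' hE'⟩
      · exact fun E hE hE' => ⟨y, (mem_union.1 hE).resolve_left hE'⟩
    -- A star at `c'` that avoids `y₀` has at most `(ℓ - 1) * N2` sets, whereas the petals over all
    -- `y ∈ Y` form a star at `a` of nearly `ℓ * N2` sets. The surplus is about `N2`.
    · obtain ⟨⟨c', y₀⟩, hcy, rfl⟩ := mem_image.1 hb
      obtain ⟨hc', hy₀⟩ := mem_product.1 hcy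
      set T := Y.biUnion fun y => petal k Y C a y with hT
      have hpd : Set.PairwiseDisjoint (Y : Set α) (fun y => petal k Y C a y) := by
        intro y hy y' hy' hne
        refine disjoint_left.2 fun E h1 h2 => ?_
        exact disjoint_left.1 (mem_petal.1 h1).2.2.1 (mem_petal.1 h2).2.1.1
          (mem_erase.2 ⟨hne.symm, hy'⟩)
      have hTcard : ℓ * N2 ≤ #T + ℓ * ((ℓ + k) * N3) := by
        rw [hT, card_biUnion (fun y hy y' hy' h => hpd hy hy' h)]
        calc ℓ * N2 = ∑ y ∈ Y, N2 := by rw [sum_const, smul_eq_mul]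
          _ ≤ ∑ y ∈ Y, (#(petal k Y C a y) + (ℓ + k) * N3) := sum_le_sum hpetal
          _ = _ := by rw [sum_add_distrib, sum_const, smul_eq_mul]
      have hbcard : #({E ∈ powersetCard k (univ : Finset α) |
          c' ∈ E ∧ ¬Disjoint E (Y.erase y₀)} : Finset (Finset α)) ≤ (ℓ - 1) * N2 := by
        have hcY : Disjoint ({c'} : Finset α) (Y.erase y₀) :=
          disjoint_singleton_left.2 fun h => disjoint_left.1 hYC (mem_of_mem_erase h) hc'
        have := card_filter_superset_not_disjoint_le k hcY
        rw [card_erase_of_mem hy₀, card_singleton, ← hnn, ← hℓ] at this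
        simpa only [singleton_subset_iff] using this
      have hsplit : ℓ * N2 = (ℓ - 1) * N2 + N2 := by
        obtain ⟨j, hj⟩ : ∃ j, ℓ = j + 1 := ⟨ℓ - 1, by omega⟩
        rw [hj]
        simp
        ring
      have ht : q * s + D * N3 + D * N3 * F ≤ #T - (ℓ - 1) * N2 := by omega
      have hle : (ℓ - 1) * N2 ≤ #T := by omega
      have hmono : (1 + x) ^ (#({E ∈ powersetCard k (univ : Finset α) |
          c' ∈ E ∧ ¬Disjoint E (Y.erase y₀)} : Finset (Finset α)) + D * N3) ≤
          (1 + x) ^ ((ℓ - 1) * N2 + D * N3) := pow_le_pow_right₀ hμ (by omega)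
      refine le_trans ?_ (le_trans (marked_weight_le_gain hx hXcard hc1 hMF ht
        (B := (ℓ - 1) * N2)) ?_)
      · exact mul_le_mul_of_nonneg_left (mul_le_mul_of_nonneg_left hmono
          (mul_nonneg (by positivity) (sum_nonneg fun _ _ => by positivity))) (by positivity)
      · rw [mul_sub, ← pow_add, mul_one, Nat.add_sub_cancel' hle]
        have h1 : (1 : ℝ) ≤ (1 + x) ^ ((ℓ - 1) * N2) := one_le_pow₀ hμ
        have h2 : (1 + x) ^ #T - (1 + x) ^ #(∅ : Finset (Finset α)) ≤ famWeight x W := by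
          refine petal_gain_le hx hℓ2' T ∅ (empty_subset _) ?_ ?_ ?_
          · exact biUnion_subset.2 fun y hy => petal_subset_hitBoth hy
          · have haall : ∀ E ∈ T, a ∈ E := by
              intro E hE
              obtain ⟨y, -, h⟩ := mem_biUnion.1 hE
              exact (mem_petal.1 h).2.1.2
            exact fun E hE E' hE' => not_disjoint_iff.2 ⟨a, haall E hE, haall E' hE'⟩
          · intro E hE _
            obtain ⟨y, -, h⟩ := mem_biUnion.1 hE
            exact ⟨y, h⟩
        rw [card_empty, pow_zero] at h2
        linarith
  have hKpos : (0 : ℝ) < ((ℓ + k * ℓ : ℕ) : ℝ) := by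
    exact_mod_cast (by omega : 0 < ℓ + k * ℓ)
  have hWnn := famWeight_nonneg hx W
  -- Each of the at most `ℓ + k * ℓ` bases takes up at most that fraction of the weight of `W`; this
  -- is the last factor in `petalFactor`.
  have htotal : ((ℓ + k * ℓ : ℕ) : ℝ) * famWeight x NR ≤
      ((ℓ + k * ℓ : ℕ) : ℝ) * famWeight x W := by
    calc ((ℓ + k * ℓ : ℕ) : ℝ) * famWeight x NR
        ≤ ((ℓ + k * ℓ : ℕ) : ℝ) * ∑ base ∈ bases, famWeight x (L base) :=
          mul_le_mul_of_nonneg_left ((famWeight_mono hx hNRsub).trans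
            (famWeight_biUnion_le hx _ _)) hKpos.le
      _ = ∑ base ∈ bases, ((ℓ + k * ℓ : ℕ) : ℝ) * famWeight x (L base) := mul_sum _ _ _
      _ ≤ ∑ base ∈ bases, famWeight x W := sum_le_sum hpart
      _ = #bases * famWeight x W := by rw [sum_const, nsmul_eq_mul]
      _ ≤ _ := by
          gcongr
  exact le_of_mul_le_mul_left htotal hKpos

end Core

/-! ### Growth of the counts with the ground set -/

section SupCard

theorem one_le_supCard {n k j : ℕ} (hjk : j ≤ k) (hkn : k ≤ n) : 1 ≤ supCard n k j := by
  rw [supCard, if_pos hjk]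
  exact Nat.choose_pos (by omega)

theorem le_mul_supCard {n k j : ℕ} (hjk : j < k) (hkn : k ≤ n) : n - j ≤ k * supCard n k j := by
  calc n - j ≤ (n - j) * supCard n k (j + 1) :=
        Nat.le_mul_of_pos_right _ (one_le_supCard hjk hkn)
    _ = (k - j) * supCard n k j := supCard_succ_mul (by omega)
    _ ≤ _ := Nat.mul_le_mul_right _ (Nat.sub_le _ _)

theorem mul_supCard_succ_le {n k j c : ℕ} (hk : 0 < k) (hjn : j < n) (hc : c * k ≤ n - j) :
    c * supCard n k (j + 1) ≤ supCard n k j := by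
  refine Nat.le_of_mul_le_mul_left ?_ hk
  calc k * (c * supCard n k (j + 1)) = c * k * supCard n k (j + 1) := by ring
    _ ≤ (n - j) * supCard n k (j + 1) := by gcongr
    _ = (k - j) * supCard n k j := supCard_succ_mul hjn
    _ ≤ _ := Nat.mul_le_mul_right _ (Nat.sub_le _ _)

end SupCard

/-! ### Invariance under permutations of the ground set -/

section Permutation

variable {α : Type*} [DecidableEq α]

/-- A permutation carrying three disjoint sets to three disjoint sets of the same sizes. -/
theorem exists_perm_of_card_eq [Fintype α] {Y K T Y' K' T' : Finset α} (hYK : Disjoint Y K)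
    (hYT : Disjoint Y T) (hKT : Disjoint K T) (hYK' : Disjoint Y' K') (hYT' : Disjoint Y' T')
    (hKT' : Disjoint K' T') (hY : #Y = #Y') (hK : #K = #K') (hT : #T = #T') :
    ∃ σ : Equiv.Perm α, (∀ a, σ a ∈ Y' ↔ a ∈ Y) ∧ (∀ a, σ a ∈ K' ↔ a ∈ K) ∧
      ∀ a, σ a ∈ T' ↔ a ∈ T := by
  -- Colour each point by the set containing it, with `3` for none. Colour classes of equal size can
  -- be matched by a permutation.
  set f : Finset α → Finset α → Finset α → α → ℕ := fun A B C a =>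
    if a ∈ A then 0 else if a ∈ B then 1 else if a ∈ C then 2 else 3 with hf
  have hmem : ∀ {A B C : Finset α}, Disjoint A B → Disjoint A C → Disjoint B C → ∀ a,
      (f A B C a = 0 ↔ a ∈ A) ∧ (f A B C a = 1 ↔ a ∈ B) ∧ (f A B C a = 2 ↔ a ∈ C) ∧
      (f A B C a = 3 ↔ a ∈ (A ∪ B ∪ C)ᶜ) ∧ f A B C a ≤ 3 := by
    intro A B C h1 h2 h3 a
    have h1 : a ∈ A → a ∉ B := fun h => disjoint_left.1 h1 h
    have h2 : a ∈ A → a ∉ C := fun h => disjoint_left.1 h2 h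
    have h3 : a ∈ B → a ∉ C := fun h => disjoint_left.1 h3 h
    simp only [hf, mem_compl, mem_union]
    split_ifs with h4 h5 h6 <;> simp_all
  have hcard : ∀ c, Fintype.card {a // f Y K T a = c} = Fintype.card {a // f Y' K' T' a = c} := by
    intro c
    rw [Fintype.card_subtype, Fintype.card_subtype]
    have hcompl : #((Y ∪ K ∪ T)ᶜ) = #((Y' ∪ K' ∪ T')ᶜ) := by
      rw [card_compl, card_compl, card_union_of_disjoint (disjoint_union_left.2 ⟨hYT, hKT⟩),
        card_union_of_disjoint hYK, card_union_of_disjoint (disjoint_union_left.2 ⟨hYT', hKT'⟩),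
        card_union_of_disjoint hYK', hY, hK, hT]
    have e := hmem hYK hYT hKT
    have e' := hmem hYK' hYT' hKT'
    obtain rfl | rfl | rfl | rfl | hc : c = 0 ∨ c = 1 ∨ c = 2 ∨ c = 3 ∨ 3 < c := by omega
    · simpa only [(e _).1, (e' _).1, filter_univ_mem] using hY
    · simpa only [(e _).2.1, (e' _).2.1, filter_univ_mem] using hK
    · simpa only [(e _).2.2.1, (e' _).2.2.1, filter_univ_mem] using hT
    · simpa only [(e _).2.2.2.1, (e' _).2.2.2.1, filter_univ_mem] using hcompl
    · rw [filter_false_of_mem fun a _ => by have := (e a).2.2.2.2; omega,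
        filter_false_of_mem fun a _ => by have := (e' a).2.2.2.2; omega]
  set σ : Equiv.Perm α :=
    Equiv.ofFiberEquiv (f := f Y K T) (g := f Y' K' T') fun c => Fintype.equivOfCardEq (hcard c)
  have hσ : ∀ a, f Y' K' T' (σ a) = f Y K T a := fun a => Equiv.ofFiberEquiv_map _ a
  refine ⟨σ, fun a => ?_, fun a => ?_, fun a => ?_⟩
  · rw [← (hmem hYK' hYT' hKT' _).1, hσ, (hmem hYK hYT hKT _).1]
  · rw [← (hmem hYK' hYT' hKT' _).2.1, hσ, (hmem hYK hYT hKT _).2.1]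
  · rw [← (hmem hYK' hYT' hKT' _).2.2.1, hσ, (hmem hYK hYT hKT _).2.2.1]

theorem intWeight_le_of_perm {x : ℝ} (hx : 0 ≤ x) {F F' : Finset (Finset α)} (σ : Equiv.Perm α)
    (h : ∀ E ∈ F, E.map σ.toEmbedding ∈ F') : intWeight x F ≤ intWeight x F' :=
  intWeight_le_of_injOn hx (fun E => E.map σ.toEmbedding) h
    (fun _ _ _ _ he => map_injective _ he)
    fun _ _ _ _ hAB hd => hAB ((disjoint_map σ.toEmbedding).1 hd)

omit [DecidableEq α] in
theorem disjoint_map_perm_iff {A B : Finset α} {σ : Equiv.Perm α} (h : ∀ a, σ a ∈ B ↔ a ∈ A)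
    (E : Finset α) : Disjoint (E.map σ.toEmbedding) B ↔ Disjoint E A := by
  simp only [disjoint_left, mem_map_equiv]
  constructor
  · intro h1 a ha hA
    exact h1 (a := σ a) (by simpa using ha) ((h a).2 hA)
  · intro h1 a ha hB
    refine h1 ha ((h _).1 ?_)
    simpa using hB

end Permutation

/-! ### Conditioning on the trace in the remainder -/

section Link

variable {α : Type*} [DecidableEq α]

/-- The members of a family which meet every member of `S`. -/
def crossing (U S : Finset (Finset α)) : Finset (Finset α) :=
  {E ∈ U | ∀ A ∈ S, ¬Disjoint E A}

theorem mem_crossing {U S : Finset (Finset α)} {E : Finset α} :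
    E ∈ crossing U S ↔ E ∈ U ∧ ∀ A ∈ S, ¬Disjoint E A := by
  rw [crossing, mem_filter]

/-- An intersecting `G ⊆ U ∪ R` is determined by its trace `S` on `R` together with an intersecting
family of sets of `U`, each meeting all members of `S`. -/
theorem intWeight_union {x : ℝ} {U R : Finset (Finset α)} (hUR : Disjoint U R) :
    intWeight x (U ∪ R) = ∑ S ∈ intFamilies R, x ^ #S * intWeight x (crossing U S) := by
  simp only [intWeight, famWeight, mul_sum, ← pow_add]
  rw [sum_sigma']
  refine sum_bij' (fun G _ => (⟨G ∩ R, G ∩ U⟩ : (_ : Finset (Finset α)) × Finset (Finset α)))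
    (fun p _ => p.1 ∪ p.2) ?_ ?_ ?_ ?_ ?_
  · intro G hG
    obtain ⟨h1, h2⟩ := mem_intFamilies.1 hG
    refine mem_sigma.2 ⟨mem_intFamilies.2 ⟨inter_subset_right, h2.mono (by simp)⟩,
      mem_intFamilies.2 ⟨fun E hE => mem_crossing.2 ⟨(mem_inter.1 hE).2, fun A hA => ?_⟩,
        h2.mono (by simp)⟩⟩
    exact h2 (mem_coe.2 (mem_inter.1 hE).1) (mem_coe.2 (mem_inter.1 hA).1)
  · intro p hp
    obtain ⟨h1, h2⟩ := mem_sigma.1 hp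
    obtain ⟨h3, h4⟩ := mem_intFamilies.1 h1
    obtain ⟨h5, h6⟩ := mem_intFamilies.1 h2
    refine mem_intFamilies.2 ⟨union_subset (h3.trans subset_union_right)
      ((h5.trans (filter_subset _ _)).trans subset_union_left), ?_⟩
    intro A hA B hB
    rcases mem_union.1 (mem_coe.1 hA) with hA | hA <;> rcases mem_union.1 (mem_coe.1 hB) with hB | hB
    · exact h4 (mem_coe.2 hA) (mem_coe.2 hB)
    · exact fun h => (mem_crossing.1 (h5 hB)).2 A hA h.symm
    · exact (mem_crossing.1 (h5 hA)).2 B hB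
    · exact h6 (mem_coe.2 hA) (mem_coe.2 hB)
  · intro G hG
    rw [← inter_union_distrib_left, inter_eq_left, union_comm]
    exact (mem_intFamilies.1 hG).1
  · intro p hp
    obtain ⟨h1, h2⟩ := mem_sigma.1 hp
    have h3 := (mem_intFamilies.1 h1).1
    have h4 : p.2 ⊆ U := (mem_intFamilies.1 h2).1.trans (filter_subset _ _)
    have e1 : (p.1 ∪ p.2) ∩ R = p.1 := by
      rw [union_inter_distrib_right, inter_eq_left.2 h3,
        disjoint_iff_inter_eq_empty.1 (hUR.mono_left h4), union_empty]
    have e2 : (p.1 ∪ p.2) ∩ U = p.2 := by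
      rw [union_inter_distrib_right, inter_eq_left.2 h4,
        disjoint_iff_inter_eq_empty.1 (hUR.symm.mono_left h3), empty_union]
    exact Sigma.ext e1 (heq_of_eq e2)
  · intro G hG
    congr 1
    have h := (mem_intFamilies.1 hG).1
    have h2 : Disjoint (G ∩ R) (G ∩ U) :=
      hUR.symm.mono inter_subset_right inter_subset_right
    rw [← card_union_of_disjoint h2, ← inter_union_distrib_left, inter_eq_left.2]
    rwa [union_comm]

theorem one_le_intWeight {x : ℝ} (hx : 0 ≤ x) (F : Finset (Finset α)) : 1 ≤ intWeight x F := by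
  have : ∅ ∈ intFamilies F := mem_intFamilies.2 ⟨empty_subset _, by
    rw [coe_empty]; exact Set.intersecting_empty⟩
  have h := single_le_sum (f := fun G : Finset (Finset α) => x ^ #G)
    (fun G _ => pow_nonneg hx _) this
  simpa [intWeight, famWeight] using h

theorem intWeight_empty (x : ℝ) : intWeight x (∅ : Finset (Finset α)) = 1 := by
  rw [intWeight_of_intersecting x (by rw [coe_empty]; exact Set.intersecting_empty)]
  simp

theorem mem_sunflower {K T E : Finset α} : E ∈ sunflower K T ↔ ∃ t ∈ T, insert t K = E := by
  simp [sunflower]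

/-- A family of sets of size `k` either is a sunflower with kernel of size `k - 1`, or its
transversals outside a small common core have two points in a bounded set. -/
theorem exists_core_or_sunflower {k : ℕ} {S : Finset (Finset α)} (hS : S.Nonempty)
    (hSk : ∀ A ∈ S, #A = k) (hk : 1 ≤ k) :
    (∃ K T, #K + 1 = k ∧ Disjoint K T ∧ S = sunflower K T ∧ K ⊆ S.sup id ∧ T ⊆ S.sup id) ∨
    ∃ C B, #C + 2 ≤ k ∧ #B ≤ k + k * k ∧ C ⊆ S.sup id ∧ B ⊆ S.sup id ∧
      ∀ E, (∀ A ∈ S, ¬Disjoint E A) → ¬Disjoint E C ∨ 2 ≤ #(E ∩ B) := by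
  obtain ⟨A₀, hA₀⟩ := hS
  -- `C` is the common intersection of the members of `S`; the cases are `#C ≤ k - 2` and `#C ≥ k -
  -- 1`.
  set C : Finset α := {c ∈ A₀ | ∀ A ∈ S, c ∈ A} with hC
  have hCA : C ⊆ A₀ := filter_subset _ _
  have hle : ∀ A ∈ S, A ⊆ S.sup id := fun A hA => le_sup (f := id) hA
  by_cases hCk : #C + 2 ≤ k
  · right
    have hex : ∀ p ∈ A₀ \ C, ∃ A ∈ S, p ∉ A := by
      intro p hp
      rw [mem_sdiff, hC, mem_filter, not_and] at hp
      have := hp.2 hp.1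
      push Not at this
      exact this
    choose! f hfS hfp using hex
    -- `B` consists of `A₀` and, for each `p ∈ A₀ \ C`, a member `f p` avoiding `p`, with `C`
    -- removed. A transversal missing `C` meets `A₀` in some `p`, then `f p` in another point.
    refine ⟨C, (A₀ ∪ A₀.biUnion fun p => if p ∈ C then ∅ else f p) \ C, hCk, ?_,
      hCA.trans (hle _ hA₀), ?_, ?_⟩
    · refine (card_le_card sdiff_subset).trans ((card_union_le _ _).trans ?_)
      rw [hSk _ hA₀]
      refine Nat.add_le_add_left ?_ _
      refine card_biUnion_le.trans ((sum_le_card_nsmul _ _ k fun p hp => ?_).trans ?_)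
      · split_ifs with h
        · simp
        · exact (hSk _ (hfS p (mem_sdiff.2 ⟨hp, h⟩))).le
      · rw [hSk _ hA₀, smul_eq_mul]
    · refine sdiff_subset.trans (union_subset (hle _ hA₀) (biUnion_subset.2 fun p hp => ?_))
      split_ifs with h
      · simp
      · exact hle _ (hfS p (mem_sdiff.2 ⟨hp, h⟩))
    · intro E hE
      by_cases hEC : Disjoint E C
      · right
        obtain ⟨p, hpE, hpA⟩ := not_disjoint_iff.1 (hE _ hA₀)
        have hpC : p ∉ C := disjoint_left.1 hEC hpE
        have hp : p ∈ A₀ \ C := mem_sdiff.2 ⟨hpA, hpC⟩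
        obtain ⟨q, hqE, hqA⟩ := not_disjoint_iff.1 (hE _ (hfS p hp))
        have hqC : q ∉ C := disjoint_left.1 hEC hqE
        have hne : p ≠ q := fun h => hfp p hp (h ▸ hqA)
        rw [← card_pair hne]
        refine card_le_card (insert_subset ?_ (singleton_subset_iff.2 ?_))
        · exact mem_inter.2 ⟨hpE, mem_sdiff.2 ⟨mem_union_left _ hpA, hpC⟩⟩
        · refine mem_inter.2 ⟨hqE, mem_sdiff.2 ⟨mem_union_right _ (mem_biUnion.2
            ⟨p, hpA, ?_⟩), hqC⟩⟩
          rwa [if_neg hpC]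
      · exact Or.inl hEC
  · left
    have hCk' : k - 1 ≤ #C := by omega
    obtain ⟨K, hKC, hK⟩ := exists_subset_card_eq hCk'
    have hKA : ∀ A ∈ S, K ⊆ A := fun A hA c hc => (mem_filter.1 (hKC hc)).2 A hA
    have h1 : ∀ A ∈ S, ∃ t, t ∉ K ∧ insert t K = A := by
      intro A hA
      have hc : #(A \ K) = 1 := by
        rw [card_sdiff_of_subset (hKA A hA), hSk A hA, hK]
        omega
      obtain ⟨t, ht⟩ := card_eq_one.1 hc
      refine ⟨t, (mem_sdiff.1 (ht ▸ mem_singleton_self t)).2, ?_⟩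
      rw [insert_eq, ← ht, sdiff_union_of_subset (hKA A hA)]
    refine ⟨K, (S.sup id) \ K |>.filter fun t => insert t K ∈ S, by omega,
      disjoint_sdiff.mono_right (filter_subset _ _), ?_,
      (hKA _ hA₀).trans (hle _ hA₀), (filter_subset _ _).trans sdiff_subset⟩
    ext A
    rw [mem_sunflower]
    constructor
    · intro hA
      obtain ⟨t, ht, rfl⟩ := h1 A hA
      exact ⟨t, mem_filter.2 ⟨mem_sdiff.2 ⟨hle _ hA (mem_insert_self _ _), ht⟩, hA⟩, rfl⟩
    · rintro ⟨t, ht, rfl⟩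
      exact (mem_filter.1 ht).2

end Link

/-! ### Sunflowers are optimal remainders -/

/-- A bound beyond which the families `hitFam k Y ∪ R` are dominated by those where `R` is a
sunflower. -/
def sunflowerThreshold (k ℓ : ℕ) : ℕ :=
  2 + ℓ + k + 1 + ((k + k * k) ^ 2 + k) * k + 4 * (ℓ * k + 1) * k +
    2 * (configSize k ℓ (k + k * k) ^ 3 + configSize k ℓ (k + k * k) ^ 3 *
      petalFactor k ℓ (k + k * k) + ℓ * (ℓ + k)) * k

theorem exists_mapsTo_injOn_of_card_le {β γ : Type*} {s : Finset β} {t : Finset γ}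
    (h : #s ≤ #t) (f₀ : β → γ) : ∃ f : β → γ, (∀ a ∈ s, f a ∈ t) ∧ Set.InjOn f s := by
  classical
  obtain ⟨e⟩ : Nonempty (s ↪ t) := Function.Embedding.nonempty_of_card_le (by simpa using h)
  refine ⟨fun a => if h : a ∈ s then (e ⟨a, h⟩ : γ) else f₀ a, fun a ha => ?_, fun a ha b hb hab => ?_⟩
  · simp only [ha, dif_pos]
    exact (e ⟨a, ha⟩).2
  · rw [mem_coe] at ha hb
    simp only [ha, hb, dif_pos] at hab
    simpa using e.injective (Subtype.ext hab)

section

variable {α : Type*} [Fintype α] [DecidableEq α]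

/-- Only the sizes of the three disjoint sets matter, since a permutation carries one configuration
to the other. -/
theorem intWeight_crossing_le_of_sunflower {x : ℝ} (hx : 0 ≤ x) {k : ℕ} {Y K T Y' K' T' : Finset α}
    (hYK : Disjoint Y K) (hYT : Disjoint Y T) (hKT : Disjoint K T) (hYK' : Disjoint Y' K')
    (hYT' : Disjoint Y' T') (hKT' : Disjoint K' T') (hY : #Y = #Y') (hK : #K = #K')
    (hT : #T = #T') :
    intWeight x (crossing (hitFam k Y) (sunflower K T)) ≤
      intWeight x (crossing (hitFam k Y') (sunflower K' T')) := by
  obtain ⟨σ, h1, h2, h3⟩ := exists_perm_of_card_eq hYK hYT hKT hYK' hYT' hKT' hY hK hT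
  refine intWeight_le_of_perm hx σ fun E hE => ?_
  obtain ⟨hE1, hE2⟩ := mem_crossing.1 hE
  rw [mem_hitFam] at hE1
  refine mem_crossing.2 ⟨mem_hitFam.2 ⟨by rw [card_map, hE1.1], ?_⟩, fun A hA => ?_⟩
  · rw [disjoint_map_perm_iff h1]
    exact hE1.2
  · obtain ⟨t, ht, rfl⟩ := mem_sunflower.1 hA
    obtain ⟨t, rfl⟩ := σ.surjective t
    rw [disjoint_map_perm_iff (A := insert t K)]
    · exact hE2 _ (mem_sunflower.2 ⟨t, (h3 t).1 ht, rfl⟩)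
    · intro a
      rw [mem_insert, mem_insert, h2, σ.injective.eq_iff]

/-- After moving `C` to `K'`, a set meeting `K'` meets every petal of the sunflower. -/
theorem intWeight_hitBoth_le {x : ℝ} (hx : 0 ≤ x) {k : ℕ} {Y C Y' K' T' : Finset α}
    (hYC : Disjoint Y C) (hYK' : Disjoint Y' K') (hY : #Y = #Y') (hC : #C = #K') :
    intWeight x (hitBoth k Y C) ≤
      intWeight x (crossing (hitFam k Y') (sunflower K' T')) := by
  obtain ⟨σ, h1, h2, -⟩ := exists_perm_of_card_eq (T := ∅) (T' := ∅) hYC (disjoint_empty_right _)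
    (disjoint_empty_right _) hYK' (disjoint_empty_right _) (disjoint_empty_right _) hY hC rfl
  refine intWeight_le_of_perm hx σ fun E hE => ?_
  obtain ⟨hE1, hE2, hE3⟩ := mem_hitBoth.1 hE
  refine mem_crossing.2 ⟨mem_hitFam.2 ⟨by rw [card_map, hE1], ?_⟩, fun A hA => ?_⟩
  · rwa [disjoint_map_perm_iff h1]
  · obtain ⟨t, ht, rfl⟩ := mem_sunflower.1 hA
    rw [← disjoint_map_perm_iff h2] at hE3
    exact fun h => hE3 (h.mono_right (subset_insert _ _))

/-- A sunflower with kernel of size `k - 1` matches up to a permutation. Otherwise the core `C` of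
`S` has at most `k - 2` points, so there is room to add a point `a`, trade all pairs in `B` for it,
and extend to a kernel of size `k - 1`. -/
theorem intWeight_crossing_le {x : ℝ} (hx : 0 ≤ x) {k : ℕ} (hk : 2 ≤ k) {Y : Finset α}
    (hY : Y.Nonempty) (hn : sunflowerThreshold k #Y ≤ Fintype.card α) {S : Finset (Finset α)}
    (hS : ∀ A ∈ S, #A = k ∧ Disjoint A Y) {Y' K T : Finset α} (hY' : #Y = #Y')
    (hK : #K + 1 = k) (hYK : Disjoint Y' K) (hYT : Disjoint Y' T) (hKT : Disjoint K T)
    (hST : #S = #T) :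
    intWeight x (crossing (hitFam k Y) S) ≤
      intWeight x (crossing (hitFam k Y') (sunflower K T)) := by
  rw [sunflowerThreshold] at hn
  have hbig : ∀ C ⊆ Yᶜ, #C ≤ k - 1 → ∃ C', C ⊆ C' ∧ Disjoint Y C' ∧ #C' = k - 1 := by
    intro C hC hCk
    obtain ⟨C', h1, h2, h3⟩ := exists_subsuperset_card_eq hC hCk
      (by rw [card_compl]; omega)
    exact ⟨C', h1, disjoint_left.2 fun a h h' => mem_compl.1 (h2 h') h, h3⟩
  rcases S.eq_empty_or_nonempty with rfl | hSne
  · obtain ⟨C', -, h2, h3⟩ := hbig ∅ (empty_subset _) (by simp)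
    have hT : T = ∅ := by
      rw [card_empty] at hST
      exact card_eq_zero.1 hST.symm
    have := intWeight_crossing_le_of_sunflower hx (k := k) h2 (disjoint_empty_right _)
      (disjoint_empty_right _) hYK hYT hKT hY' (by omega) (T := ∅) (by simp [hT])
    simpa [sunflower] using this
  have hsup : Disjoint Y (S.sup id) := by
    rw [disjoint_comm, Finset.disjoint_sup_left]
    exact fun A hA => (hS A hA).2
  rcases exists_core_or_sunflower hSne (fun A hA => (hS A hA).1) (by omega) with
    ⟨K', T', h1, h2, rfl, h3, h4⟩ | ⟨C, B, h1, h2, h3, h4, h5⟩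
  · refine intWeight_crossing_le_of_sunflower hx (hsup.mono_right h3) (hsup.mono_right h4) h2 hYK
      hYT hKT hY' (by omega) ?_
    rw [← hST, card_sunflower h2]
  have hYC := hsup.mono_right h3
  have hYB := hsup.mono_right h4
  have hsub : crossing (hitFam k Y) S ⊆ hitOrPair k Y C B := fun E hE => by
    obtain ⟨hE1, hE2⟩ := mem_crossing.1 hE
    rw [mem_hitFam] at hE1
    exact mem_hitOrPair.2 ⟨hE1.1, hE1.2, h5 E hE2⟩
  refine (intWeight_mono hx hsub).trans ?_
  obtain rfl | hk3 : k = 2 ∨ 3 ≤ k := by omega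
  -- For `k = 2` the core is empty, and an edge with two points in `B` lies inside `B`, which misses
  -- `Y`.
  · have : hitOrPair 2 Y C B = ∅ := by
      refine eq_empty_of_forall_notMem fun E hE => ?_
      obtain ⟨hE1, hE2, hE3⟩ := mem_hitOrPair.1 hE
      have hC : C = ∅ := card_eq_zero.1 (by omega)
      have hE4 := hE3.resolve_left (by simp [hC])
      have hEB : E ∩ B = E := eq_of_subset_of_card_le inter_subset_left (by omega)
      exact hE2 (hYB.symm.mono_left (inter_eq_left.1 hEB))
    rw [this, intWeight_empty]
    exact one_le_intWeight hx _
  · have hYCc : #(Y ∪ C) < Fintype.card α := by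
      have := card_union_le Y C
      omega
    obtain ⟨a, ha⟩ : ∃ a, a ∉ Y ∪ C := by
      by_contra! h
      rw [eq_univ_of_forall h, card_univ] at hYCc
      omega
    rw [mem_union, not_or] at ha
    have hN2 : Fintype.card α - 2 ≤ k * supCard (Fintype.card α) k 2 :=
      le_mul_supCard (by omega) (by omega)
    refine (intWeight_hitOrPair_le hx hY hYC hYB ha.1 ha.2 h2 (by omega) (by omega) (by omega)
      ?_ (mul_supCard_succ_le (by omega) (by omega) (by omega))).trans ?_
    · refine Nat.le_of_mul_le_mul_right (c := k) ?_ (by omega)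
      rw [mul_comm (supCard _ _ _)]
      omega
    · obtain ⟨C', h6, h7, h8⟩ := hbig (insert a C) (insert_subset (mem_compl.2 ha.1)
        fun c hc => mem_compl.2 fun h => disjoint_left.1 hYC h hc)
        ((card_insert_le _ _).trans (by omega))
      exact (intWeight_mono hx (hitBoth_mono k Y h6)).trans
        (intWeight_hitBoth_le hx h7 hYK hY' (by omega))

/-- Among the families containing all `k`-sets that meet a given `ℓ`-set, those whose remaining
members form a sunflower are optimal. -/
theorem intWeight_hitFam_union_le {x : ℝ} (hx : 0 ≤ x) {k : ℕ} (hk : 2 ≤ k) {Y : Finset α}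
    (hY : Y.Nonempty) (hn : sunflowerThreshold k #Y ≤ Fintype.card α) {R : Finset (Finset α)}
    (hR : ∀ A ∈ R, #A = k ∧ Disjoint A Y) {Y' K T : Finset α} (hY' : #Y = #Y')
    (hK : #K + 1 = k) (hYK : Disjoint Y' K) (hYT : Disjoint Y' T) (hKT : Disjoint K T)
    (hRT : #R = #T) :
    intWeight x (hitFam k Y ∪ R) ≤ intWeight x (hitFam k Y' ∪ sunflower K T) := by
  have hd : Disjoint (hitFam k Y) R := disjoint_left.2 fun E h1 h2 =>
    (mem_hitFam.1 h1).2 (hR E h2).2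
  have hd' : Disjoint (hitFam k Y') (sunflower K T) := disjoint_left.2 fun E h1 h2 => by
    obtain ⟨t, ht, rfl⟩ := mem_sunflower.1 h2
    refine (mem_hitFam.1 h1).2 (disjoint_insert_left.2 ⟨?_, hYK.symm⟩)
    exact disjoint_right.1 hYT ht
  -- `φ` matches `R` with the sunflower. As `K` is nonempty, every subfamily of the sunflower is
  -- intersecting, so each trace `S` is compared with its image of the same size.
  obtain ⟨φ, hφ, hinj⟩ := exists_mapsTo_injOn_of_card_le
    (hRT.le.trans (card_sunflower hKT).ge) id
  have hSR : ∀ S ∈ intFamilies R, S ⊆ R := fun S hS => (mem_intFamilies.1 hS).1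
  have hcard : ∀ S ∈ intFamilies R, #(S.image φ) = #S := fun S hS =>
    card_image_of_injOn (hinj.mono (by exact_mod_cast hSR S hS))
  have hsub : ∀ S ∈ intFamilies R, S.image φ ⊆ sunflower K T := fun S hS A hA => by
    obtain ⟨B, hB, rfl⟩ := mem_image.1 hA
    exact hφ B (hSR S hS hB)
  have hne : K.Nonempty := card_pos.1 (by omega)
  have hint : ∀ S ⊆ sunflower K T, S ∈ intFamilies (sunflower K T) := fun S hS =>
    mem_intFamilies.2 ⟨hS, fun A hA B hB => by
      obtain ⟨c, hc⟩ := hne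
      obtain ⟨t, -, rfl⟩ := mem_sunflower.1 (hS hA)
      obtain ⟨t', -, rfl⟩ := mem_sunflower.1 (hS hB)
      exact not_disjoint_iff.2 ⟨c, mem_insert_of_mem hc, mem_insert_of_mem hc⟩⟩
  have hinj' : Set.InjOn (fun S : Finset (Finset α) => S.image φ) (intFamilies R) := by
    intro S hS S' hS' he
    exact image_injOn_powerset_of_injOn hinj (mem_coe.2 (mem_powerset.2 (hSR S hS)))
      (mem_coe.2 (mem_powerset.2 (hSR S' hS'))) he
  rw [intWeight_union hd, intWeight_union hd']
  calc _ ≤ ∑ S ∈ intFamilies R, x ^ #(S.image φ) *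
        intWeight x (crossing (hitFam k Y') (S.image φ)) := by
        refine sum_le_sum fun S hS => ?_
        rw [hcard S hS]
        refine mul_le_mul_of_nonneg_left ?_ (pow_nonneg hx _)
        obtain ⟨T', hT', he⟩ := subset_image_iff.1 (hsub S hS)
        have he' : S.image φ = sunflower K T' := he.symm
        have hKT' := hKT.mono_right hT'
        rw [he']
        refine intWeight_crossing_le hx hk hY hn (fun A hA => hR A (hSR S hS hA)) hY' hK hYK
          (hYT.mono_right hT') hKT' ?_
        rw [← hcard S hS, he', card_sunflower hKT']
    _ = ∑ S ∈ (intFamilies R).image (fun S => S.image φ), x ^ #S *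
        intWeight x (crossing (hitFam k Y') S) :=
        (sum_image (f := fun S => x ^ #S * intWeight x (crossing (hitFam k Y') S)) hinj').symm
    _ ≤ _ := by
        refine sum_le_sum_of_subset_of_nonneg (fun S hS => ?_) fun S _ _ =>
          mul_nonneg (pow_nonneg hx _) (famWeight_nonneg hx _)
        obtain ⟨S', hS', rfl⟩ := mem_image.1 hS
        exact hint _ (hsub S' hS')

end

/-! ### Convexity of the star contribution -/

section Excess

/-- The weight of the subfamilies with at least two members of a family of size `d`. -/
def excess (x : ℝ) (d : ℕ) : ℝ := (1 + x) ^ d - 1 - d * x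

variable {x : ℝ}

theorem excess_zero : excess x 0 = 0 := by simp [excess]

theorem excess_nonneg (hx : 0 ≤ x) (d : ℕ) : 0 ≤ excess x d := by
  have := mul_le_pow_sub_one hx d
  rw [excess]
  linarith

theorem pow_sub_one_nonneg (hx : 0 ≤ x) (d : ℕ) : 0 ≤ (1 + x) ^ d - 1 :=
  (mul_nonneg d.cast_nonneg hx).trans (mul_le_pow_sub_one hx d)

theorem pow_sub_one_mono (hx : 0 ≤ x) {a b : ℕ} (h : a ≤ b) :
    (1 + x) ^ a - 1 ≤ (1 + x) ^ b - 1 :=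
  sub_le_sub_right (pow_le_pow_right₀ (by linarith) h) _

/-- Expansion at `t` along the line of slope `x * ((1 + x) ^ t - 1)`, the forward difference of
`excess` at `t`. Nonnegativity of the last term expresses convexity. -/
theorem excess_add (t b : ℕ) :
    excess x (t + b) = excess x t + b * (x * ((1 + x) ^ t - 1)) + (1 + x) ^ t * excess x b := by
  rw [excess, excess, excess, pow_add]
  push_cast
  ring

theorem excess_mono (hx : 0 ≤ x) {a b : ℕ} (h : a ≤ b) : excess x a ≤ excess x b := by
  obtain ⟨c, rfl⟩ := Nat.exists_eq_add_of_le h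
  have h1 : 0 ≤ (c : ℝ) * (x * ((1 + x) ^ a - 1)) :=
    mul_nonneg c.cast_nonneg (mul_nonneg hx (pow_sub_one_nonneg hx a))
  have h2 : 0 ≤ (1 + x) ^ a * excess x c :=
    mul_nonneg (pow_nonneg (by linarith) _) (excess_nonneg hx c)
  rw [excess_add]
  linarith

theorem pow_sub_one_le (hx : 0 ≤ x) (a : ℕ) : (1 + x) ^ a - 1 ≤ a * x * (1 + x) ^ a := by
  induction a with
  | zero => simp
  | succ a ih =>
    have h1 : (0 : ℝ) ≤ (1 + x) ^ a := pow_nonneg (by linarith) _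
    have h2 : (0 : ℝ) ≤ a * x * (1 + x) ^ a * x := by positivity
    have h3 : (0 : ℝ) ≤ (1 + x) ^ a * x * x := by positivity
    rw [pow_succ]
    push_cast
    nlinarith

theorem excess_le_mul (hx : 0 ≤ x) {d t : ℕ} (h : d ≤ t) :
    excess x d ≤ d * (x * ((1 + x) ^ t - 1)) := by
  have h1 := pow_sub_one_le hx d
  have h2 := pow_sub_one_mono hx h
  have h3 : (d : ℝ) * (x * ((1 + x) ^ d - 1)) ≤ d * (x * ((1 + x) ^ t - 1)) := by gcongr
  rw [excess]
  linarith

theorem excess_le (hx : 0 ≤ x) (d : ℕ) : excess x d ≤ (d : ℝ) ^ 2 * x ^ 2 * (1 + x) ^ d := by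
  refine (excess_le_mul hx le_rfl).trans ?_
  have h1 := pow_sub_one_le hx d
  calc d * (x * ((1 + x) ^ d - 1)) ≤ d * (x * (d * x * (1 + x) ^ d)) := by gcongr
    _ = _ := by ring

/-- Pairs alone contribute `d * (d - 1) / 2 * x ^ 2`, and `d ^ 2 ≤ 2 * d * (d - 1)` once `d ≥ 2`. -/
theorem sq_le_four_mul_excess (hx : 0 ≤ x) {d : ℕ} (hd : 2 ≤ d) :
    (d : ℝ) ^ 2 * x ^ 2 ≤ 4 * excess x d := by
  have h : ∀ d : ℕ, (d : ℝ) * (d - 1) * x ^ 2 ≤ 2 * excess x d := by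
    intro d
    induction d with
    | zero => simp [excess]
    | succ d ih =>
      have h1 := mul_le_mul_of_nonneg_left (mul_le_pow_sub_one hx d) hx
      have h2 : excess x (d + 1) = excess x d + x * ((1 + x) ^ d - 1) := by
        rw [excess_add]
        simp [excess]
      rw [h2]
      push_cast
      nlinarith
  have h2 : (2 : ℝ) ≤ d := by exact_mod_cast hd
  have h3 : (d : ℝ) ^ 2 * x ^ 2 ≤ 2 * ((d : ℝ) * (d - 1) * x ^ 2) := by
    have : (d : ℝ) ^ 2 ≤ 2 * (d * (d - 1)) := by nlinarith
    nlinarith [sq_nonneg x]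
  linarith [h d]

theorem famWeight_two_le_card {β : Type*} [DecidableEq β] (D : Finset β) :
    famWeight x {G ∈ D.powerset | 2 ≤ #G} = excess x #D := by
  have h1 := sum_filter_add_sum_filter_not D.powerset (fun G => 2 ≤ #G) (fun G => x ^ #G)
  have h2 : ∑ G ∈ D.powerset with ¬2 ≤ #G, x ^ #G = 1 + #D * x := by
    have : ({G ∈ D.powerset | ¬2 ≤ #G} : Finset (Finset β)) =
        insert ∅ (D.image fun a => {a}) := by
      ext G
      simp only [mem_filter, mem_powerset, mem_insert, mem_image]
      constructor
      · rintro ⟨h1, h2⟩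
        rcases G.eq_empty_or_nonempty with h | h
        · exact Or.inl h
        · obtain ⟨a, rfl⟩ := card_eq_one.1 (by have := card_pos.2 h; omega : #G = 1)
          exact Or.inr ⟨a, by simpa using h1, rfl⟩
      · rintro (rfl | ⟨a, ha, rfl⟩)
        · simp
        · simpa using ha
    rw [this, sum_insert (by simp), sum_image (by simp)]
    simp
  have h3 := famWeight_powerset x D
  rw [famWeight] at h3
  rw [famWeight, excess]
  linarith

variable {α : Type*} [Fintype α] [DecidableEq α]

/-- A subset of prescribed size on which a function is largest. -/
theorem exists_top (d : α → ℕ) {ℓ : ℕ} (h : ℓ < Fintype.card α) :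
    ∃ H : Finset α, ∃ v ∉ H, #H = ℓ ∧ (∀ a ∈ H, d v ≤ d a) ∧ ∀ a ∉ H, d a ≤ d v := by
  induction ℓ with
  | zero =>
    have : Nonempty α := Fintype.card_pos_iff.1 h
    obtain ⟨v, -, hv⟩ := exists_max_image univ d univ_nonempty
    exact ⟨∅, v, by simp, rfl, by simp, fun a _ => hv a (mem_univ _)⟩
  | succ ℓ ih =>
    obtain ⟨H, v, hv, hH, h1, h2⟩ := ih (by omega)
    have hne : ((insert v H)ᶜ).Nonempty := card_pos.1 (by
      rw [card_compl, card_insert_of_notMem hv]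
      omega)
    obtain ⟨u, hu, hmax⟩ := exists_max_image _ d hne
    have hu' : u ∉ insert v H := mem_compl.1 hu
    refine ⟨insert v H, u, hu', by rw [card_insert_of_notMem hv, hH], fun a ha => ?_,
      fun a ha => hmax a (mem_compl.2 ha)⟩
    have huv := h2 u fun h => hu' (mem_insert_of_mem h)
    rcases mem_insert.1 ha with rfl | ha
    · exact huv
    · exact huv.trans (h1 a ha)

/-- Convexity: a degree sequence with fewer than `ℓ` nearly full members loses a definite amount
against the extremal one. -/
theorem sum_excess_le (hx : 0 ≤ x) (d : α → ℕ) {ℓ N' D r err : ℕ} (hℓ : ℓ < Fintype.card α)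
    (hd : ∀ a, d a ≤ N' + D) (hfew : #{a | N' < d a} < ℓ)
    (hsum : ∑ a, d a ≤ ℓ * (N' + D) + r + err) :
    ∑ a, excess x (d a) ≤ ℓ * excess x (N' + D) + excess x r + x * ((1 + x) ^ N' - 1) * err -
      (1 + x) ^ N' * excess x D := by
  obtain ⟨H, v, hv, hH, h1, h2⟩ := exists_top d hℓ
  -- `H` carries the `ℓ` largest values, `t` is the next one, and some `h₀ ∈ H` has value at most
  -- `N'`. Below, `g` is `excess` minus the linear function with the slope of `excess` at `t`; it is
  -- minimal at `t`, increasing beyond `t` and nonpositive before it.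
  set t := d v with ht
  obtain ⟨h₀, hh₀, hd₀⟩ : ∃ h ∈ H, d h ≤ N' := by
    by_contra! hcon
    have : #H ≤ #{a | N' < d a} := card_le_card fun a ha => mem_filter.2 ⟨mem_univ _, hcon a ha⟩
    omega
  have htN : t ≤ N' := (h1 h₀ hh₀).trans hd₀
  set w : ℝ := x * ((1 + x) ^ t - 1) with hw
  have hw0 : 0 ≤ w := mul_nonneg hx (pow_sub_one_nonneg hx t)
  have hwN : w ≤ x * ((1 + x) ^ N' - 1) := mul_le_mul_of_nonneg_left (pow_sub_one_mono hx htN) hx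
  set g : ℕ → ℝ := fun d => excess x d - d * w with hg
  have hμ : (0 : ℝ) ≤ (1 + x) ^ t := pow_nonneg (by linarith) _
  have hgt : ∀ b, g (t + b) = g t + (1 + x) ^ t * excess x b := by
    intro b
    simp only [hg, excess_add, hw]
    push_cast
    ring
  have hgmono : ∀ a b, t ≤ a → a ≤ b → g a ≤ g b := by
    intro a b ha hb
    obtain ⟨a', rfl⟩ := Nat.exists_eq_add_of_le ha
    obtain ⟨b', rfl⟩ := Nat.exists_eq_add_of_le (ha.trans hb)
    rw [hgt, hgt]
    have := mul_le_mul_of_nonneg_left (excess_mono hx (by omega : a' ≤ b')) hμ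
    linarith
  have hgmin : ∀ a, g t ≤ g a := by
    intro a
    rcases le_total t a with h | h
    · exact hgmono t a le_rfl h
    · obtain ⟨b, hb⟩ := Nat.exists_eq_add_of_le h
      have h4 := pow_sub_one_le hx b
      have h5 : (0 : ℝ) ≤ (1 + x) ^ a := pow_nonneg (by linarith) _
      have h6 := mul_le_mul_of_nonneg_left h4 h5
      simp only [hg, hw, excess, hb, pow_add]
      push_cast
      nlinarith
  have hgneg : ∀ a, a ≤ t → g a ≤ 0 := fun a ha => by
    have := excess_le_mul hx ha
    simp only [hg, hw]
    linarith
  -- The points of `H` other than `h₀` count as full, `h₀` as `N'`, and `v` contributes `g t ≤ g r`,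
  -- which produces the remainder term. All other points contribute nothing positive.
  have hsumg : ∑ a, g (d a) ≤ (ℓ - 1) * g (N' + D) + g N' + g r := by
    have e1 : ∑ a, g (d a) = ∑ a ∈ H, g (d a) + ∑ a ∈ Hᶜ, g (d a) :=
      (sum_add_sum_compl H _).symm
    have e2 : ∑ a ∈ H, g (d a) = g (d h₀) + ∑ a ∈ H.erase h₀, g (d a) :=
      (add_sum_erase _ _ hh₀).symm
    have e3 : ∑ a ∈ Hᶜ, g (d a) = g t + ∑ a ∈ Hᶜ.erase v, g (d a) :=
      (add_sum_erase _ _ (mem_compl.2 hv)).symm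
    have b1 : ∑ a ∈ H.erase h₀, g (d a) ≤ #(H.erase h₀) • g (N' + D) :=
      sum_le_card_nsmul _ _ _ fun a ha => hgmono _ _ (h1 a (mem_of_mem_erase ha)) (hd a)
    have b2 : ∑ a ∈ Hᶜ.erase v, g (d a) ≤ 0 :=
      sum_nonpos fun a ha => hgneg _ (h2 a (mem_compl.1 (mem_of_mem_erase ha)))
    have b3 : g (d h₀) ≤ g N' := hgmono _ _ (h1 _ hh₀) hd₀
    have hcast : ((#(H.erase h₀) : ℕ) : ℝ) = ℓ - 1 := by
      rw [card_erase_of_mem hh₀, hH, Nat.cast_sub (by have := card_pos.2 ⟨h₀, hh₀⟩; omega)]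
      simp
    rw [nsmul_eq_mul, hcast] at b1
    rw [e1, e2, e3]
    linarith [hgmin r]
  have hsplit : ∑ a, excess x (d a) = ((∑ a, d a : ℕ) : ℝ) * w + ∑ a, g (d a) := by
    simp only [hg, sum_sub_distrib]
    push_cast
    rw [sum_mul]
    ring
  have hsum' : ((∑ a, d a : ℕ) : ℝ) * w ≤ (ℓ * (N' + D) + r + err) * w := by
    gcongr
    exact_mod_cast hsum
  -- The definite loss from `h₀` not being nearly full.
  have hkey : g N' + (1 + x) ^ N' * excess x D ≤ g (N' + D) := by
    simp only [hg, excess_add]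
    have : (D : ℝ) * w ≤ D * (x * ((1 + x) ^ N' - 1)) := by gcongr
    push_cast
    linarith
  have herr : w * err ≤ x * ((1 + x) ^ N' - 1) * err := by gcongr
  rw [hsplit]
  have hgN : g (N' + D) = excess x (N' + D) - (N' + D) * w := by simp only [hg]; push_cast; ring
  have hgr : g r = excess x r - r * w := rfl
  rw [hgr] at hsumg
  have hfin : (ℓ : ℝ) * g (N' + D) = ℓ * excess x (N' + D) - ℓ * (N' + D) * w := by
    rw [hgN]
    ring
  nlinarith

end Excess

/-! ### Certificates with one member from a small pool -/

section Certificates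

theorem sum_pow_card_nonempty_le {β : Type*} [DecidableEq β] {x : ℝ} (hx : 0 ≤ x) (X : Finset β)
    (s : ℕ) :
    ∑ S ∈ X.powerset with #S ≤ s + 1 ∧ S.Nonempty, x ^ #S ≤
      #X * x * ∑ j ∈ range (s + 1), (#X * x) ^ j := by
  have h1 := sum_pow_card_le hx X (s + 1)
  rw [sum_range_succ' _ (s + 1), pow_zero] at h1
  have h2 : ({S ∈ X.powerset | #S ≤ s + 1} : Finset (Finset β)) =
      insert ∅ ({S ∈ X.powerset | #S ≤ s + 1 ∧ S.Nonempty} : Finset (Finset β)) := by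
    ext S
    simp only [mem_filter, mem_powerset, mem_insert]
    constructor
    · rintro ⟨h1, h2⟩
      rcases S.eq_empty_or_nonempty with h | h
      · exact Or.inl h
      · exact Or.inr ⟨h1, h2, h⟩
    · rintro (rfl | ⟨h1, h2, -⟩)
      · simp
      · exact ⟨h1, h2⟩
  rw [h2, sum_insert (by simp), card_empty, pow_zero] at h1
  rw [mul_sum]
  have h3 : ∑ j ∈ range (s + 1), (#X * x) ^ (j + 1) =
      ∑ j ∈ range (s + 1), #X * x * (#X * x) ^ j := sum_congr rfl fun j _ => pow_succ' _ _
  linarith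

/-- A certificate bound where one member of the certificate is taken from a small pool determined
by the others. -/
theorem famWeight_le_of_pool_cert {β : Type*} [DecidableEq β] {x : ℝ} (hx : 0 ≤ x)
    {𝒢 : Finset (Finset β)} (X : Finset β) (s p : ℕ) (pool : Finset β → Finset β)
    (hpool : ∀ S ⊆ X, #S ≤ s + 2 → #(pool S) ≤ p) (hpoolX : ∀ S, pool S ⊆ X)
    (h : ∀ G ∈ 𝒢, ∃ S ⊆ X, S.Nonempty ∧ #S ≤ s + 1 ∧ ∃ E ∈ pool S, E ∉ S ∧ insert E S ⊆ G ∧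
      G ⊆ pool (insert E S)) :
    famWeight x 𝒢 ≤ p * x * (1 + x) ^ p * (#X * x * ∑ j ∈ range (s + 1), (#X * x) ^ j) := by
  have h1 : (1 : ℝ) ≤ 1 + x := by linarith
  set T : Finset (Finset β) := {S ∈ X.powerset | #S ≤ s + 1 ∧ S.Nonempty} with hT
  have hcert := famWeight_le_of_cert hx (𝒢 := 𝒢) (T.sigma fun S => pool S \ S)
    (fun i => insert i.2 i.1) (fun i => pool (insert i.2 i.1)) (by
      intro G hG
      obtain ⟨S, hS, hSn, hs, E, hE, hES, h2, h3⟩ := h G hG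
      exact ⟨⟨S, E⟩, mem_sigma.2 ⟨mem_filter.2 ⟨mem_powerset.2 hS, hs, hSn⟩,
        mem_sdiff.2 ⟨hE, hES⟩⟩, h2, h3.trans subset_union_right⟩)
  refine hcert.trans ?_
  rw [sum_sigma]
  calc _ ≤ ∑ S ∈ T, ∑ E ∈ pool S \ S, x * x ^ #S * (1 + x) ^ p := by
        refine sum_le_sum fun S hS => sum_le_sum fun E hE => ?_
        obtain ⟨hSX, hs, hSn⟩ := mem_filter.1 hS
        rw [mem_powerset] at hSX
        obtain ⟨hE1, hE2⟩ := mem_sdiff.1 hE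
        have := pow_le_pow_right₀ h1 (hpool (insert E S) (insert_subset (hpoolX S hE1) hSX)
          (by rw [card_insert_of_notMem hE2]; omega))
        dsimp only
        rw [card_insert_of_notMem hE2, pow_succ']
        gcongr
    _ ≤ ∑ S ∈ T, p * (x * x ^ #S * (1 + x) ^ p) := by
        refine sum_le_sum fun S hS => ?_
        obtain ⟨hSX, hs, hSn⟩ := mem_filter.1 hS
        rw [mem_powerset] at hSX
        rw [sum_const, nsmul_eq_mul]
        have : (#(pool S \ S) : ℝ) ≤ p := by
          exact_mod_cast (card_le_card sdiff_subset).trans (hpool S hSX (by omega))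
        gcongr
    _ = p * x * (1 + x) ^ p * ∑ S ∈ T, x ^ #S := by
        rw [mul_sum]
        exact sum_congr rfl fun S _ => by ring
    _ ≤ _ := by
        refine mul_le_mul_of_nonneg_left (sum_pow_card_nonempty_le hx X s) (by positivity)

end Certificates

/-! ### Upper bound: intersecting families are mostly stars -/

section Upper

variable {α : Type*} [Fintype α] [DecidableEq α]

/-- The members of a family through a point. -/
def starFam (F : Finset (Finset α)) (a : α) : Finset (Finset α) := {E ∈ F | a ∈ E}

omit [Fintype α] in
theorem mem_starFam {F : Finset (Finset α)} {a : α} {E : Finset α} :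
    E ∈ starFam F a ↔ E ∈ F ∧ a ∈ E := mem_filter

omit [Fintype α] in
theorem starFam_subset (F : Finset (Finset α)) (a : α) : starFam F a ⊆ F := filter_subset _ _

theorem card_starFam_le {F : Finset (Finset α)} {k : ℕ} (hF : ∀ E ∈ F, #E = k) (a : α) :
    #(starFam F a) ≤ supCard (Fintype.card α) k 1 := by
  rw [← card_singleton a, ← card_filter_superset]
  refine card_le_card fun E hE => ?_
  rw [mem_starFam] at hE
  exact mem_filter.2 ⟨mem_powersetCard_univ.2 (hF E hE.1), singleton_subset_iff.2 hE.2⟩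

omit [Fintype α] in
theorem sum_card_starFam (F : Finset (Finset α)) (B : Finset α) :
    ∑ a ∈ B, #(starFam F a) = ∑ E ∈ F, #(E ∩ B) := by
  simp only [starFam, card_filter]
  rw [sum_comm]
  refine sum_congr rfl fun E _ => ?_
  rw [← card_filter]
  congr 1
  ext a
  simp [and_comm]

/-- Only sets with two points in `B` are counted more than once, and none more than `k` times. -/
theorem sum_card_starFam_le {F : Finset (Finset α)} {k : ℕ} (hF : ∀ E ∈ F, #E = k) (B : Finset α) :
    ∑ a ∈ B, #(starFam F a) ≤ #F + k * (#B ^ 2 * supCard (Fintype.card α) k 2) := by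
  rw [sum_card_starFam]
  calc ∑ E ∈ F, #(E ∩ B) ≤ ∑ E ∈ F, (1 + if 2 ≤ #(E ∩ B) then k else 0) := by
        refine sum_le_sum fun E hE => ?_
        have := (card_le_card (inter_subset_left : E ∩ B ⊆ E)).trans (hF E hE).le
        split_ifs <;> omega
    _ = #F + k * #{E ∈ F | 2 ≤ #(E ∩ B)} := by
        rw [sum_add_distrib, ← sum_filter, sum_const, sum_const, smul_eq_mul, smul_eq_mul, mul_one,
          mul_comm k]
    _ ≤ _ := by
        refine Nat.add_le_add_left (Nat.mul_le_mul_left _ ((card_le_card fun E hE => ?_).trans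
          (card_filter_le_card_inter k 2 B))) _
        obtain ⟨h1, h2⟩ := mem_filter.1 hE
        exact mem_filter.2 ⟨mem_powersetCard_univ.2 (hF E h1), h2⟩

/-- The members of `F` which have two points in `B` or meet a member of `S` outside `B`. -/
def spread (F : Finset (Finset α)) (B : Finset α) (S : Finset (Finset α)) : Finset (Finset α) :=
  {E ∈ F | 2 ≤ #(E ∩ B) ∨ ¬Disjoint E (S.sup id \ B)}

/-- The members of `S` cover at most `#S * k` points, and those outside `B` have degree at most `q`.
-/
theorem card_spread_le {F : Finset (Finset α)} {k : ℕ} (hF : ∀ E ∈ F, #E = k) {B : Finset α}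
    {q : ℕ} (hB : ∀ a ∉ B, #(starFam F a) ≤ q) {S : Finset (Finset α)} (hS : S ⊆ F) :
    #(spread F B S) ≤ #B ^ 2 * supCard (Fintype.card α) k 2 + #S * k * q := by
  calc #(spread F B S) ≤ #(({E ∈ powersetCard k (univ : Finset α) | 2 ≤ #(E ∩ B)}) ∪
        (S.sup id \ B).biUnion fun a => starFam F a) := by
        refine card_le_card fun E hE => ?_
        obtain ⟨h1, h2 | h2⟩ := mem_filter.1 hE
        · exact mem_union_left _ (mem_filter.2 ⟨mem_powersetCard_univ.2 (hF E h1), h2⟩)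
        · obtain ⟨a, haE, ha⟩ := not_disjoint_iff.1 h2
          exact mem_union_right _ (mem_biUnion.2 ⟨a, ha, mem_starFam.2 ⟨h1, haE⟩⟩)
    _ ≤ _ := by
        refine (card_union_le _ _).trans (Nat.add_le_add (card_filter_le_card_inter k 2 B) ?_)
        refine card_biUnion_le.trans ((sum_le_card_nsmul _ _ q fun a ha =>
          hB a (mem_sdiff.1 ha).2).trans ?_)
        rw [smul_eq_mul]
        refine Nat.mul_le_mul_right _ ((card_le_card sdiff_subset).trans ?_)
        rw [sup_eq_biUnion]
        refine card_biUnion_le.trans ((sum_le_card_nsmul _ _ k fun E hE => ?_).trans ?_)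
        · exact (hF E (hS hE)).le
        · rw [smul_eq_mul]

omit [Fintype α] in
/-- A set meeting all members of a family without common point in `B` is spread. -/
theorem mem_spread_of_crossing {F : Finset (Finset α)} {B : Finset α} {S : Finset (Finset α)}
    (hS : S.Nonempty) {E : Finset α} (hE : E ∈ F) (hcross : ∀ A ∈ S, ¬Disjoint E A)
    (hB : ∀ b ∈ B, b ∈ E → ∃ A ∈ S, b ∉ A) : E ∈ spread F B S := by
  refine mem_filter.2 ⟨hE, ?_⟩
  by_cases h2 : 2 ≤ #(E ∩ B)
  · exact Or.inl h2
  refine Or.inr ?_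
  obtain ⟨A, hA, hAB⟩ : ∃ A ∈ S, ∀ b ∈ E ∩ B, b ∉ A := by
    rcases (E ∩ B).eq_empty_or_nonempty with h | h
    · obtain ⟨A, hA⟩ := hS
      exact ⟨A, hA, by simp [h]⟩
    · obtain ⟨b, hb⟩ := card_eq_one.1 (by have := card_pos.2 h; omega : #(E ∩ B) = 1)
      have hb' : b ∈ E ∩ B := by rw [hb]; exact mem_singleton_self b
      obtain ⟨A, hA, hbA⟩ := hB b (mem_inter.1 hb').2 (mem_inter.1 hb').1
      refine ⟨A, hA, fun b' hb'' => ?_⟩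
      rw [hb, mem_singleton] at hb''
      rwa [hb'']
  obtain ⟨a, haE, haA⟩ := not_disjoint_iff.1 (hcross A hA)
  refine not_disjoint_iff.2 ⟨a, haE, mem_sdiff.2 ⟨le_sup (f := id) hA haA, fun haB => ?_⟩⟩
  exact hAB a (mem_inter.2 ⟨haE, haB⟩) haA

omit [Fintype α] in
/-- Every intersecting family without common point in `B` is generated by few spread sets. -/
theorem exists_spread_cert {F G : Finset (Finset α)} {k : ℕ} (hF : ∀ E ∈ F, #E = k)
    {B : Finset α} (hGF : G ⊆ F) (hG : (G : Set (Finset α)).Intersecting) (hG2 : 2 ≤ #G)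
    (hGB : ∀ b ∈ B, ∃ E ∈ G, b ∉ E) :
    ∃ S ⊆ F, S.Nonempty ∧ #S ≤ k + 1 ∧ ∃ E ∈ spread F B S, E ∉ S ∧ insert E S ⊆ G ∧
      G ⊆ spread F B (insert E S) := by
  obtain ⟨E₀, hE₀⟩ : G.Nonempty := card_pos.1 (by omega)
  choose! f hfG hf using hGB
  -- `E₀` together with, for each of its points in `B`, a member avoiding that point: at most `k +
  -- 1` sets with no common point in `B`.
  set S₀ : Finset (Finset α) := insert E₀ ((E₀ ∩ B).image f) with hS₀
  have hS₀G : S₀ ⊆ G := insert_subset hE₀ fun A hA => by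
    obtain ⟨b, hb, rfl⟩ := mem_image.1 hA
    exact hfG b (mem_inter.1 hb).2
  have hS₀B : ∀ b ∈ B, ∃ A ∈ S₀, b ∉ A := by
    intro b hb
    by_cases hbE : b ∈ E₀
    · exact ⟨f b, mem_insert_of_mem (mem_image_of_mem _ (mem_inter.2 ⟨hbE, hb⟩)), hf b hb⟩
    · exact ⟨E₀, mem_insert_self _ _, hbE⟩
  have hS₀c : #S₀ ≤ k + 1 := by
    refine (card_insert_le _ _).trans (Nat.add_le_add_right (card_image_le.trans ?_) 1)
    exact (card_le_card inter_subset_left).trans (hF _ (hGF hE₀)).le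
  have hcross : ∀ E ∈ G, ∀ A ∈ G, ¬Disjoint E A := fun E hE A hA =>
    hG (mem_coe.2 hE) (mem_coe.2 hA)
  have hspread : ∀ S, S₀ ⊆ S → S ⊆ G → G ⊆ spread F B S := fun S h1 h2 E hE =>
    mem_spread_of_crossing ⟨E₀, h1 (mem_insert_self _ _)⟩ (hGF hE)
      (fun A hA => hcross E hE A (h2 hA)) fun b hb _ => by
        obtain ⟨A, hA, hbA⟩ := hS₀B b hb
        exact ⟨A, h1 hA, hbA⟩
  -- The set to be drawn from the pool must be spread with respect to the others. If `S₀` is just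
  -- `E₀`, any further member will do; otherwise `E₀` itself does, since the other sets of `S₀`
  -- avoid its points in `B` one by one.
  by_cases h1 : #S₀ = 1
  · obtain ⟨E, hE, hES⟩ : ∃ E ∈ G, E ∉ S₀ := by
      by_contra! h
      have := card_le_card h
      omega
    refine ⟨S₀, hS₀G.trans hGF, ⟨E₀, mem_insert_self _ _⟩, hS₀c, E, hspread _ le_rfl hS₀G hE, hES,
      insert_subset hE hS₀G, hspread _ (subset_insert _ _) (insert_subset hE hS₀G)⟩
  · have hE₀S : E₀ ∈ S₀ := mem_insert_self _ _
    have hins : insert E₀ (S₀.erase E₀) = S₀ := insert_erase hE₀S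
    have hne : (S₀.erase E₀).Nonempty := card_pos.1 (by
      have := card_pos.2 ⟨E₀, hE₀S⟩
      rw [card_erase_of_mem hE₀S]
      omega)
    refine ⟨S₀.erase E₀, (erase_subset _ _).trans (hS₀G.trans hGF), hne,
      (card_le_card (erase_subset _ _)).trans hS₀c, E₀, ?_, notMem_erase _ _, ?_, ?_⟩
    · refine mem_spread_of_crossing hne (hGF hE₀)
        (fun A hA => hcross _ hE₀ _ (hS₀G (mem_of_mem_erase hA))) fun b hb hbE => ?_
      obtain ⟨A, hA, hbA⟩ := hS₀B b hb
      exact ⟨A, mem_erase.2 ⟨fun h => hbA (h ▸ hbE), hA⟩, hbA⟩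
    · rw [hins]
      exact hS₀G
    · rw [hins]
      exact hspread _ le_rfl hS₀G

theorem famWeight_card_lt_two {x : ℝ} {β : Type*} [DecidableEq β] (D : Finset β) :
    famWeight x {G ∈ D.powerset | ¬2 ≤ #G} = 1 + #D * x := by
  have h1 := sum_filter_add_sum_filter_not D.powerset (fun G => 2 ≤ #G) (fun G => x ^ #G)
  have h2 := famWeight_two_le_card (x := x) D
  have h3 := famWeight_powerset x D
  simp only [famWeight, excess] at *
  linarith

open scoped Classical in
/-- Intersecting families are mostly stars. -/
theorem intWeight_le_sum_excess {x : ℝ} (hx : 0 ≤ x) {F : Finset (Finset α)} {k : ℕ}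
    (hF : ∀ E ∈ F, #E = k) {B : Finset α} {q : ℕ}
    (hB : ∀ a ∉ B, #(starFam F a) ≤ q) {p : ℕ}
    (hp : #B ^ 2 * supCard (Fintype.card α) k 2 + (k + 2) * k * q ≤ p) :
    intWeight x F ≤ 1 + #F * x + ∑ a, excess x (if a ∈ B then #(starFam F a) else 0) +
      p * x * (1 + x) ^ p * (#F * x * ∑ j ∈ range (k + 1), (#F * x) ^ j) := by
  -- Intersecting families have at most one member, or a common point in `B`, or belong to `NS`. The
  -- certificate bound makes `NS` cost about `p * #F * x ^ 2`, with `p` small compared with the size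
  -- of a star.
  set NS : Finset (Finset (Finset α)) :=
    {G ∈ intFamilies F | 2 ≤ #G ∧ ∀ b ∈ B, ∃ E ∈ G, b ∉ E} with hNS
  have hsub : intFamilies F ⊆ {G ∈ F.powerset | ¬2 ≤ #G} ∪
      (B.biUnion fun b => {G ∈ (starFam F b).powerset | 2 ≤ #G}) ∪ NS := by
    intro G hG
    obtain ⟨hGF, -⟩ := mem_intFamilies.1 hG
    by_cases h2 : 2 ≤ #G
    · by_cases h3 : ∀ b ∈ B, ∃ E ∈ G, b ∉ E
      · exact mem_union_right _ (mem_filter.2 ⟨hG, h2, h3⟩)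
      · push Not at h3
        obtain ⟨b, hb, h3⟩ := h3
        refine mem_union_left _ (mem_union_right _ (mem_biUnion.2 ⟨b, hb, mem_filter.2
          ⟨mem_powerset.2 fun E hE => mem_starFam.2 ⟨hGF hE, h3 E hE⟩, h2⟩⟩))
    · exact mem_union_left _ (mem_union_left _ (mem_filter.2 ⟨mem_powerset.2 hGF, h2⟩))
  have hNSw := famWeight_le_of_pool_cert hx (𝒢 := NS) F k p (spread F B)
    (fun S hS hs => (card_spread_le hF hB hS).trans (le_trans (by gcongr) hp))
    (fun S => filter_subset _ _)
    (fun G hG => by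
      obtain ⟨h1, h2, h3⟩ := mem_filter.1 hG
      exact exists_spread_cert hF (mem_intFamilies.1 h1).1 (mem_intFamilies.1 h1).2 h2 h3)
  have hstars : famWeight x (B.biUnion fun b => {G ∈ (starFam F b).powerset | 2 ≤ #G}) ≤
      ∑ a, excess x (if a ∈ B then #(starFam F a) else 0) := by
    refine (famWeight_biUnion_le hx _ _).trans (le_of_eq ?_)
    rw [← sum_subset (subset_univ B) fun a _ ha => by rw [if_neg ha, excess_zero]]
    exact sum_congr rfl fun a ha => by rw [if_pos ha, famWeight_two_le_card]
  calc intWeight x F ≤ _ := famWeight_mono hx hsub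
    _ ≤ _ := famWeight_union_le hx _ _
    _ ≤ _ := add_le_add (famWeight_union_le hx _ _) le_rfl
    _ ≤ _ := by
        rw [famWeight_card_lt_two]
        linarith

end Upper

/-! ### Lower bound for the extremal family -/

section Lower

/-- Bonferroni's inequality, with the number of pairs bounded by `#s ^ 2`. -/
theorem sum_famWeight_le_biUnion {β ι : Type*} [DecidableEq β] [DecidableEq ι] {x : ℝ} (hx : 0 ≤ x)
    (s : Finset ι) (A : ι → Finset (Finset β)) {c : ℝ} (hc : 0 ≤ c)
    (h : ∀ i ∈ s, ∀ j ∈ s, i ≠ j → famWeight x (A i ∩ A j) ≤ c) :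
    ∑ i ∈ s, famWeight x (A i) ≤ famWeight x (s.biUnion A) + (#s : ℝ) ^ 2 * c := by
  induction s using Finset.induction_on with
  | empty => simp [famWeight]
  | insert a s ha ih =>
    have ih' := ih fun i hi j hj => h i (mem_insert_of_mem hi) j (mem_insert_of_mem hj)
    have h1 : famWeight x (A a ∪ s.biUnion A) + famWeight x (A a ∩ s.biUnion A) =
        famWeight x (A a) + famWeight x (s.biUnion A) := by
      simp only [famWeight]
      exact sum_union_inter
    have h2 : famWeight x (A a ∩ s.biUnion A) ≤ #s * c := by
      rw [inter_biUnion, ← nsmul_eq_mul]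
      refine (famWeight_biUnion_le hx _ _).trans (sum_le_card_nsmul _ _ _ fun j hj => ?_)
      exact h a (mem_insert_self _ _) j (mem_insert_of_mem hj) fun e => ha (e ▸ hj)
    rw [sum_insert ha, biUnion_insert, card_insert_of_notMem ha]
    push_cast
    have h3 : (0 : ℝ) ≤ #s * c := by positivity
    nlinarith

variable {α : Type*} [Fintype α] [DecidableEq α]

/-- Only three kinds of families are counted: those with at most one member, those inside a star at
a point of `Y`, and those inside `R`. Two stars overlap in the sets through both centres, which
gives the correction. A single set is an intersecting family because `k ≥ 1`. -/
theorem le_intWeight_hitFam_union {x : ℝ} (hx : 0 ≤ x) {k : ℕ} (hk : 1 ≤ k) {Y : Finset α}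
    {R : Finset (Finset α)} (hd : Disjoint (hitFam k Y) R)
    (hR : (R : Set (Finset α)).Intersecting) (hRk : ∀ E ∈ R, #E = k) :
    1 + #(hitFam k Y ∪ R) * x + #Y * excess x (supCard (Fintype.card α) k 1) + excess x #R ≤
      intWeight x (hitFam k Y ∪ R) + (#Y : ℝ) ^ 2 * excess x (supCard (Fintype.card α) k 2) := by
  set S : α → Finset (Finset α) := fun y => {E ∈ powersetCard k (univ : Finset α) | {y} ⊆ E} with hS
  set A : α → Finset (Finset (Finset α)) := fun y => {G ∈ (S y).powerset | 2 ≤ #G} with hA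
  have hSc : ∀ y, #(S y) = supCard (Fintype.card α) k 1 := fun y => by
    simp only [hS]
    rw [card_filter_superset, card_singleton]
  have hpairs : ∀ i ∈ Y, ∀ j ∈ Y, i ≠ j →
      famWeight x (A i ∩ A j) ≤ excess x (supCard (Fintype.card α) k 2) := by
    intro i _ j _ hij
    have h1 : A i ∩ A j = {G ∈ (S i ∩ S j).powerset | 2 ≤ #G} := by
      ext G
      simp only [hA, mem_inter, mem_filter, mem_powerset, subset_inter_iff]
      tauto
    have h2 : S i ∩ S j = {E ∈ powersetCard k (univ : Finset α) | {i, j} ⊆ E} := by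
      ext E
      simp only [hS, mem_inter, mem_filter, insert_subset_iff, singleton_subset_iff]
      tauto
    rw [h1, famWeight_two_le_card, h2, card_filter_superset, card_pair hij]
  have hsum := sum_famWeight_le_biUnion hx Y A (excess_nonneg hx _) hpairs
  have hsum' : ∑ y ∈ Y, famWeight x (A y) = #Y * excess x (supCard (Fintype.card α) k 1) := by
    rw [← nsmul_eq_mul, ← sum_const]
    exact sum_congr rfl fun y _ => by simp only [hA]; rw [famWeight_two_le_card, hSc]
  have hSsub : ∀ y ∈ Y, S y ⊆ hitFam k Y := fun y hy E hE => by
    obtain ⟨h1, h2⟩ := mem_filter.1 hE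
    exact mem_hitFam.2 ⟨mem_powersetCard_univ.1 h1,
      not_disjoint_iff.2 ⟨y, singleton_subset_iff.1 h2, hy⟩⟩
  set P₀ : Finset (Finset (Finset α)) := {G ∈ (hitFam k Y ∪ R).powerset | ¬2 ≤ #G} with hP₀
  set P₁ := Y.biUnion A with hP₁
  set P₂ : Finset (Finset (Finset α)) := {G ∈ R.powerset | 2 ≤ #G} with hP₂
  have hP₁' : ∀ G ∈ P₁, G ⊆ hitFam k Y ∧ 2 ≤ #G := fun G hG => by
    obtain ⟨y, hy, hG⟩ := mem_biUnion.1 hG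
    obtain ⟨h1, h2⟩ := mem_filter.1 hG
    exact ⟨(mem_powerset.1 h1).trans (hSsub y hy), h2⟩
  have hd1 : Disjoint P₀ P₁ := disjoint_left.2 fun G h1 h2 =>
    (mem_filter.1 h1).2 (hP₁' G h2).2
  have hd2 : Disjoint (P₀ ∪ P₁) P₂ := disjoint_left.2 fun G h1 h2 => by
    obtain ⟨h3, h4⟩ := mem_filter.1 h2
    rcases mem_union.1 h1 with h | h
    · exact (mem_filter.1 h).2 h4
    · obtain ⟨E, hE⟩ : G.Nonempty := card_pos.1 (by omega)
      exact disjoint_left.1 hd ((hP₁' G h).1 hE) (mem_powerset.1 h3 hE)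
  have hsub : P₀ ∪ P₁ ∪ P₂ ⊆ intFamilies (hitFam k Y ∪ R) := by
    intro G hG
    rcases mem_union.1 hG with hG | hG
    · rcases mem_union.1 hG with hG | hG
      · obtain ⟨h1, h2⟩ := mem_filter.1 hG
        rw [mem_powerset] at h1
        refine mem_intFamilies.2 ⟨h1, fun E hE E' hE' => ?_⟩
        have hEE : E = E' := card_le_one.1 (by omega : #G ≤ 1) E hE E' hE'
        have hEk : #E = k := by
          rcases mem_union.1 (h1 (mem_coe.1 hE)) with h | h
          · exact (mem_hitFam.1 h).1
          · exact hRk E h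
        rw [← hEE, disjoint_self_iff_empty]
        rintro rfl
        simp at hEk
        omega
      · obtain ⟨y, hy, hG⟩ := mem_biUnion.1 hG
        have h1 := mem_powerset.1 (mem_filter.1 hG).1
        refine mem_intFamilies.2 ⟨(h1.trans (hSsub y hy)).trans subset_union_left,
          fun E hE E' hE' => not_disjoint_iff.2 ⟨y, ?_, ?_⟩⟩
        · exact singleton_subset_iff.1 (mem_filter.1 (h1 hE)).2
        · exact singleton_subset_iff.1 (mem_filter.1 (h1 hE')).2
    · have h1 := mem_powerset.1 (mem_filter.1 hG).1
      exact mem_intFamilies.2 ⟨h1.trans subset_union_right, hR.mono (by exact_mod_cast h1)⟩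
  have htot : famWeight x (P₀ ∪ P₁ ∪ P₂) =
      famWeight x P₀ + famWeight x P₁ + famWeight x P₂ := by
    simp only [famWeight]
    rw [sum_union hd2, sum_union hd1]
  have hle := famWeight_mono hx hsub
  rw [htot, hP₀, famWeight_card_lt_two, hP₂, famWeight_two_le_card] at hle
  rw [intWeight]
  linarith

end Lower

/-! ### Stability: few nearly full stars are not optimal -/

section Stability

/-- Everything is measured in units of `x ^ 2 * (1 + x) ^ N'`. The gain is at least `D ^ 2 / 4`,
hence at least `N ^ 2 / (16 * q ^ 2)`, and each of the three errors is at most a third of that; this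
is the origin of `48`. -/
theorem error_le_excess {x : ℝ} (hx : 0 ≤ x) {N N2 N' D q k ℓ m p s c err : ℕ} (hq : 0 < q)
    (hD : N ≤ 2 * q * D) (hD2 : 2 ≤ D) (hN' : N' ≤ N) (hm : m ≤ c * s) (hc : 1 ≤ c)
    (hps : p + s * k ≤ N') (h1 : 48 * q ^ 2 * err ≤ N) (h2 : 48 * q ^ 2 * ℓ ^ 2 * N2 ≤ N)
    (h22 : N2 ≤ N') (h3 : 48 * q ^ 2 * (p * m * ((k + 1) * c ^ k)) ≤ N ^ 2) :
    x * ((1 + x) ^ N' - 1) * err + (ℓ : ℝ) ^ 2 * excess x N2 +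
      p * x * (1 + x) ^ p * (m * x * ∑ j ∈ range (k + 1), (m * x) ^ j) ≤
      (1 + x) ^ N' * excess x D := by
  have hμ : (1 : ℝ) ≤ 1 + x := by linarith
  set Z : ℝ := x ^ 2 * (1 + x) ^ N' with hZ
  have hZ0 : 0 ≤ Z := by positivity
  have e1 : x * ((1 + x) ^ N' - 1) * err ≤ (N * err : ℕ) * Z := by
    have := pow_sub_one_le hx N'
    have hN'' : (N' : ℝ) ≤ N := by exact_mod_cast hN'
    calc x * ((1 + x) ^ N' - 1) * err ≤ x * (N' * x * (1 + x) ^ N') * err := by gcongr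
      _ = N' * err * Z := by rw [hZ]; ring
      _ ≤ _ := by push_cast; gcongr
  have e2 : (ℓ : ℝ) ^ 2 * excess x N2 ≤ (ℓ ^ 2 * N2 * N2 : ℕ) * Z := by
    calc (ℓ : ℝ) ^ 2 * excess x N2 ≤ (ℓ : ℝ) ^ 2 * ((N2 : ℝ) ^ 2 * x ^ 2 * (1 + x) ^ N2) := by
          gcongr
          exact excess_le hx N2
      _ ≤ (ℓ : ℝ) ^ 2 * ((N2 : ℝ) ^ 2 * x ^ 2 * (1 + x) ^ N') := by gcongr
      _ = _ := by push_cast; rw [hZ]; ring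
  have e3 : p * x * (1 + x) ^ p * (m * x * ∑ j ∈ range (k + 1), (m * x) ^ j) ≤
      (p * m * ((k + 1) * c ^ k) : ℕ) * Z := by
    calc p * x * (1 + x) ^ p * (m * x * ∑ j ∈ range (k + 1), (m * x) ^ j)
        ≤ p * x * (1 + x) ^ p * (m * x * ((k + 1) * c ^ k * (1 + x) ^ (s * k))) := by
          gcongr
          exact sum_pow_le_pow hx hm hc k
      _ = (p * m * ((k + 1) * c ^ k) : ℕ) * (x ^ 2 * (1 + x) ^ (p + s * k)) := by
          push_cast
          ring
      _ ≤ _ := by rw [hZ]; gcongr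
  have c1 : 48 * q ^ 2 * (N * err) ≤ N ^ 2 := by nlinarith
  have c2 : 48 * q ^ 2 * (ℓ ^ 2 * N2 * N2) ≤ N ^ 2 := by
    have : N2 ≤ N := h22.trans hN'
    calc _ = (48 * q ^ 2 * ℓ ^ 2 * N2) * N2 := by ring
      _ ≤ N * N := Nat.mul_le_mul h2 this
      _ = _ := by ring
  have c1' : 48 * (q : ℝ) ^ 2 * (N * err : ℕ) ≤ N ^ 2 := by exact_mod_cast c1
  have c2' : 48 * (q : ℝ) ^ 2 * (ℓ ^ 2 * N2 * N2 : ℕ) ≤ N ^ 2 := by exact_mod_cast c2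
  have c3' : 48 * (q : ℝ) ^ 2 * (p * m * ((k + 1) * c ^ k) : ℕ) ≤ N ^ 2 := by exact_mod_cast h3
  have hmain : (N : ℝ) ^ 2 * Z ≤ 16 * (q : ℝ) ^ 2 * ((1 + x) ^ N' * excess x D) := by
    have hD' : (N : ℝ) ≤ 2 * q * D := by exact_mod_cast hD
    calc (N : ℝ) ^ 2 * Z ≤ (2 * q * D) ^ 2 * Z := by gcongr
      _ = 4 * (q : ℝ) ^ 2 * (1 + x) ^ N' * ((D : ℝ) ^ 2 * x ^ 2) := by rw [hZ]; ring
      _ ≤ 4 * (q : ℝ) ^ 2 * (1 + x) ^ N' * (4 * excess x D) := by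
          refine mul_le_mul_of_nonneg_left ?_ (by positivity)
          exact sq_le_four_mul_excess hx hD2
      _ = _ := by ring
  have hq' : (0 : ℝ) < 48 * (q : ℝ) ^ 2 := by positivity
  refine le_of_mul_le_mul_left ?_ hq'
  have f1 := mul_le_mul_of_nonneg_left e1 hq'.le
  have f2 := mul_le_mul_of_nonneg_left e2 hq'.le
  have f3 := mul_le_mul_of_nonneg_left e3 hq'.le
  have g1 := mul_le_mul_of_nonneg_right c1' hZ0
  have g2 := mul_le_mul_of_nonneg_right c2' hZ0
  have g3 := mul_le_mul_of_nonneg_right c3' hZ0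
  rw [← mul_assoc] at f1 f2 f3
  linarith

/-- Auxiliary constants for the stability estimate. -/
def stabilityRatio (k ℓ q : ℕ) : ℕ :=
  48 * q ^ 2 * ((ℓ + 1) * ((k + 1) * (8 * k * (ℓ + 1)) ^ k))

/-- The reciprocal of the relative degree below which points are negligible. -/
def stabilityDegree (k ℓ q : ℕ) : ℕ := 2 * stabilityRatio k ℓ q * (k * (k + 2))

/-- A bound for the number of points of non-negligible degree. -/
def stabilityCard (k ℓ q : ℕ) : ℕ := stabilityDegree k ℓ q * (k * (ℓ + 1))

/-- A bound beyond which families with fewer than `ℓ` nearly full stars are not optimal. -/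
def stabilityThreshold (k ℓ q : ℕ) : ℕ :=
  (2 * stabilityRatio k ℓ q * stabilityCard k ℓ q ^ 2 +
    48 * q ^ 2 * (k * stabilityCard k ℓ q ^ 2) + 48 * q ^ 2 * ℓ ^ 2 + 2) * k +
    4 * k * k + 2 * q * k + ℓ + k + 2

variable {α : Type*} [Fintype α] [DecidableEq α]

/-- A family with fewer than `ℓ` nearly full stars is dominated by `hitFam k Y ∪ R` for
intersecting `R`. -/
theorem intWeight_le_of_few_full_stars {x : ℝ} (hx : 0 ≤ x) {k ℓ q : ℕ} (hk : 2 ≤ k) (hℓ : 1 ≤ ℓ)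
    (hq : 2 ≤ q) (hn : stabilityThreshold k ℓ q ≤ Fintype.card α) {F : Finset (Finset α)}
    (hF : ∀ E ∈ F, #E = k) {Y : Finset α} (hY : #Y = ℓ) {R : Finset (Finset α)}
    (hd : Disjoint (hitFam k Y) R) (hR : (R : Set (Finset α)).Intersecting)
    (hRk : ∀ E ∈ R, #E = k) (hRN : #R ≤ supCard (Fintype.card α) k 1)
    (hcard : #F = #(hitFam k Y ∪ R))
    (hfew : #{a | supCard (Fintype.card α) k 1 - supCard (Fintype.card α) k 1 / q <
      #(starFam F a)} < ℓ) :
    intWeight x F ≤ intWeight x (hitFam k Y ∪ R) := by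
  set n := Fintype.card α with hnn
  set N := supCard n k 1 with hN
  set N2 := supCard n k 2 with hN2
  set Q := stabilityRatio k ℓ q with hQ
  set h := stabilityDegree k ℓ q with hh
  set M := stabilityCard k ℓ q with hM
  set D := N / q with hD
  set N' := N - D with hN'
  set r := #R with hr
  set m := #F with hm
  rw [stabilityThreshold, ← hQ, ← hM] at hn
  have hnN : n - 1 ≤ k * N := le_mul_supCard (by omega) (by omega)
  have hNk : 4 * k ≤ N := Nat.le_of_mul_le_mul_left (c := k)
    (by have : k * (4 * k) = 4 * k * k := by ring
        omega) (by omega)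
  have hNq : 2 * q ≤ N := Nat.le_of_mul_le_mul_left (c := k)
    (by have : k * (2 * q) = 2 * q * k := by ring
        omega) (by omega)
  have hA : (2 * Q * M ^ 2 + 48 * q ^ 2 * (k * M ^ 2) + 48 * q ^ 2 * ℓ ^ 2 + 2) * N2 ≤ N :=
    mul_supCard_succ_le (by omega) (by omega) (by omega)
  have hA' : 2 * Q * M ^ 2 * N2 + 48 * q ^ 2 * (k * M ^ 2) * N2 + 48 * q ^ 2 * ℓ ^ 2 * N2 +
      2 * N2 ≤ N := by
    rw [← add_mul, ← add_mul, ← add_mul]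
    exact hA
  have hqD : q * D ≤ N := Nat.mul_div_le N q
  have hqD' : N < q * D + q := by
    have h1 := Nat.div_add_mod N q
    have h2 := Nat.mod_lt N (show 0 < q by omega)
    rw [← hD] at h1
    omega
  have hD2 : 2 ≤ D := (Nat.le_div_iff_mul_le (by omega)).2 hNq
  have h2D : 2 * D ≤ N := (Nat.mul_le_mul_right D hq).trans hqD
  have hN'D : N' + D = N := by omega
  have hmcard : m ≤ ℓ * N + r := by
    rw [hcard, card_union_of_disjoint hd]
    exact Nat.add_le_add_right ((card_hitFam_le k Y).trans (by rw [hY])) _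
  have hmN : m ≤ (ℓ + 1) * N := by
    rw [add_mul, one_mul]
    omega
  -- The points of degree at least `N / h`; double counting incidences bounds their number by a
  -- constant.
  set B : Finset α := {a | N ≤ h * #(starFam F a)} with hB
  have hBM : #B ≤ M := by
    have h1 : ∑ a ∈ B, #(starFam F a) ≤ k * ((ℓ + 1) * N) := by
      rw [sum_card_starFam]
      refine (sum_le_card_nsmul _ _ k fun E hE => ?_).trans ?_
      · exact (card_le_card inter_subset_left).trans (hF E hE).le
      · rw [smul_eq_mul, mul_comm]
        gcongr
    have h2 : #B * N ≤ h * ∑ a ∈ B, #(starFam F a) := by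
      rw [mul_sum, ← smul_eq_mul]
      exact card_nsmul_le_sum _ _ _ fun a ha => (mem_filter.1 ha).2
    refine Nat.le_of_mul_le_mul_right (c := N) ?_ (by omega)
    calc #B * N ≤ h * (k * ((ℓ + 1) * N)) := h2.trans (by gcongr)
      _ = M * N := by rw [hM, stabilityCard]; ring
  have hQ1 : 48 ≤ Q := by
    rw [hQ, stabilityRatio]
    have : 0 < q ^ 2 * ((ℓ + 1) * ((k + 1) * (8 * k * (ℓ + 1)) ^ k)) := by positivity
    rw [mul_assoc]
    omega
  have hh1 : 0 < h := by
    rw [hh, stabilityDegree]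
    positivity
  have hBc : ∀ a ∉ B, #(starFam F a) ≤ N / h := by
    intro a ha
    rw [hB, mem_filter, not_and, not_le] at ha
    exact (Nat.le_div_iff_mul_le hh1).2 (by rw [mul_comm]; exact (ha (mem_univ a)).le)
  set p := M ^ 2 * N2 + (k + 2) * k * (N / h) with hp
  have hpQ : Q * p ≤ N := by
    have h1 : 2 * (Q * ((k + 2) * k * (N / h))) ≤ N := by
      calc 2 * (Q * ((k + 2) * k * (N / h))) = h * (N / h) := by
            rw [hh, stabilityDegree]; ring
        _ ≤ N := Nat.mul_div_le N h
    have h2 : 2 * (Q * (M ^ 2 * N2)) ≤ N := by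
      have : 2 * (Q * (M ^ 2 * N2)) = 2 * Q * M ^ 2 * N2 := by ring
      omega
    rw [hp, mul_add]
    omega
  have hp4 : 4 * p ≤ N := (Nat.mul_le_mul_right p (by omega)).trans hpQ
  -- With `s * k` and `p` at most `N / 4` each, the error exponent stays below `N / 2 ≤ N'`, while
  -- `m` is still at most a constant times `s`.
  set s := N / (4 * k) with hs
  have hs4 : 4 * (s * k) ≤ N := by
    have := Nat.div_mul_le_self N (4 * k)
    rw [← hs] at this
    have h1 : 4 * (s * k) = s * (4 * k) := by ring
    omega
  have hsN : N ≤ 8 * k * s := by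
    have h1 : 1 ≤ s := (Nat.one_le_div_iff (by omega)).2 hNk
    have h2 := Nat.div_add_mod N (4 * k)
    have h3 := Nat.mod_lt N (show 0 < 4 * k by omega)
    rw [← hs] at h2
    have h4 : 4 * k ≤ 4 * k * s := Nat.le_mul_of_pos_right _ h1
    have h5 : 8 * k * s = 4 * k * s + 4 * k * s := by ring
    omega
  set c := 8 * k * (ℓ + 1) with hc
  have hmc : m ≤ c * s := by
    calc m ≤ (ℓ + 1) * (8 * k * s) := hmN.trans (by gcongr)
      _ = c * s := by rw [hc]; ring
  set err := k * (#B ^ 2 * N2) with herr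
  have herr' : err ≤ k * (M ^ 2 * N2) := by
    rw [herr]
    gcongr
  have hkey := error_le_excess hx (N := N) (N2 := N2) (N' := N') (D := D) (q := q) (k := k)
    (ℓ := ℓ) (m := m) (p := p) (s := s) (c := c) (err := err) (by omega)
    (by
      have h1 : q ≤ q * D := Nat.le_mul_of_pos_right _ (by omega)
      have h2 : 2 * q * D = q * D + q * D := by ring
      omega) hD2 (by omega) hmc (Nat.one_le_iff_ne_zero.2 (by rw [hc]; positivity)) (by omega)
    (by
      calc 48 * q ^ 2 * err ≤ 48 * q ^ 2 * (k * (M ^ 2 * N2)) := by gcongr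
        _ = 48 * q ^ 2 * (k * M ^ 2) * N2 := by ring
        _ ≤ N := by omega)
    (by omega) (by omega)
    (by
      calc 48 * q ^ 2 * (p * m * ((k + 1) * c ^ k))
          ≤ 48 * q ^ 2 * (p * ((ℓ + 1) * N) * ((k + 1) * c ^ k)) := by gcongr
        _ = Q * p * N := by rw [hQ, stabilityRatio, ← hc]; ring
        _ ≤ N * N := by gcongr
        _ = N ^ 2 := by ring)
  have hupper := intWeight_le_sum_excess hx hF hBc (p := p) (by
    rw [hp]
    gcongr)
  have hconv := sum_excess_le hx (fun a => if a ∈ B then #(starFam F a) else 0) (ℓ := ℓ) (N' := N')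
    (D := D) (r := r) (err := err) (by omega)
    (fun a => by
      rw [hN'D]
      split_ifs
      · exact card_starFam_le hF a
      · exact Nat.zero_le _)
    (lt_of_le_of_lt (card_le_card fun a ha => by
      rw [mem_filter] at ha ⊢
      refine ⟨mem_univ _, ?_⟩
      have := ha.2
      split_ifs at this
      · exact this
      · omega) hfew)
    (by
      rw [hN'D, ← sum_filter, filter_mem_eq_inter, univ_inter]
      refine (sum_card_starFam_le hF B).trans ?_
      exact Nat.add_le_add_right hmcard _)
  have hlower := le_intWeight_hitFam_union hx (by omega) hd hR hRk
  rw [hN'D] at hconv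
  rw [hY, ← hcard] at hlower
  linarith

end Stability

/-! ### Exchanging stray members for sets in stars -/

section Exchange

variable {α : Type*} [DecidableEq α]

/-- Members of `F` missing `Y` may be exchanged for new sets meeting `Y` as long as they meet few
other members. -/
theorem intWeight_le_exchange {x : ℝ} (hx : 0 ≤ x) {F B P : Finset (Finset α)} {Y : Finset α}
    {g : ℕ} (hcard : #B ≤ #P) (hPF : Disjoint P F) (hB : ∀ A ∈ B, Disjoint A Y)
    (hP : ∀ A ∈ P, ¬Disjoint A Y) (hg : ∀ A ∈ B, #{E ∈ F | E ≠ A ∧ ¬Disjoint E A} ≤ g)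
    (hY : ∀ y ∈ Y, g ≤ #(starFam F y)) :
    intWeight x F ≤ intWeight x (F \ B ∪ P) := by
  classical
  have hμ : (1 : ℝ) ≤ 1 + x := by linarith
  -- An intersecting family through `A ∈ B` contains only `A` and members meeting it, of which there
  -- are at most `g`.
  have hupper : intWeight x F ≤ intWeight x (F \ B) + #B * (x * (1 + x) ^ g) := by
    have hsub : intFamilies F ⊆ intFamilies (F \ B) ∪
        B.biUnion fun A => {G ∈ intFamilies F | A ∈ G} := by
      intro G hG
      by_cases h : ∃ A ∈ B, A ∈ G
      · obtain ⟨A, hA, hAG⟩ := h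
        exact mem_union_right _ (mem_biUnion.2 ⟨A, hA, mem_filter.2 ⟨hG, hAG⟩⟩)
      · push Not at h
        obtain ⟨h1, h2⟩ := mem_intFamilies.1 hG
        exact mem_union_left _ (mem_intFamilies.2 ⟨fun E hE =>
          mem_sdiff.2 ⟨h1 hE, fun hEB => h E hEB hE⟩, h2⟩)
    have hA : ∀ A ∈ B, famWeight x {G ∈ intFamilies F | A ∈ G} ≤ x * (1 + x) ^ g := by
      intro A hA
      refine (famWeight_interval_le hx (A := {A}) (B := {E ∈ F | E ≠ A ∧ ¬Disjoint E A})
        fun G hG => ?_).trans ?_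
      · obtain ⟨h1, h2⟩ := mem_filter.1 hG
        obtain ⟨h3, h4⟩ := mem_intFamilies.1 h1
        refine ⟨singleton_subset_iff.2 h2, fun E hE => ?_⟩
        by_cases hEA : E = A
        · exact mem_union_left _ (mem_singleton.2 hEA)
        · exact mem_union_right _ (mem_filter.2 ⟨h3 hE, hEA, h4 (mem_coe.2 hE) (mem_coe.2 h2)⟩)
      · rw [card_singleton, pow_one]
        exact mul_le_mul_of_nonneg_left (pow_le_pow_right₀ hμ (hg A hA)) hx
    calc intWeight x F ≤ _ := famWeight_mono hx hsub
      _ ≤ intWeight x (F \ B) + famWeight x (B.biUnion fun A => {G ∈ intFamilies F | A ∈ G}) :=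
          famWeight_union_le hx _ _
      _ ≤ _ := by
          refine add_le_add le_rfl ((famWeight_biUnion_le hx _ _).trans ?_)
          rw [← nsmul_eq_mul]
          exact sum_le_card_nsmul _ _ _ hA
  rcases P.eq_empty_or_nonempty with rfl | ⟨A₀, hA₀⟩
  · rw [card_empty] at hcard
    rw [card_eq_zero.1 (by omega : #B = 0)]
    simp
  have hex : ∀ A ∈ P, ∃ y ∈ Y, y ∈ A := fun A hA => by
    obtain ⟨y, h1, h2⟩ := not_disjoint_iff.1 (hP A hA)
    exact ⟨y, h2, h1⟩
  have : Nonempty α := ⟨(hex A₀ hA₀).choose⟩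
  choose! f hfY hfA using hex
  -- Each new set `A` may be added to any subfamily of the star at a point of `A` in `Y`. That star
  -- has at least `g` sets and survives the removal of `B`, whose members miss `Y`.
  set S : Finset α → Finset (Finset (Finset α)) := fun A =>
    (starFam F (f A)).powerset.image (insert A) with hS
  have hstar : ∀ A ∈ P, starFam F (f A) ⊆ F \ B := fun A hA E hE => by
    obtain ⟨h1, h2⟩ := mem_starFam.1 hE
    exact mem_sdiff.2 ⟨h1, fun h => disjoint_left.1 (hB E h) h2 (hfY A hA)⟩
  have hPn : ∀ A ∈ P, ∀ G ⊆ F, A ∉ G := fun A hA G hG h => disjoint_left.1 hPF hA (hG h)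
  have hmemS : ∀ A ∈ P, ∀ G ∈ S A, G ⊆ F \ B ∪ P ∧ (G : Set (Finset α)).Intersecting ∧
      ∀ A' ∈ P, A' ∈ G ↔ A' = A := by
    intro A hA G hG
    obtain ⟨G', hG', rfl⟩ := mem_image.1 hG
    rw [mem_powerset] at hG'
    refine ⟨insert_subset (mem_union_right _ hA)
      ((hG'.trans (hstar A hA)).trans subset_union_left), ?_, fun A' hA' => ?_⟩
    · have hall : ∀ E ∈ insert A G', f A ∈ E := fun E hE => by
        rcases mem_insert.1 hE with rfl | hE
        · exact hfA E hA
        · exact (mem_starFam.1 (hG' hE)).2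
      exact fun E hE E' hE' => not_disjoint_iff.2 ⟨f A, hall E hE, hall E' hE'⟩
    · rw [mem_insert]
      exact ⟨fun h => h.resolve_right (hPn A' hA' G' (hG'.trans (starFam_subset _ _))),
        Or.inl⟩
  have hwS : ∀ A ∈ P, x * (1 + x) ^ g ≤ famWeight x (S A) := by
    intro A hA
    have hinj : Set.InjOn (insert A) ((starFam F (f A)).powerset : Set (Finset (Finset α))) := by
      intro G hG G' hG' he
      have h1 := hPn A hA G ((mem_powerset.1 (mem_coe.1 hG)).trans (starFam_subset _ _))
      have h2 := hPn A hA G' ((mem_powerset.1 (mem_coe.1 hG')).trans (starFam_subset _ _))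
      rw [← erase_insert h1, ← erase_insert h2, he]
    have : famWeight x (S A) = x * (1 + x) ^ #(starFam F (f A)) := by
      rw [famWeight, hS, sum_image hinj, ← famWeight_powerset, famWeight, mul_sum]
      refine sum_congr rfl fun G hG => ?_
      rw [card_insert_of_notMem
        (hPn A hA G ((mem_powerset.1 hG).trans (starFam_subset _ _))), pow_succ']
    rw [this]
    exact mul_le_mul_of_nonneg_left (pow_le_pow_right₀ hμ (hY _ (hfY A hA))) hx
  have hdis : Set.PairwiseDisjoint (P : Set (Finset α)) S := by
    intro A hA A' hA' hne
    refine disjoint_left.2 fun G h1 h2 => hne ?_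
    have h3 := ((hmemS A hA G h1).2.2 A hA).2 rfl
    exact ((hmemS A' hA' G h2).2.2 A hA).1 h3
  have hd : Disjoint (intFamilies (F \ B)) (P.biUnion S) := disjoint_left.2 fun G h1 h2 => by
    obtain ⟨A, hA, hG⟩ := mem_biUnion.1 h2
    exact hPn A hA G ((mem_intFamilies.1 h1).1.trans sdiff_subset)
      (((hmemS A hA G hG).2.2 A hA).2 rfl)
  have hlower : intWeight x (F \ B) + #P * (x * (1 + x) ^ g) ≤ intWeight x (F \ B ∪ P) := by
    calc intWeight x (F \ B) + #P * (x * (1 + x) ^ g)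
        ≤ intWeight x (F \ B) + ∑ A ∈ P, famWeight x (S A) := by
          refine add_le_add le_rfl ?_
          rw [← nsmul_eq_mul]
          exact card_nsmul_le_sum _ _ _ hwS
      _ = famWeight x (intFamilies (F \ B) ∪ P.biUnion S) := by
          simp only [intWeight, famWeight]
          rw [sum_union hd, sum_biUnion hdis]
      _ ≤ _ := famWeight_mono hx (union_subset (intFamilies_mono subset_union_left)
          (biUnion_subset.2 fun A hA G hG =>
            mem_intFamilies.2 ⟨(hmemS A hA G hG).1, (hmemS A hA G hG).2.1⟩))
  have hle : (#B : ℝ) * (x * (1 + x) ^ g) ≤ #P * (x * (1 + x) ^ g) := by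
    have : (#B : ℝ) ≤ #P := by exact_mod_cast hcard
    gcongr
  linarith

end Exchange

/-! ### Completing nearly full stars -/

section FullStars

variable {α : Type*} [Fintype α] [DecidableEq α]

theorem card_hitFam_sdiff_le {F : Finset (Finset α)} {k D : ℕ} {Y : Finset α}
    (hY : ∀ y ∈ Y, supCard (Fintype.card α) k 1 ≤ #(starFam F y) + D) (hF : ∀ E ∈ F, #E = k) :
    #(hitFam k Y \ F) ≤ #Y * D := by
  calc #(hitFam k Y \ F) ≤
      #(Y.biUnion fun y => {E ∈ powersetCard k (univ : Finset α) | {y} ⊆ E} \ starFam F y) := by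
        refine card_le_card fun E hE => ?_
        obtain ⟨h1, h2⟩ := mem_sdiff.1 hE
        obtain ⟨h3, h4⟩ := mem_hitFam.1 h1
        obtain ⟨y, hyE, hyY⟩ := not_disjoint_iff.1 h4
        exact mem_biUnion.2 ⟨y, hyY, mem_sdiff.2 ⟨mem_filter.2 ⟨mem_powersetCard_univ.2 h3,
          singleton_subset_iff.2 hyE⟩, fun h => h2 (mem_starFam.1 h).1⟩⟩
    _ ≤ _ := by
        refine card_biUnion_le.trans (sum_le_card_nsmul _ _ D fun y hy => ?_)
        have hsub : starFam F y ⊆ {E ∈ powersetCard k (univ : Finset α) | {y} ⊆ E} := by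
          intro E hE
          obtain ⟨h1, h2⟩ := mem_starFam.1 hE
          exact mem_filter.2 ⟨mem_powersetCard_univ.2 (hF E h1), singleton_subset_iff.2 h2⟩
        rw [card_sdiff_of_subset hsub, card_filter_superset, card_singleton]
        have := hY y hy
        omega

theorem card_hitFam_not_disjoint_le (k : ℕ) {Y A : Finset α} (h : Disjoint A Y) :
    #{E ∈ hitFam k Y | ¬Disjoint E A} ≤ #Y * (#A * supCard (Fintype.card α) k 2) := by
  calc #{E ∈ hitFam k Y | ¬Disjoint E A} ≤ #(Y.biUnion fun y =>
      {E ∈ powersetCard k (univ : Finset α) | {y} ⊆ E ∧ ¬Disjoint E A}) := by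
        refine card_le_card fun E hE => ?_
        obtain ⟨h1, h2⟩ := mem_filter.1 hE
        obtain ⟨h3, h4⟩ := mem_hitFam.1 h1
        obtain ⟨y, hyE, hyY⟩ := not_disjoint_iff.1 h4
        exact mem_biUnion.2 ⟨y, hyY, mem_filter.2 ⟨mem_powersetCard_univ.2 h3,
          singleton_subset_iff.2 hyE, h2⟩⟩
    _ ≤ _ := by
        refine card_biUnion_le.trans (sum_le_card_nsmul _ _ _ fun y hy => ?_)
        have := card_filter_superset_not_disjoint_le k (J := {y}) (M := A)
          (disjoint_singleton_left.2 (disjoint_right.1 h hy))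
        simpa using this

/-- Exchanging members of `F` missing `Y` for the missing sets of `hitFam k Y`. -/
theorem card_sdiff_hitFam {F : Finset (Finset α)} {k r : ℕ} {Y : Finset α}
    (hcard : #F = #(hitFam k Y) + r) :
    #(F \ hitFam k Y) = r + #(hitFam k Y \ F) := by
  have h1 := card_sdiff_add_card_inter F (hitFam k Y)
  have h2 := card_sdiff_add_card_inter (hitFam k Y) F
  rw [inter_comm] at h2
  omega

/-- Families with `ℓ` nearly full stars and few further members are dominated by families with
`ℓ` full stars. -/
theorem exists_full_of_nearly_full {x : ℝ} (hx : 0 ≤ x) {F : Finset (Finset α)} {k r D : ℕ}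
    {Y : Finset α} (hF : ∀ E ∈ F, #E = k) (hcard : #F = #(hitFam k Y) + r)
    (hY : ∀ y ∈ Y, supCard (Fintype.card α) k 1 ≤ #(starFam F y) + D)
    (hbig : #Y * (k * supCard (Fintype.card α) k 2) + r + #Y * D + D ≤
      supCard (Fintype.card α) k 1) :
    ∃ R : Finset (Finset α), (∀ A ∈ R, #A = k ∧ Disjoint A Y) ∧ #R = r ∧
      intWeight x F ≤ intWeight x (hitFam k Y ∪ R) := by
  set U := hitFam k Y with hU
  have hs := card_hitFam_sdiff_le hY hF
  have hQ := card_sdiff_hitFam hcard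
  rw [← hU] at hs hQ
  have hQY : ∀ A ∈ F \ U, #A = k ∧ Disjoint A Y := fun A hA => by
    obtain ⟨h1, h2⟩ := mem_sdiff.1 hA
    refine ⟨hF A h1, ?_⟩
    by_contra h
    exact h2 (mem_hitFam.2 ⟨hF A h1, h⟩)
  obtain ⟨B, hB, hBc⟩ := exists_subset_card_eq (by omega : #(U \ F) ≤ #(F \ U))
  have hBF : B ⊆ F := hB.trans sdiff_subset
  refine ⟨(F \ U) \ B, fun A hA => hQY A (sdiff_subset hA), ?_, ?_⟩
  · rw [card_sdiff_of_subset hB]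
    omega
  -- The bound `g` adds the sets of `hitFam k Y` that meet a given stray set to the number of all
  -- stray sets.
  · have h := intWeight_le_exchange hx (F := F) (B := B) (P := U \ F) (Y := Y)
      (g := #Y * (k * supCard (Fintype.card α) k 2) + r + #Y * D) hBc.le
      disjoint_sdiff_self_left (fun A hA => (hQY A (hB hA)).2)
      (fun A hA => (mem_hitFam.1 (sdiff_subset hA)).2) ?_ ?_
    · convert h using 2
      ext E
      simp only [mem_union, mem_sdiff]
      have h1 : E ∈ B → E ∈ F ∧ E ∉ U := fun h => mem_sdiff.1 (hB h)
      tauto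
    · intro A hA
      obtain ⟨hAk, hAY⟩ := hQY A (hB hA)
      calc #{E ∈ F | E ≠ A ∧ ¬Disjoint E A} ≤ #({E ∈ U | ¬Disjoint E A} ∪ F \ U) := by
            refine card_le_card fun E hE => ?_
            obtain ⟨h1, h2, h3⟩ := mem_filter.1 hE
            by_cases hEU : E ∈ U
            · exact mem_union_left _ (mem_filter.2 ⟨hEU, h3⟩)
            · exact mem_union_right _ (mem_sdiff.2 ⟨h1, hEU⟩)
        _ ≤ _ := (card_union_le _ _).trans (Nat.add_le_add
            (card_hitFam_not_disjoint_le k hAY) le_rfl)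
        _ ≤ _ := by
            rw [hAk]
            omega
    · intro y hy
      have := hY y hy
      omega

end FullStars

/-! ### Graphs: links of an edge and degree sums -/

section Graph

variable {α : Type*} [DecidableEq α]

theorem intWeight_insert {x : ℝ} {U : Finset (Finset α)} {e : Finset α} (he : e.Nonempty)
    (heU : e ∉ U) :
    intWeight x (insert e U) = intWeight x U + x * intWeight x (crossing U {e}) := by
  have h1 : intFamilies {e} = {∅, {e}} := by
    ext G
    rw [mem_intFamilies, subset_singleton_iff, mem_insert, mem_singleton]
    refine ⟨fun h => h.1, fun h => ⟨h, ?_⟩⟩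
    rcases h with rfl | rfl
    · rw [coe_empty]
      exact Set.intersecting_empty
    · intro A hA B hB
      rw [mem_coe, mem_singleton] at hA hB
      rw [hA, hB, disjoint_self_iff_empty]
      exact he.ne_empty
  have h2 : crossing U ∅ = U := by simp [crossing]
  rw [insert_eq, union_comm, intWeight_union (disjoint_singleton_right.2 heU), h1,
    sum_pair (singleton_ne_empty e).symm, h2]
  simp

variable [Fintype α]

/-- The points joined to `a` in a family of pairs. -/
def nbr (U : Finset (Finset α)) (a : α) : Finset α := {z | {a, z} ∈ U}

theorem mem_nbr {U : Finset (Finset α)} {a z : α} : z ∈ nbr U a ↔ {a, z} ∈ U := by simp [nbr]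

omit [Fintype α] in
theorem exists_eq_pair {a : α} {E : Finset α} (hE : #E = 2) (ha : a ∈ E) :
    ∃ z, z ≠ a ∧ E = {a, z} := by
  obtain ⟨z, hz⟩ := card_eq_one.1 (by rw [card_erase_of_mem ha, hE] : #(E.erase a) = 1)
  refine ⟨z, (mem_erase.1 (hz ▸ mem_singleton_self z)).1, ?_⟩
  rw [← insert_erase ha, hz]

omit [Fintype α] in
theorem pair_right_injective (a : α) : Function.Injective fun z : α => ({a, z} : Finset α) := by
  intro z z' h
  have h1 : z ∈ ({a, z'} : Finset α) := by rw [← show ({a, z} : Finset α) = {a, z'} from h]; simp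
  have h2 : z' ∈ ({a, z} : Finset α) := by rw [show ({a, z} : Finset α) = {a, z'} from h]; simp
  simp only [mem_insert, mem_singleton] at h1 h2
  rcases h1 with rfl | h1
  · rcases h2 with h2 | h2 <;> exact h2.symm
  · exact h1

theorem starFam_eq_image {U : Finset (Finset α)} (hU : ∀ E ∈ U, #E = 2) (a : α) :
    starFam U a = (nbr U a).image fun z => {a, z} := by
  ext E
  rw [mem_starFam, mem_image]
  constructor
  · rintro ⟨h1, h2⟩
    obtain ⟨z, -, rfl⟩ := exists_eq_pair (hU E h1) h2
    exact ⟨z, mem_nbr.2 h1, rfl⟩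
  · rintro ⟨z, hz, rfl⟩
    exact ⟨mem_nbr.1 hz, mem_insert_self _ _⟩

theorem card_nbr {U : Finset (Finset α)} (hU : ∀ E ∈ U, #E = 2) (a : α) :
    #(nbr U a) = #(starFam U a) := by
  rw [starFam_eq_image hU, card_image_of_injective _ (pair_right_injective a)]

/-- Among edges meeting `{a, b}`, an intersecting family lies in the star of `a`, or in the star of
`b`, or consists of the two edges from `a` and `b` to a common neighbour. The `-1` corrects for the
empty family. -/
theorem intWeight_crossing_pair {x : ℝ} {U : Finset (Finset α)} (hU : ∀ E ∈ U, #E = 2) {a b : α}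
    (hab : a ≠ b) (hU' : {a, b} ∉ U) :
    intWeight x (crossing U {{a, b}}) =
      (1 + x) ^ #(nbr U a) + (1 + x) ^ #(nbr U b) - 1 + #(nbr U a ∩ nbr U b) * x ^ 2 := by
  have hnotb : ∀ E ∈ starFam U a, b ∉ E := fun E hE hb => by
    obtain ⟨h1, h2⟩ := mem_starFam.1 hE
    have : ({a, b} : Finset α) = E := eq_of_subset_of_card_le
      (insert_subset h2 (singleton_subset_iff.2 hb)) (by rw [hU E h1, card_pair hab])
    exact hU' (this ▸ h1)
  have hnota : ∀ E ∈ starFam U b, a ∉ E := fun E hE ha => by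
    obtain ⟨h1, h2⟩ := mem_starFam.1 hE
    exact hnotb E (mem_starFam.2 ⟨h1, ha⟩) h2
  have hdis : Disjoint (starFam U a) (starFam U b) := disjoint_left.2 fun E h1 h2 =>
    hnotb E h1 (mem_starFam.1 h2).2
  set Tr : Finset (Finset (Finset α)) :=
    (nbr U a ∩ nbr U b).image fun z => {{a, z}, {b, z}} with hTr
  have hz : ∀ z ∈ nbr U a ∩ nbr U b, {a, z} ∈ starFam U a ∧ {b, z} ∈ starFam U b := fun z hz => by
    obtain ⟨h1, h2⟩ := mem_inter.1 hz
    exact ⟨mem_starFam.2 ⟨mem_nbr.1 h1, mem_insert_self _ _⟩,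
      mem_starFam.2 ⟨mem_nbr.1 h2, mem_insert_self _ _⟩⟩
  have hfam : intFamilies (crossing U {{a, b}}) =
      ((starFam U a).powerset ∪ (starFam U b).powerset) ∪ Tr := by
    ext G
    constructor
    · intro hG
      obtain ⟨h1, h2⟩ := mem_intFamilies.1 hG
      have h3 : ∀ E ∈ G, E ∈ starFam U a ∨ E ∈ starFam U b := fun E hE => by
        obtain ⟨h4, h5⟩ := mem_crossing.1 (h1 hE)
        have h6 := h5 _ (mem_singleton_self _)
        rw [disjoint_insert_right, disjoint_singleton_right, not_and_or, not_not, not_not] at h6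
        exact h6.imp (fun h => mem_starFam.2 ⟨h4, h⟩) fun h => mem_starFam.2 ⟨h4, h⟩
      by_cases ha : G ⊆ starFam U a
      · exact mem_union_left _ (mem_union_left _ (mem_powerset.2 ha))
      by_cases hb : G ⊆ starFam U b
      · exact mem_union_left _ (mem_union_right _ (mem_powerset.2 hb))
      obtain ⟨B, hB, hBa⟩ := not_subset.1 ha
      obtain ⟨A, hA, hAb⟩ := not_subset.1 hb
      have hBb := (h3 B hB).resolve_left hBa
      have hAa := (h3 A hA).resolve_right hAb
      have hmeet : ∀ z z', {a, z} ∈ G → {b, z'} ∈ G → {a, z} ∈ starFam U a →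
          {b, z'} ∈ starFam U b → z = z' := by
        intro z z' hzG hzG' hz1 hz2
        have h4 := h2 (mem_coe.2 hzG) (mem_coe.2 hzG')
        have h5 := hnota _ hz2
        have h6 := hnotb _ hz1
        simp only [mem_insert, mem_singleton, not_or] at h5 h6
        simp only [disjoint_insert_left, disjoint_singleton_left, mem_insert, mem_singleton] at h4
        have h7 := h5.2
        have h8 := h6.2
        by_contra h9
        refine h4 ⟨?_, ?_⟩
        · rintro (h | h)
          · exact hab h
          · exact h7 h
        · rintro (h | h)
          · exact h8 h.symm
          · exact h9 h
      obtain ⟨z, -, hAz⟩ := exists_eq_pair (hU A (mem_starFam.1 hAa).1) (mem_starFam.1 hAa).2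
      obtain ⟨z', -, hBz⟩ := exists_eq_pair (hU B (mem_starFam.1 hBb).1) (mem_starFam.1 hBb).2
      rw [hAz] at hA hAa
      rw [hBz] at hB hBb
      obtain rfl := hmeet z z' hA hB hAa hBb
      refine mem_union_right _ (mem_image.2 ⟨z, mem_inter.2
        ⟨mem_nbr.2 (mem_starFam.1 hAa).1, mem_nbr.2 (mem_starFam.1 hBb).1⟩, ?_⟩)
      refine subset_antisymm (insert_subset hA (singleton_subset_iff.2 hB)) fun E hE => ?_
      rw [mem_insert, mem_singleton]
      rcases h3 E hE with h | h
      · obtain ⟨w, -, rfl⟩ := exists_eq_pair (hU E (mem_starFam.1 h).1) (mem_starFam.1 h).2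
        rw [hmeet w z hE hB h hBb]
        exact Or.inl rfl
      · obtain ⟨w, -, rfl⟩ := exists_eq_pair (hU E (mem_starFam.1 h).1) (mem_starFam.1 h).2
        rw [hmeet z w hA hE hAa h]
        exact Or.inr rfl
    · have hsa : ∀ c ∈ ({a, b} : Finset α), starFam U c ⊆ crossing U {{a, b}} := fun c hc E hE => by
        obtain ⟨h1, h2⟩ := mem_starFam.1 hE
        refine mem_crossing.2 ⟨h1, fun A hA => ?_⟩
        rw [mem_singleton.1 hA]
        exact not_disjoint_iff.2 ⟨c, h2, hc⟩
      have hst : ∀ c ∈ ({a, b} : Finset α), ∀ G ⊆ starFam U c,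
          G ∈ intFamilies (crossing U {{a, b}}) := fun c hc G hG =>
        mem_intFamilies.2 ⟨hG.trans (hsa c hc), fun E hE E' hE' => not_disjoint_iff.2
          ⟨c, (mem_starFam.1 (hG hE)).2, (mem_starFam.1 (hG hE')).2⟩⟩
      intro hG
      rcases mem_union.1 hG with hG | hG
      · rcases mem_union.1 hG with hG | hG
        · exact hst a (by simp) G (mem_powerset.1 hG)
        · exact hst b (by simp) G (mem_powerset.1 hG)
      · obtain ⟨z, hzm, rfl⟩ := mem_image.1 hG
        obtain ⟨h1, h2⟩ := hz z hzm
        refine mem_intFamilies.2 ⟨insert_subset (hsa a (by simp) h1)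
          (singleton_subset_iff.2 (hsa b (by simp) h2)), ?_⟩
        have hall : ∀ E ∈ ({{a, z}, {b, z}} : Finset (Finset α)), z ∈ E := by
          intro E hE
          rw [mem_insert, mem_singleton] at hE
          rcases hE with rfl | rfl <;> simp
        exact fun E hE E' hE' => not_disjoint_iff.2 ⟨z, hall E hE, hall E' hE'⟩
  have hne : ∀ z ∈ nbr U a ∩ nbr U b, ({a, z} : Finset α) ≠ {b, z} := fun z hzm h => by
    obtain ⟨h1, h2⟩ := hz z hzm
    exact disjoint_left.1 hdis h1 (h ▸ h2)
  have hTrw : famWeight x Tr = #(nbr U a ∩ nbr U b) * x ^ 2 := by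
    have hinj : Set.InjOn (fun z : α => ({{a, z}, {b, z}} : Finset (Finset α)))
        (nbr U a ∩ nbr U b : Finset α) := by
      intro z hzm z' hzm' he
      have h1 : ({a, z} : Finset α) ∈ ({{a, z'}, {b, z'}} : Finset (Finset α)) := by
        rw [← show ({{a, z}, {b, z}} : Finset (Finset α)) = {{a, z'}, {b, z'}} from he]
        exact mem_insert_self _ _
      rw [mem_insert, mem_singleton] at h1
      rcases h1 with h1 | h1
      · exact pair_right_injective a h1
      · exact absurd (h1 ▸ (hz z (mem_coe.1 hzm)).1)
          (disjoint_right.1 hdis (hz z' (mem_coe.1 hzm')).2)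
    rw [famWeight, hTr, sum_image hinj, sum_congr rfl fun z hzm => by rw [card_pair (hne z hzm)],
      sum_const, nsmul_eq_mul]
  have hTrd : Disjoint ((starFam U a).powerset ∪ (starFam U b).powerset) Tr := by
    refine disjoint_right.2 fun G hG => ?_
    obtain ⟨z, hzm, rfl⟩ := mem_image.1 hG
    obtain ⟨h1, h2⟩ := hz z hzm
    rw [mem_union, mem_powerset, mem_powerset, not_or]
    refine ⟨fun h => ?_, fun h => ?_⟩
    · exact disjoint_left.1 hdis (h (mem_insert_of_mem (mem_singleton_self _))) h2
    · exact disjoint_left.1 hdis h1 (h (mem_insert_self _ _))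
  have hinter : (starFam U a).powerset ∩ (starFam U b).powerset = {∅} := by
    ext G
    rw [mem_inter, mem_powerset, mem_powerset, ← subset_inter_iff,
      disjoint_iff_inter_eq_empty.1 hdis, subset_empty, mem_singleton]
  have hpow : famWeight x ((starFam U a).powerset ∪ (starFam U b).powerset) + 1 =
      (1 + x) ^ #(nbr U a) + (1 + x) ^ #(nbr U b) := by
    rw [card_nbr hU, card_nbr hU, ← famWeight_powerset, ← famWeight_powerset]
    simp only [famWeight]
    rw [← sum_union_inter, hinter]
    simp
  rw [intWeight, hfam, famWeight, sum_union hTrd]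
  change famWeight x _ + famWeight x Tr = _
  rw [hTrw]
  linarith

omit [Fintype α] in
theorem card_starFam_add_le {U : Finset (Finset α)} (hU : ∀ E ∈ U, #E = 2) {a b : α} (hab : a ≠ b) :
    #(starFam U a) + #(starFam U b) ≤ #(starFam U a ∪ starFam U b) + 1 := by
  rw [← card_union_add_card_inter]
  refine Nat.add_le_add_left ?_ _
  rw [← card_singleton ({a, b} : Finset α)]
  refine card_le_card fun E hE => mem_singleton.2 ?_
  obtain ⟨h1, h2⟩ := mem_inter.1 hE
  obtain ⟨h3, h4⟩ := mem_starFam.1 h1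
  exact (eq_of_subset_of_card_le (insert_subset h4 (singleton_subset_iff.2 (mem_starFam.1 h2).2))
    (by rw [hU E h3, card_pair hab])).symm

-- Inclusion-exclusion: any two of the stars share at most one edge.
omit [Fintype α] in
theorem card_starFam_add_add_le {U : Finset (Finset α)} (hU : ∀ E ∈ U, #E = 2) {a b c : α}
    (hab : a ≠ b) (hac : a ≠ c) (hbc : b ≠ c) :
    #(starFam U a) + #(starFam U b) + #(starFam U c) ≤ #U + 3 := by
  have h1 := card_starFam_add_le hU hab
  have h2 := card_union_add_card_inter (starFam U a ∪ starFam U b) (starFam U c)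
  have h3 : #((starFam U a ∪ starFam U b) ∩ starFam U c) ≤ 2 := by
    rw [union_inter_distrib_right]
    have h4 := card_union_le (starFam U a ∩ starFam U c) (starFam U b ∩ starFam U c)
    have h5 := card_starFam_add_le hU hac
    have h6 := card_starFam_add_le hU hbc
    rw [← card_union_add_card_inter] at h5 h6
    omega
  have h4 : #(starFam U a ∪ starFam U b ∪ starFam U c) ≤ #U :=
    card_le_card (union_subset (union_subset (starFam_subset _ _) (starFam_subset _ _))
      (starFam_subset _ _))
  omega

end Graph

/-! ### Graphs covered by `ℓ + 1` points -/

section CoveredGraph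

variable {α : Type*} [Fintype α] [DecidableEq α]

theorem intWeight_hitFam_le {x : ℝ} (hx : 0 ≤ x) (k : ℕ) {Y Y' : Finset α} (h : #Y = #Y') :
    intWeight x (hitFam k Y) ≤ intWeight x (hitFam k Y') := by
  obtain ⟨σ, h1, -, -⟩ := exists_perm_of_card_eq (disjoint_empty_right Y) (disjoint_empty_right Y)
    (disjoint_empty_right ∅) (disjoint_empty_right Y') (disjoint_empty_right Y')
    (disjoint_empty_right ∅) h rfl rfl
  refine intWeight_le_of_perm hx σ fun E hE => ?_
  rw [mem_hitFam] at hE ⊢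
  rw [card_map, disjoint_map_perm_iff h1]
  exact hE

/-- Moving `j` from the smaller degree to the larger does not decrease the weight. With `z = (1 + x)
^ j - 1`, the difference of the two sides is at least `(1 + x) ^ d * z ^ 2 - j * x ^ 2`, which is
nonnegative by Bernoulli's inequality. -/
theorem pair_weight_le {x : ℝ} (hx : 0 ≤ x) {ℓ t d j D : ℕ} (hℓ : ℓ = d + j) (hD : ℓ + t + j ≤ D) :
    (1 + x) ^ (ℓ + t) + (1 + x) ^ ℓ - 1 + ℓ * x ^ 2 ≤
      (1 + x) ^ D + (1 + x) ^ d - 1 + d * x ^ 2 := by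
  have hμ : (1 : ℝ) ≤ 1 + x := by linarith
  have h1 : (1 + x) ^ (ℓ + t + j) ≤ (1 + x) ^ D := pow_le_pow_right₀ hμ hD
  subst hℓ
  have hA : (1 : ℝ) ≤ (1 + x) ^ d := one_le_pow₀ hμ
  have hm : (1 : ℝ) ≤ (1 + x) ^ t := one_le_pow₀ hμ
  have hz := mul_le_pow_sub_one hx j
  have hz0 : (0 : ℝ) ≤ j * x := by positivity
  set A := (1 + x) ^ d
  set m := (1 + x) ^ t
  set z := (1 + x) ^ j - 1 with hzd
  have hj : (1 + x) ^ j = 1 + z := by rw [hzd]; ring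
  have e1 : (1 + x) ^ (d + j + t) = A * (1 + z) * m := by rw [pow_add, pow_add, hj]
  have e2 : (1 + x) ^ (d + j) = A * (1 + z) := by rw [pow_add, hj]
  have e3 : (1 + x) ^ (d + j + t + j) = A * (1 + z) * m * (1 + z) := by rw [pow_add, e1, hj]
  rw [e3] at h1
  rw [e1, e2]
  have hjj : (j : ℝ) * x ^ 2 ≤ z ^ 2 := by
    have h2 : (j : ℝ) ≤ (j : ℝ) ^ 2 := by
      exact_mod_cast Nat.le_self_pow (by norm_num) j
    calc (j : ℝ) * x ^ 2 ≤ (j : ℝ) ^ 2 * x ^ 2 := by gcongr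
      _ = (j * x) ^ 2 := by ring
      _ ≤ z ^ 2 := by gcongr
  have hz1 : 0 ≤ z := hz0.trans hz
  have h3 : z ^ 2 ≤ A * z ^ 2 := le_mul_of_one_le_left (sq_nonneg z) hA
  have h4 : A * (1 + z) * z ≤ A * (1 + z) * z * m := le_mul_of_one_le_right (by positivity) hm
  push_cast
  nlinarith

theorem nbr_hitFam_of_mem {W : Finset α} {a : α} (ha : a ∈ W) :
    nbr (hitFam 2 W) a = univ.erase a := by
  ext z
  rw [mem_nbr, mem_hitFam, mem_erase]
  refine ⟨fun h => ⟨fun hz => ?_, mem_univ _⟩, fun h => ⟨card_pair h.1.symm,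
    not_disjoint_iff.2 ⟨a, mem_insert_self _ _, ha⟩⟩⟩
  have := h.1
  rw [hz] at this
  simp at this

theorem nbr_hitFam_of_notMem {W : Finset α} {a : α} (ha : a ∉ W) :
    nbr (hitFam 2 W) a = W := by
  ext z
  rw [mem_nbr, mem_hitFam, disjoint_insert_left, disjoint_singleton_left, not_and_or, not_not,
    not_not]
  refine ⟨fun h => h.2.resolve_left ha, fun h => ⟨card_pair ?_, Or.inr h⟩⟩
  rintro rfl
  exact ha h

theorem card_nbr_add_card_nbr_sdiff {F U : Finset (Finset α)} (h : F ⊆ U) (a : α) :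
    #(nbr F a) + #(nbr (U \ F) a) = #(nbr U a) := by
  rw [← card_union_of_disjoint]
  · congr 1
    ext z
    simp only [mem_union, mem_nbr, mem_sdiff]
    have := @h {a, z}
    tauto
  · refine disjoint_left.2 fun z h1 h2 => ?_
    exact (mem_sdiff.1 (mem_nbr.1 h2)).2 (mem_nbr.1 h1)

theorem hitFam_two_insert (Y : Finset α) (v : α) :
    hitFam 2 (insert v Y) = hitFam 2 Y ∪ sunflower {v} (insert v Y)ᶜ := by
  ext E
  rw [mem_union, mem_hitFam, mem_hitFam, mem_sunflower]
  constructor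
  · rintro ⟨h1, h2⟩
    by_cases hE : Disjoint E Y
    · rw [disjoint_insert_right, not_and_or, not_not] at h2
      obtain ⟨z, hz, rfl⟩ := exists_eq_pair h1 (h2.resolve_right (not_not.2 hE))
      refine Or.inr ⟨z, ?_, pair_comm z v⟩
      rw [mem_compl, mem_insert, not_or]
      rw [disjoint_insert_left, disjoint_singleton_left] at hE
      exact ⟨hz, hE.2⟩
    · exact Or.inl ⟨h1, hE⟩
  · rintro (⟨h1, h2⟩ | ⟨z, hz, rfl⟩)
    · exact ⟨h1, fun h => h2 (h.mono_right (subset_insert _ _))⟩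
    · rw [mem_compl, mem_insert, not_or] at hz
      exact ⟨card_pair hz.1, not_disjoint_iff.2 ⟨v, by simp, mem_insert_self _ _⟩⟩

theorem disjoint_hitFam_sunflower {k : ℕ} {Y K T : Finset α} (hYK : Disjoint Y K)
    (hYT : Disjoint Y T) : Disjoint (hitFam k Y) (sunflower K T) := disjoint_left.2 fun E h1 h2 => by
  obtain ⟨t, ht, rfl⟩ := mem_sunflower.1 h2
  exact (mem_hitFam.1 h1).2 (disjoint_insert_left.2 ⟨disjoint_right.1 hYT ht, hYK.symm⟩)

theorem crossing_sunflower_weight {x : ℝ} {Y T : Finset α} {v t : α} (hv : v ∉ Y)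
    (hT : T ⊆ (insert v Y)ᶜ) (htv : t ∉ insert v Y) (htT : t ∉ T) :
    intWeight x (crossing (hitFam 2 Y ∪ sunflower {v} T) {{v, t}}) =
      (1 + x) ^ (#Y + #T) + (1 + x) ^ #Y - 1 + #Y * x ^ 2 := by
  rw [mem_insert, not_or] at htv
  have hT' : ∀ z ∈ T, z ≠ v ∧ z ∉ Y := fun z hz => by
    have := hT hz
    rwa [mem_compl, mem_insert, not_or] at this
  have hmem : ∀ a z, ({a, z} : Finset α) ∈ hitFam 2 Y ∪ sunflower {v} T ↔
      (a ≠ z ∧ (a ∈ Y ∨ z ∈ Y)) ∨ (a = v ∧ z ∈ T) ∨ (z = v ∧ a ∈ T) := by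
    intro a z
    rw [mem_union, mem_hitFam, mem_sunflower, disjoint_insert_left, disjoint_singleton_left,
      not_and_or, not_not, not_not, card_eq_two]
    constructor
    · rintro (⟨⟨p, q, hpq, he⟩, h⟩ | ⟨w, hw, he⟩)
      · refine Or.inl ⟨?_, h⟩
        rintro rfl
        have := card_pair hpq
        rw [← he] at this
        simp at this
      · right
        have h1 : a ∈ ({w, v} : Finset α) := by rw [he]; simp
        have h2 : z ∈ ({w, v} : Finset α) := by rw [he]; simp
        have h3 : w ∈ ({a, z} : Finset α) := by rw [← he]; simp
        have h4 : v ∈ ({a, z} : Finset α) := by rw [← he]; simp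
        have hwv := (hT' w hw).1
        simp only [mem_insert, mem_singleton] at h1 h2 h3 h4
        rcases h1 with rfl | rfl
        · exact Or.inr ⟨(h4.resolve_left hwv.symm).symm, hw⟩
        · exact Or.inl ⟨rfl, (h3.resolve_left hwv) ▸ hw⟩
    · rintro (⟨h1, h2⟩ | ⟨rfl, h⟩ | ⟨rfl, h⟩)
      · exact Or.inl ⟨⟨a, z, h1, rfl⟩, h2⟩
      · exact Or.inr ⟨z, h, pair_comm _ _⟩
      · exact Or.inr ⟨a, h, rfl⟩
  have hU : ∀ E ∈ hitFam 2 Y ∪ sunflower {v} T, #E = 2 := fun E hE => by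
    rcases mem_union.1 hE with h | h
    · exact (mem_hitFam.1 h).1
    · obtain ⟨z, hz, rfl⟩ := mem_sunflower.1 h
      exact card_pair (hT' z hz).1
  have hn1 : nbr (hitFam 2 Y ∪ sunflower {v} T) v = Y ∪ T := by
    ext z
    rw [mem_nbr, hmem, mem_union]
    constructor
    · rintro (⟨-, h⟩ | ⟨-, h⟩ | ⟨-, h⟩)
      · exact Or.inl (h.resolve_left hv)
      · exact Or.inr h
      · exact absurd rfl (hT' v h).1
    · rintro (h | h)
      · exact Or.inl ⟨fun e => hv (e ▸ h), Or.inr h⟩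
      · exact Or.inr (Or.inl ⟨rfl, h⟩)
  have hn2 : nbr (hitFam 2 Y ∪ sunflower {v} T) t = Y := by
    ext z
    rw [mem_nbr, hmem]
    constructor
    · rintro (⟨-, h⟩ | ⟨h, -⟩ | ⟨-, h⟩)
      · exact h.resolve_left htv.2
      · exact absurd h htv.1
      · exact absurd h htT
    · exact fun h => Or.inl ⟨fun e => htv.2 (e ▸ h), Or.inr h⟩
  have hYT : Disjoint Y T := disjoint_right.2 fun z hz => (hT' z hz).2
  rw [intWeight_crossing_pair hU (Ne.symm htv.1), hn1, hn2, card_union_of_disjoint hYT,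
    inter_eq_right.2 subset_union_left]
  rw [hmem]
  rintro (⟨-, h⟩ | ⟨-, h⟩ | ⟨h, -⟩)
  · exact h.elim hv htv.2
  · exact htT h
  · exact htv.1 h

/-- Among the graphs covered by `ℓ + 1` points which miss few edges, those where the missing edges
share a point are optimal. -/
theorem intWeight_le_of_subset_hitFam_two {x : ℝ} (hx : 0 ≤ x) {W Y : Finset α} {v : α}
    (hv : v ∉ Y) (hW : #W = #Y + 1) (p : ℕ) :
    ∀ (F : Finset (Finset α)) (T : Finset α), F ⊆ hitFam 2 W → #(hitFam 2 W \ F) = p →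
      T ⊆ (insert v Y)ᶜ → p + #T = #((insert v Y)ᶜ) →
      intWeight x F ≤ intWeight x (hitFam 2 Y ∪ sunflower {v} T) := by
  have hvY : #(insert v Y) = #Y + 1 := card_insert_of_notMem hv
  induction p with
  | zero =>
    intro F T hF hp hT hpT
    have hT' : T = (insert v Y)ᶜ := eq_of_subset_of_card_le hT (by omega)
    rw [hT', ← hitFam_two_insert]
    exact (intWeight_mono hx hF).trans (intWeight_hitFam_le hx 2 (by omega))
  | succ p ih =>
    intro F T hF hp hT hpT
    set P := hitFam 2 W \ F with hP
    obtain ⟨t, ht, htT⟩ : ∃ t ∈ (insert v Y)ᶜ, t ∉ T := by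
      by_contra! h
      have := card_le_card h
      omega
    rw [mem_compl] at ht
    -- The induction restores one missing edge on each side and compares links. An edge inside `W`
    -- is preferred, so that an edge leaving `W` is restored only when no edge inside `W` is
    -- missing.
    obtain ⟨e, heP, hmax⟩ : ∃ e ∈ P, e ⊆ W ∨ ∀ e' ∈ P, ¬e' ⊆ W := by
      by_cases h : ∃ e ∈ P, e ⊆ W
      · obtain ⟨e, h1, h2⟩ := h
        exact ⟨e, h1, Or.inl h2⟩
      · push Not at h
        obtain ⟨e, he⟩ := card_pos.1 (by omega : 0 < #P)
        exact ⟨e, he, Or.inr h⟩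
    obtain ⟨heU, heF⟩ := mem_sdiff.1 heP
    obtain ⟨he2, heW⟩ := mem_hitFam.1 heU
    obtain ⟨a, hae, haW⟩ := not_disjoint_iff.1 heW
    obtain ⟨b, hba, rfl⟩ := exists_eq_pair he2 hae
    have hF2 : ∀ E ∈ F, #E = 2 := fun E hE => (mem_hitFam.1 (hF hE)).1
    have hP2 : ∀ E ∈ P, #E = 2 := fun E hE => (mem_hitFam.1 (mem_sdiff.1 hE).1).1
    have hrec := ih (insert {a, b} F) (insert t T) (insert_subset heU hF)
      (by
        rw [sdiff_insert, card_erase_of_mem heP, hp]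
        rfl)
      (insert_subset (mem_compl.2 ht) hT) (by rw [card_insert_of_notMem htT]; omega)
    have hsf : hitFam 2 Y ∪ sunflower {v} (insert t T) =
        insert {v, t} (hitFam 2 Y ∪ sunflower {v} T) := by
      rw [sunflower, image_insert, union_insert, pair_comm]
      rfl
    have hnot : ({v, t} : Finset α) ∉ hitFam 2 Y ∪ sunflower {v} T := by
      rw [mem_insert, not_or] at ht
      rw [mem_union, mem_hitFam, mem_sunflower, not_or]
      refine ⟨fun h => h.2 (by simp [hv, ht.2]), ?_⟩
      rintro ⟨z, hz, he⟩
      have h1 : t ∈ ({z, v} : Finset α) := by rw [he]; simp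
      rw [mem_insert, mem_singleton] at h1
      rcases h1 with h1 | h1
      · exact htT (h1 ▸ hz)
      · exact ht.1 h1
    rw [hsf, intWeight_insert (insert_nonempty _ _) heF, intWeight_insert (insert_nonempty _ _) hnot,
      crossing_sunflower_weight hv hT ht htT, intWeight_crossing_pair hF2 hba.symm heF] at hrec
    suffices h : (1 + x) ^ (#Y + #T) + (1 + x) ^ #Y - 1 + #Y * x ^ 2 ≤
        (1 + x) ^ #(nbr F a) + (1 + x) ^ #(nbr F b) - 1 + #(nbr F a ∩ nbr F b) * x ^ 2 by
      have := mul_le_mul_of_nonneg_left h hx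
      linarith
    have hda : #(nbr F a) + #(nbr P a) = Fintype.card α - 1 := by
      rw [hP, card_nbr_add_card_nbr_sdiff hF, nbr_hitFam_of_mem haW, card_erase_of_mem (mem_univ _),
        card_univ]
    have hPab : #(nbr P a) + #(nbr P b) ≤ p + 2 := by
      have h1 := card_starFam_add_le hP2 hba.symm
      rw [← card_nbr hP2, ← card_nbr hP2] at h1
      have h2 : #(starFam P a ∪ starFam P b) ≤ #P :=
        card_le_card (union_subset (starFam_subset _ _) (starFam_subset _ _))
      omega
    have hPa : 1 ≤ #(nbr P a) := card_pos.2 ⟨b, mem_nbr.2 heP⟩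
    have hPb : 1 ≤ #(nbr P b) := card_pos.2 ⟨a, mem_nbr.2 (pair_comm a b ▸ heP)⟩
    have hcompl : #((insert v Y)ᶜ) = Fintype.card α - (#Y + 1) := by rw [card_compl, hvY]
    have hYn : #Y + 1 ≤ Fintype.card α := hvY ▸ card_le_univ _
    have hμ : (1 : ℝ) ≤ 1 + x := by linarith
    -- If both ends lie in `W`, together they have at most `p + 2` missing edges, counting `{a, b}`
    -- twice. Hence both degrees are large, and so is the common neighbourhood, because neither end
    -- is a neighbour of `a` or `b`.
    by_cases hbW : b ∈ W
    · have hdb : #(nbr F b) + #(nbr P b) = Fintype.card α - 1 := by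
        rw [hP, card_nbr_add_card_nbr_sdiff hF, nbr_hitFam_of_mem hbW,
          card_erase_of_mem (mem_univ _), card_univ]
      have hun : #(nbr F a ∪ nbr F b) ≤ Fintype.card α - 2 := by
        have : nbr F a ∪ nbr F b ⊆ ({a, b} : Finset α)ᶜ := by
          have hself : ∀ c, c ∉ nbr F c := fun c h => by
            have := hF2 _ (mem_nbr.1 h)
            simp at this
          intro z hz
          rw [mem_compl, mem_insert, mem_singleton, not_or]
          rcases mem_union.1 hz with h | h
          · exact ⟨fun e => hself a (e ▸ h), fun e => heF (e ▸ mem_nbr.1 h)⟩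
          · exact ⟨fun e => heF (by rw [pair_comm]; exact e ▸ mem_nbr.1 h),
              fun e => hself b (e ▸ h)⟩
        have := card_le_card this
        rwa [card_compl, card_pair hba.symm] at this
      have hui := card_union_add_card_inter (nbr F a) (nbr F b)
      have h1 : (1 + x) ^ (#Y + #T) ≤ (1 + x) ^ #(nbr F a) := pow_le_pow_right₀ hμ (by omega)
      have h2 : (1 + x) ^ #Y ≤ (1 + x) ^ #(nbr F b) := pow_le_pow_right₀ hμ (by omega)
      have h3 : (#Y : ℝ) ≤ #(nbr F a ∩ nbr F b) := by exact_mod_cast (by omega)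
      have h4 : (#Y : ℝ) * x ^ 2 ≤ #(nbr F a ∩ nbr F b) * x ^ 2 := by gcongr
      linarith
    -- If `b ∉ W`, all neighbours of `b` lie in `W`, and no edge inside `W` is missing, so they are
    -- neighbours of `a` too. What `b` lost beyond `{a, b}` is gained in the bound for `a`.
    · have hdb : #(nbr F b) + #(nbr P b) = #Y + 1 := by
        rw [hP, card_nbr_add_card_nbr_sdiff hF, nbr_hitFam_of_notMem hbW, hW]
      have hnoWW := hmax.resolve_left fun h => hbW (h (by simp))
      have hint : nbr F a ∩ nbr F b = nbr F b := by
        refine inter_eq_right.2 fun z hz => ?_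
        have hzF := mem_nbr.1 hz
        have hzW : z ∈ W := by
          have := (mem_hitFam.1 (hF hzF)).2
          rw [disjoint_insert_left, disjoint_singleton_left, not_and_or, not_not, not_not] at this
          exact this.resolve_left hbW
        have hza : z ≠ a := fun e => heF (by rw [pair_comm]; exact e ▸ hzF)
        rw [mem_nbr]
        by_contra hcon
        refine hnoWW {a, z} (mem_sdiff.2 ⟨mem_hitFam.2 ⟨card_pair hza.symm,
          not_disjoint_iff.2 ⟨a, mem_insert_self _ _, haW⟩⟩, hcon⟩) ?_
        exact insert_subset haW (singleton_subset_iff.2 hzW)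
      rw [hint]
      exact pair_weight_le hx (j := #(nbr P b) - 1) (by omega) (by omega)

end CoveredGraph

/-! ### Assembly -/

section Main

variable {α : Type*} [Fintype α] [DecidableEq α]

theorem card_hitFam_eq {k : ℕ} {Y Y' : Finset α} (h : #Y = #Y') :
    #(hitFam k Y) = #(hitFam k Y') := by
  have h1 := card_hitFam_add k Y
  have h2 := card_hitFam_add k Y'
  rw [h] at h1
  omega

/-- Graphs with `ℓ` nearly full stars. -/
theorem intWeight_le_of_nearly_full_two {x : ℝ} (hx : 0 ≤ x) {F : Finset (Finset α)} {D : ℕ}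
    {Y Y' T : Finset α} {v₀ : α} (hYne : Y.Nonempty)
    (hn : sunflowerThreshold 2 #Y ≤ Fintype.card α) (hF : ∀ E ∈ F, #E = 2)
    (hYY' : #Y = #Y') (hv₀ : v₀ ∉ Y') (hYT : Disjoint Y' T) (hvT : v₀ ∉ T)
    (hcard : #F = #(hitFam 2 Y) + #T)
    (hY : ∀ y ∈ Y, supCard (Fintype.card α) 2 1 ≤ #(starFam F y) + D)
    (hbig : 6 * #Y + 2 * (#T + #Y * D) + 6 + 3 * D ≤ 3 * supCard (Fintype.card α) 2 1) :
    intWeight x F ≤ intWeight x (hitFam 2 Y' ∪ sunflower {v₀} T) := by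
  set U := hitFam 2 Y with hU
  have hs := card_hitFam_sdiff_le hY hF
  have hQc := card_sdiff_hitFam hcard
  rw [← hU] at hs hQc
  set Q := F \ U with hQ
  have hQ2 : ∀ E ∈ Q, #E = 2 := fun E hE => hF E (mem_sdiff.1 hE).1
  have hQY : ∀ A ∈ Q, Disjoint A Y := fun A hA => by
    by_contra h
    exact (mem_sdiff.1 hA).2 (mem_hitFam.2 ⟨hQ2 A hA, h⟩)
  -- For `k = 2` the remainder `Q` can be as large as a star, so its size is too weak a bound on the
  -- number of edges meeting a stray edge. An edge of `Q` missing the vertex `v` of largest degree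
  -- in `Q` meets at most about two thirds of `Q`, so only such edges are exchanged.
  obtain ⟨v, -, hvmax⟩ := exists_max_image (univ : Finset α) (fun a => #(starFam Q a))
    ⟨hYne.choose, mem_univ _⟩
  have hsplit : #(starFam Q v) + #{E ∈ Q | v ∉ E} = #Q :=
    card_filter_add_card_filter_not (fun E => v ∈ E)
  obtain ⟨B, hB, hBc⟩ := exists_subset_card_eq
    (min_le_right #(U \ F) #{E ∈ Q | v ∉ E})
  obtain ⟨P, hP, hPc⟩ := exists_subset_card_eq
    (min_le_left #(U \ F) #{E ∈ Q | v ∉ E})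
  have hBQ : B ⊆ Q := hB.trans (filter_subset _ _)
  have hBF : B ⊆ F := hBQ.trans sdiff_subset
  have hPF : Disjoint P F := disjoint_sdiff_self_left.mono_left hP
  have hN2 : supCard (Fintype.card α) 2 2 = 1 := by simp [supCard]
  have hexch : intWeight x F ≤ intWeight x (F \ B ∪ P) := by
    refine intWeight_le_exchange hx (Y := Y)
      (g := 2 * #Y + (2 * (#T + #Y * D) + 6) / 3) (by omega) hPF
      (fun A hA => hQY A (hBQ hA)) (fun A hA => (mem_hitFam.1 (sdiff_subset (hP hA))).2) ?_ ?_
    · intro A hA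
      have hAQ := hBQ hA
      have hvA : v ∉ A := (mem_filter.1 (hB hA)).2
      obtain ⟨a, b, hab, rfl⟩ := card_eq_two.1 (hQ2 A hAQ)
      rw [mem_insert, mem_singleton, not_or] at hvA
      have h1 : #{E ∈ F | E ≠ {a, b} ∧ ¬Disjoint E {a, b}} ≤
          #{E ∈ U | ¬Disjoint E {a, b}} + #(starFam Q a ∪ starFam Q b) := by
        refine (card_le_card fun E hE => ?_).trans (card_union_le _ _)
        obtain ⟨h1, h2, h3⟩ := mem_filter.1 hE
        by_cases hEU : E ∈ U
        · exact mem_union_left _ (mem_filter.2 ⟨hEU, h3⟩)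
        · have hEQ : E ∈ Q := mem_sdiff.2 ⟨h1, hEU⟩
          rw [disjoint_insert_right, disjoint_singleton_right, not_and_or, not_not, not_not] at h3
          refine mem_union_right _ (mem_union.2 ?_)
          exact h3.imp (fun h => mem_starFam.2 ⟨hEQ, h⟩) fun h => mem_starFam.2 ⟨hEQ, h⟩
      have h2 := card_hitFam_not_disjoint_le 2 (hQY _ hAQ)
      rw [card_pair hab, hN2, ← hU] at h2
      have h3 := card_union_le (starFam Q a) (starFam Q b)
      have h4 := card_starFam_add_add_le hQ2 hab (Ne.symm hvA.1) (Ne.symm hvA.2)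
      have h5 := hvmax a (mem_univ _)
      have h6 := hvmax b (mem_univ _)
      omega
    · intro y hy
      have := hY y hy
      omega
  refine hexch.trans ?_
  -- Either all missing edges of the stars are restored and the remainder comparison applies, or the
  -- edges avoiding `v` run out first and the graph is covered by `insert v Y`.
  rcases le_or_gt #(U \ F) #{E ∈ Q | v ∉ E} with hle | hlt
  · rw [min_eq_left hle] at hBc hPc
    have hP' : P = U \ F := eq_of_subset_of_card_le hP hPc.ge
    have heq : F \ B ∪ P = U ∪ Q \ B := by
      rw [hP', hQ]
      ext E
      simp only [mem_union, mem_sdiff]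
      have h1 : E ∈ B → E ∈ F ∧ E ∉ U := fun h => mem_sdiff.1 (hBQ h)
      tauto
    rw [heq]
    refine intWeight_hitFam_union_le hx le_rfl hYne hn
      (fun A hA => ⟨hQ2 A (sdiff_subset hA), hQY A (sdiff_subset hA)⟩) hYY' (by simp)
      (disjoint_singleton_right.2 hv₀) hYT (disjoint_singleton_left.2 hvT) ?_
    rw [card_sdiff_of_subset hBQ]
    omega
  · rw [min_eq_right hlt.le] at hBc hPc
    have hB' : B = {E ∈ Q | v ∉ E} := eq_of_subset_of_card_le hB hBc.ge
    have hvY : v ∉ Y := fun hvY => by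
      have : starFam Q v = ∅ := eq_empty_of_forall_notMem fun E hE => by
        obtain ⟨h1, h2⟩ := mem_starFam.1 hE
        exact disjoint_left.1 (hQY E h1) h2 hvY
      rw [this, card_empty] at hsplit
      omega
    have hsub : F \ B ∪ P ⊆ hitFam 2 (insert v Y) := by
      refine union_subset (fun E hE => ?_) (fun E hE => ?_)
      · obtain ⟨h1, h2⟩ := mem_sdiff.1 hE
        refine mem_hitFam.2 ⟨hF E h1, ?_⟩
        by_cases hEU : E ∈ U
        · exact fun h => (mem_hitFam.1 hEU).2 (h.mono_right (subset_insert _ _))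
        · refine not_disjoint_iff.2 ⟨v, ?_, mem_insert_self _ _⟩
          by_contra hvE
          exact h2 (hB' ▸ mem_filter.2 ⟨mem_sdiff.2 ⟨h1, hEU⟩, hvE⟩)
      · obtain ⟨h1, h2⟩ := mem_hitFam.1 (sdiff_subset (hP hE))
        exact mem_hitFam.2 ⟨h1, fun h => h2 (h.mono_right (subset_insert _ _))⟩
    have hFc : #(F \ B ∪ P) = #U + #T := by
      rw [card_union_of_disjoint (hPF.symm.mono_left sdiff_subset), card_sdiff_of_subset hBF]
      have := card_le_card hBF
      omega
    have hWc : #(hitFam 2 (insert v Y)) = #U + #((insert v Y)ᶜ) := by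
      have hdv : Disjoint Y {v} := disjoint_singleton_right.2 hvY
      have hdc : Disjoint Y (insert v Y)ᶜ := disjoint_right.2 fun z hz h =>
        mem_compl.1 hz (mem_insert_of_mem h)
      have hdvc : Disjoint {v} (insert v Y)ᶜ := disjoint_singleton_left.2 fun h =>
        mem_compl.1 h (mem_insert_self _ _)
      rw [hitFam_two_insert, card_union_of_disjoint (disjoint_hitFam_sunflower hdv hdc),
        card_sunflower hdvc]
    have hcc : #((insert v Y)ᶜ) = #((insert v₀ Y')ᶜ) := by
      rw [card_compl, card_compl, card_insert_of_notMem hvY, card_insert_of_notMem hv₀, hYY']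
    have hle' := card_le_card hsub
    refine intWeight_le_of_subset_hitFam_two hx hv₀ (W := insert v Y)
      (by rw [card_insert_of_notMem hvY, hYY']) _ _ T hsub rfl ?_ ?_
    · intro z hz
      rw [mem_compl, mem_insert, not_or]
      exact ⟨fun e => hvT (e ▸ hz), disjoint_right.1 hYT hz⟩
    · rw [card_sdiff_of_subset hsub]
      omega

/-- The size of the ground set beyond which the extremal family is known. -/
def groundThreshold (k ℓ : ℕ) : ℕ :=
  sunflowerThreshold k ℓ + stabilityThreshold k ℓ (12 * (ℓ + 1)) + 2 * (ℓ * k + k + 2) * k +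
    12 * ℓ + 14

omit [Fintype α] in
theorem sunflower_intersecting {K T : Finset α} (hK : K.Nonempty) :
    (sunflower K T : Set (Finset α)).Intersecting := by
  obtain ⟨c, hc⟩ := hK
  intro A hA B hB
  obtain ⟨t, -, rfl⟩ := mem_sunflower.1 (mem_coe.1 hA)
  obtain ⟨t', -, rfl⟩ := mem_sunflower.1 (mem_coe.1 hB)
  exact not_disjoint_iff.2 ⟨c, mem_insert_of_mem hc, mem_insert_of_mem hc⟩

/-- The union of `ℓ` full stars and a sunflower maximises the generating function of intersecting
subfamilies. -/
theorem intWeight_le_hitFam_union_sunflower {x : ℝ} (hx : 0 ≤ x) {k : ℕ} (hk : 2 ≤ k)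
    {Y K T : Finset α} (hYne : Y.Nonempty) (hn : groundThreshold k #Y ≤ Fintype.card α)
    (hK : #K + 1 = k) (hYK : Disjoint Y K) (hYT : Disjoint Y T) (hKT : Disjoint K T)
    {F : Finset (Finset α)} (hF : ∀ E ∈ F, #E = k)
    (hcard : #F = #(hitFam k Y ∪ sunflower K T)) :
    intWeight x F ≤ intWeight x (hitFam k Y ∪ sunflower K T) := by
  set n := Fintype.card α with hnn
  set N := supCard n k 1 with hN
  set ℓ := #Y with hℓ
  have hℓ1 : 1 ≤ ℓ := card_pos.2 hYne
  -- This keeps the total defect `(ℓ + 1) * D` of the nearly full stars within `N / 12`.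
  set q := 12 * (ℓ + 1) with hq
  set D := N / q with hD
  rw [groundThreshold, ← hq] at hn
  have hkn : k + 2 ≤ n := by
    have : k + 2 ≤ sunflowerThreshold k ℓ := by
      rw [sunflowerThreshold]
      omega
    omega
  have hd := disjoint_hitFam_sunflower (k := k) hYK hYT
  have hKne : K.Nonempty := card_pos.1 (by omega)
  have hRk : ∀ E ∈ sunflower K T, #E = k := fun E hE => by
    obtain ⟨t, ht, rfl⟩ := mem_sunflower.1 hE
    rw [card_insert_of_notMem (disjoint_right.1 hKT ht), hK]
  have hTc : #(sunflower K T) = #T := card_sunflower hKT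
  have hRN : #(sunflower K T) ≤ N := by
    obtain ⟨c, hc⟩ := hKne
    refine le_trans (card_le_card fun E hE => mem_starFam.2 ⟨hE, ?_⟩) (card_starFam_le hRk c)
    obtain ⟨t, ht, rfl⟩ := mem_sunflower.1 hE
    exact mem_insert_of_mem hc
  rw [hTc] at hRN
  by_cases hfew : #{a | N - N / q < #(starFam F a)} < ℓ
  · exact intWeight_le_of_few_full_stars hx hk hℓ1 (q := q) (by omega) (by omega) hF rfl hd
      (sunflower_intersecting hKne) hRk (hTc.trans_le hRN) hcard hfew
  rw [not_lt] at hfew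
  obtain ⟨Z, hZ, hZc⟩ := exists_subset_card_eq hfew
  have hZne : Z.Nonempty := card_pos.1 (by omega)
  have hqD : 12 * ((ℓ + 1) * D) ≤ N := by
    rw [← mul_assoc]
    exact Nat.mul_div_le N q
  have hℓD : (ℓ + 1) * D = ℓ * D + D := by ring
  have hZstar : ∀ y ∈ Z, N ≤ #(starFam F y) + D := fun y hy => by
    have := (mem_filter.1 (hZ hy)).2
    omega
  have hcardZ : #F = #(hitFam k Z) + #T := by
    rw [hcard, card_union_of_disjoint hd, hTc, card_hitFam_eq hZc]
  obtain rfl | hk3 : k = 2 ∨ 3 ≤ k := by omega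
  · obtain ⟨v₀, rfl⟩ := card_eq_one.1 (by omega : #K = 1)
    have hN1 : N = n - 1 := by simp [hN, supCard]
    refine intWeight_le_of_nearly_full_two hx hZne (by rw [hZc]; omega) hF hZc
      (disjoint_singleton_right.1 hYK) hYT (disjoint_singleton_left.1 hKT) hcardZ hZstar ?_
    rw [hZc, ← hnn, ← hN]
    omega
  · have hN2 : n - 2 ≤ k * supCard n k 2 := le_mul_supCard (by omega) (by omega)
    have hN21 : 1 ≤ supCard n k 2 := one_le_supCard hk (by omega)
    have hA : 2 * (ℓ * k + k + 2) * supCard n k 2 ≤ N :=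
      mul_supCard_succ_le (by omega) (by omega) (by omega)
    have hA' : 2 * (ℓ * (k * supCard n k 2)) + 2 * (k * supCard n k 2) + 4 * supCard n k 2 ≤ N := by
      refine le_trans (le_of_eq ?_) hA
      ring
    -- For `k ≥ 3` the remainder has at most `n` sets, and `n - 2 ≤ k * supCard n k 2` makes that
    -- negligible against `N`.
    have hTn : #T ≤ n := card_le_univ T
    obtain ⟨R, hR, hRc, hle⟩ := exists_full_of_nearly_full hx hF hcardZ hZstar (by
      rw [hZc, ← hnn, ← hN]
      omega)
    exact hle.trans (intWeight_hitFam_union_le hx hk hZne (by rw [hZc]; omega) hR hZc hK hYK hYT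
      hKT hRc)

end Main

theorem corollary1p5 (k ℓ : ℕ) (hk : 1 ≤ k) :
    ∃ n₀ : ℕ, ∀ n m : ℕ, n₀ ≤ n →
      (n.choose k : ℤ) - ((n - ℓ).choose k : ℤ) ≤ (m : ℤ) →
      (m : ℤ) ≤ (n.choose k : ℤ) - ((n - ℓ).choose k : ℤ) + (n : ℤ) - (ℓ : ℤ) - (k : ℤ) + 1 →
      ∀ p : unitInterval, IsMostProbablyIntersecting k m p (lexInitialSegment n k m) := by
  refine ⟨groundThreshold k ℓ + ℓ + k, fun n m hn hm₁ hm₂ p => ?_⟩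
  obtain ⟨hm, Y, K, T, hY, hK, hYK, hYT, hKT, hL⟩ :=
    lexInitialSegment_eq_union (n := n) (m := m) (ℓ := ℓ) hk (by omega) (by omega) (by omega)
  have hLc := card_lexInitialSegment hm
  have hLk : ∀ E ∈ lexInitialSegment n k m, #E = k := fun E hE =>
    mem_powersetCard_univ.1 (mem_filter.1 hE).1
  refine ⟨mem_powersetCard.2 ⟨filter_subset _ _, hLc⟩, fun F hF => ?_⟩
  obtain ⟨hFk, hFc⟩ := mem_powersetCard.1 hF
  have hFk' : ∀ E ∈ F, #E = k := fun E hE => mem_powersetCard_univ.1 (hFk hE)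
  refine probIntersecting_le_of_intWeight_le (hFc.trans hLc.symm) (fun x hx => ?_) p
  obtain rfl | hk2 : k = 1 ∨ 2 ≤ k := by omega
  -- For `k = 1` only equal singletons meet, so any injection preserves intersecting pairs.
  · obtain ⟨φ, hφ, hinj⟩ := exists_mapsTo_injOn_of_card_le (hFc.trans hLc.symm).le id
    refine intWeight_le_of_injOn hx φ hφ hinj fun A hA B hB hAB => ?_
    obtain ⟨a, rfl⟩ := card_eq_one.1 (hFk' A hA)
    obtain ⟨b, rfl⟩ := card_eq_one.1 (hFk' B hB)
    rw [disjoint_singleton, not_not] at hAB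
    rw [hAB, disjoint_self_iff_empty, ← card_eq_zero, hLk _ (hφ _ hB)]
    exact one_ne_zero
  rcases Y.eq_empty_or_nonempty with rfl | hYne
  -- For `ℓ = 0` the whole segment is a sunflower with nonempty kernel, so all of its subfamilies
  -- are intersecting.
  · have hLint : (lexInitialSegment n k m : Set (Finset (Fin n))).Intersecting := by
      rw [hL]
      have : hitFam k (∅ : Finset (Fin n)) = ∅ := by simp [hitFam]
      rw [this, empty_union]
      exact sunflower_intersecting (card_pos.1 (by omega))
    rw [intWeight_of_intersecting x hLint, hLc, ← hFc]
    exact intWeight_le_pow hx F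
  · rw [hL]
    refine intWeight_le_hitFam_union_sunflower hx hk2 hYne (by rw [hY, Fintype.card_fin]; omega) hK
      hYK hYT hKT hFk' ?_
    rw [← hL, hLc, hFc]
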